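/- Let $\mathbb{B}=\mathrm{Hom}(\mathbb{R},S^1)$ be the Bohr compactification of $\mathbb{R}$ (all group homomorphisms, topology of pointwise convergence), with its normalized Haar measure; $E$ and $\mathrm{Cov}[X,Y]=E[X\overline{Y}]-E[X]\overline{E[Y]}$ refer to this probability space. For $k\in\mathbb{R}$ let $\hat T_k\in C(\mathbb{B})$ be $\hat T_k(\chi)=\chi(k)$, and let $\Lambda$ be the von Mangoldt function. For $f\in C_c^\infty((0,\infty),\mathbb{C})$ let $M(f)(s)=\int_0^\infty f(x)x^{s}\frac{dx}{x}$, $f^*(x)=\frac1x f(\frac1x)$, and let $g=f*\bar f^*$ be the multiplicative convolution, $g(x)=\int_0^\infty f(y)\,\bar f^*(x/y)\frac{dy}{y}$. The Weil sum is $$W(g)=\sum_{p\le\infty}W_p(g),\qquad W_p(g)=\frac1{2\pi i}\int_{1/2-i\infty}^{1/2+i\infty}M(g)(s)\,d\log\frac{\zeta_p(1-s)}{\zeta_p(s)},$$ where $\zeta_p(s)=(1-p^{-s})^{-1}$ for a prime $p$ and $\zeta_\infty(s)=\pi^{-s/2}\Gamma(s/2)$. Let $I$ be a finite set of primes such that $g(p^k)=0$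 for all primes $p\notin I$ and all integers $k\ne0$. For $q\in(0,1)$ put $$\mathcal M_{I,q}(g)=\sum_{p\in I}\ \sum_{k\in\mathbb{Z},\,k\neq 0} g(p^{-k})p^{-k/2}\,\hat T_{\log p^{-k}}+\sum_{k\in\mathbb{Z}}g(q^k)q^{k/2}\,\hat T_{\log q^k},$$ and let $\mathfrak W_{I,q}$ be the bounded operator on $L^2(\mathbb{B})$ of multiplication by the continuous function $$\log\pi+\log(1-q^2)+\log q^{-1}\sum_{k\ne0}\frac{q^{|k|/2}}{1-q^{2|k|}}\hat T_{k\log q}+\sum_{p\in I}2\,\mathrm{Re}\sum_{k\ge1}\Lambda(p^k)p^{-k/2}\,\hat T_{\log p^{-k}}.$$ Call $q\in(0,1)$ admissible for $I$ if $\log q/\log p$ is irrational for every $p\in I$. The point $1$ is a limit point of the admissible $q$. (1) For all $f$ and $I$ as above, $$E[\mathcal M_{I,q}(f*\bar f^*)\cdot\mathfrak W_{I,q}\mathbf 1]\longrightarrow W(f*\bar f^*)\qquad\text{as } q\to1 \text{ through admissible values.}$$ (2) The Riemann hypothesis holds if and only if for all $f$ and $I$ as above with $M(f)(0)=M(f)(1)=0$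 there is a sequence of admissible $q$ converging to $1$ along which $$E[\mathcal M_{I,q}(f*\bar f^*)\cdot\mathfrak W_{I,q}\mathbf 1]\le0 .$$ (3) The Riemann hypothesis holds if and only if for all $f$ and $I$ as above with $M(f)(0)=M(f)(1)=0$ there is a sequence of admissible $q$ converging to $1$ along which $$\mathrm{Cov}[\mathcal M_{I,q}(f*\bar f^*),\mathfrak W_{I,q}\mathbf 1]\le\|f\|_{L^2(G_q)}^2\,\log\frac{(1-q)^{-1}}{2\pi},\qquad \|f\|_{L^2(G_q)}^2=(1-q)\sum_{k\in\mathbb{Z}}|f(q^k)|^2q^k .$$ (The expectations and covariances in (2) and (3) are real numbers.) -/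

import Mathlib

open MeasureTheory Filter Topology
open scoped ENNReal ContDiff

noncomputable section

namespace BohrWeil

/-! ### The Bohr space -/

/-- All (not necessarily continuous) homomorphisms from `(ℝ, +)` to the unit circle, as a subgroup
of the product of copies of the circle indexed by `ℝ`. -/
def bohrSubgroup : Subgroup (ℝ → Circle) where
  carrier := {X | ∀ k l : ℝ, X (k + l) = X k * X l}
  mul_mem' := by
    intro X Y hX hY k l
    simp only [Pi.mul_apply, hX k l, hY k l]
    exact mul_mul_mul_comm _ _ _ _
  one_mem' := by
    intro k l
    simp
  inv_mem' := by
    intro X hX k l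
    simp only [Pi.inv_apply, hX k l, mul_inv]

/-- The Bohr compactification `𝔹 = Hom(ℝ, S¹)` of the real line. -/
def Bohr : Type := bohrSubgroup

namespace Bohr

instance : CommGroup Bohr := inferInstanceAs (CommGroup bohrSubgroup)

/-- The topology induced by the product topology. -/
instance : TopologicalSpace Bohr := inferInstanceAs (TopologicalSpace bohrSubgroup)

instance : IsTopologicalGroup Bohr := inferInstanceAs (IsTopologicalGroup bohrSubgroup)

instance : T2Space Bohr := inferInstanceAs (T2Space bohrSubgroup)

instance : CompactSpace Bohr := by
  have h : IsClosed (bohrSubgroup : Set (ℝ → Circle)) := by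
    have : (bohrSubgroup : Set (ℝ → Circle)) =
        ⋂ k : ℝ, ⋂ l : ℝ, {X : ℝ → Circle | X (k + l) = X k * X l} := by
      ext X
      simp [bohrSubgroup]
    rw [this]
    exact isClosed_iInter fun k => isClosed_iInter fun l =>
      isClosed_eq (continuous_apply (k + l)) ((continuous_apply k).mul (continuous_apply l))
  exact isCompact_iff_compactSpace.mp h.isCompact

instance : MeasurableSpace Bohr := borel Bohr

instance : BorelSpace Bohr := ⟨rfl⟩

/-- The normalized Haar measure of the Bohr compactification. -/
def haar : Measure Bohr := Measure.haarMeasure ⊤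

instance : IsProbabilityMeasure haar :=
  ⟨Measure.haarMeasure_self (K₀ := (⊤ : TopologicalSpace.PositiveCompacts Bohr))⟩

/-- The continuous function `χ ↦ χ(T_k)` on the Bohr compactification, the lift of the almost
periodic function `T_k(x) = exp (i k x)`. -/
def T (k : ℝ) : C(Bohr, ℂ) where
  toFun χ := ((χ.1 k : Circle) : ℂ)
  continuous_toFun :=
    continuous_subtype_val.comp ((continuous_apply k).comp continuous_subtype_val)

end Bohr

/-- The expectation of a complex random variable on the Bohr space. -/
def expect (X : Bohr → ℂ) : ℂ := ∫ χ, X χ ∂Bohr.haar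

/-- The covariance `E[X * conj Y] - E[X] * conj E[Y]` of two complex random variables. -/
def covar (X Y : Bohr → ℂ) : ℂ :=
  expect (fun χ => X χ * (starRingEnd ℂ) (Y χ)) - expect X * (starRingEnd ℂ) (expect Y)

/-! ### Test functions, involution and convolution -/

/-- `f` is a smooth complex function with compact support in `(0, ∞)`, extended by zero. -/
structure IsTest (f : ℝ → ℂ) : Prop where
  smooth : ContDiff ℝ ∞ f
  compact : HasCompactSupport f
  support : tsupport f ⊆ Set.Ioi 0

/-- The function `x ↦ conj (f^* (x))`, where `f^*(x) = x⁻¹ f(x⁻¹)`. -/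
def starConj (f : ℝ → ℂ) (x : ℝ) : ℂ := (x⁻¹ : ℝ) * (starRingEnd ℂ) (f x⁻¹)

/-- Multiplicative convolution on `(0, ∞)` for the Haar measure `dy / y`. -/
def mulConv (f h : ℝ → ℂ) (x : ℝ) : ℂ :=
  ∫ y in Set.Ioi (0 : ℝ), f y * h (x / y) * ((y⁻¹ : ℝ) : ℂ)

/-- The function `f * conj f^*`. -/
def autoConv (f : ℝ → ℂ) : ℝ → ℂ := mulConv f (starConj f)

/-- The class of functions attached to the finite set `I` of primes: `g` vanishes at the powers
`p ^ k`, `k ≠ 0`, of all primes `p` outside `I`. -/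
def InClass (I : Finset Nat.Primes) (g : ℝ → ℂ) : Prop :=
  ∀ p : Nat.Primes, p ∉ I → ∀ k : ℤ, k ≠ 0 → g (((p : ℕ) : ℝ) ^ k) = 0

/-! ### The Weil sum -/

/-- The term `(1 / (2 π i)) ∫_{Re s = 1/2} M(f)(s) d log (Z(1 - s) / Z(s))` of the Weil sum for a
local zeta factor `Z`, with `s = 1/2 + i t`. -/
def weilTerm (Z : ℂ → ℂ) (f : ℝ → ℂ) : ℂ :=
  ((1 / (2 * Real.pi) : ℝ) : ℂ) *
    ∫ t : ℝ, mellin f (1 / 2 + t * Complex.I) *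
      logDeriv (fun s => Z (1 - s) / Z s) (1 / 2 + t * Complex.I)

/-- The local zeta factor `(1 - p ^ (-s))⁻¹`. -/
def zetaFactor (p : ℕ) (s : ℂ) : ℂ := (1 - (p : ℂ) ^ (-s))⁻¹

/-- The Weil sum over all places of `ℚ`; the archimedean factor is
`Gammaℝ s = π ^ (-s / 2) * Γ(s / 2)`. -/
def weilSum (f : ℝ → ℂ) : ℂ :=
  weilTerm Complex.Gammaℝ f + ∑' p : Nat.Primes, weilTerm (zetaFactor p) f

/-! ### Random variables on the Bohr space -/

/-- The random variable `M_r(f)(1/2, χ) = ∑_{k ∈ ℤ} f(r ^ k) r ^ (k / 2) χ(T_{k log r})`. For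
`r = p⁻¹` it is the `p`-adic Mellin transform, for `r = q` the `q`-Mellin transform. -/
def latticeMellin (r : ℝ) (f : ℝ → ℂ) : C(Bohr, ℂ) :=
  ∑' k : ℤ, (f (r ^ k) * ((r ^ ((k : ℝ) / 2) : ℝ) : ℂ)) • Bohr.T (k * Real.log r)

/-- The finite part: the sum over `p ∈ I` of the `p`-adic Mellin transforms, without their common
terms `k = 0`, which are the constant `f 1`. -/
def finMellin (I : Finset Nat.Primes) (f : ℝ → ℂ) : C(Bohr, ℂ) :=
  ∑ p ∈ I, (latticeMellin (((p : ℕ) : ℝ)⁻¹) f - f 1 • (1 : C(Bohr, ℂ)))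

/-- The random variable `M_{I,q}(f) = M_fin(f) + M_q(f)`. The lattice point `1`, which belongs to
`p ^ ℤ` for all `p` and to `q ^ ℤ`, is counted once. -/
def totalMellin (I : Finset Nat.Primes) (q : ℝ) (f : ℝ → ℂ) : C(Bohr, ℂ) :=
  finMellin I f + latticeMellin q f

/-- The extension of `- ζ_p' / ζ_p (1/2 + i t)` to the Bohr space,
`∑_{k ≥ 1} Λ(p ^ k) p ^ (-k / 2) χ(T_{log p ^ (-k)})`. -/
def primeLogDeriv (p : ℕ) : C(Bohr, ℂ) :=
  ∑' k : ℕ, ((ArithmeticFunction.vonMangoldt (p ^ (k + 1)) *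
      (p : ℝ) ^ (-((k : ℝ) + 1) / 2) : ℝ) : ℂ) • Bohr.T (-((k : ℝ) + 1) * Real.log p)

/-- The extension to the Bohr space of `log π - Re ψ_{q²}(1/4 + i t / 2)`, where `ψ_q` is the
`q`-digamma function: `log π + log (1 - q²) + log q⁻¹ ∑_{k ≠ 0} q^{|k|/2} / (1 - q^{2|k|}) q^{ikt}`
with `χ(T_{k log q})` in place of `q^{ikt}`. -/
def archSymbol (q : ℝ) : C(Bohr, ℂ) :=
  ((Real.log Real.pi + Real.log (1 - q ^ 2) : ℝ) : ℂ) • (1 : C(Bohr, ℂ)) +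
    ∑' k : ℤ, (if k = 0 then (0 : ℂ) else
      ((Real.log q⁻¹ * (q ^ (|(k : ℝ)| / 2) / (1 - q ^ (2 * |(k : ℝ)|))) : ℝ) : ℂ)) •
        Bohr.T (k * Real.log q)

/-- The sum of `archSymbol q` and of the twofold real parts of `primeLogDeriv p`, `p ∈ I`. -/
def weilSymbol (I : Finset Nat.Primes) (q : ℝ) : C(Bohr, ℂ) :=
  archSymbol q + ∑ p ∈ I, (primeLogDeriv p + star (primeLogDeriv p))

/-- The bounded operator on `L²(𝔹)` of multiplication by a continuous function. -/
def mulOp (h : C(Bohr, ℂ)) : Lp ℂ 2 Bohr.haar →L[ℂ] Lp ℂ 2 Bohr.haar :=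
  (ContinuousLinearMap.mul ℂ ℂ).holderL Bohr.haar ∞ 2 2 (ContinuousMap.toLp ∞ Bohr.haar ℂ h)

/-- The operator `𝔚_{I,q}` on `L²(𝔹)`. -/
def weilOp (I : Finset Nat.Primes) (q : ℝ) : Lp ℂ 2 Bohr.haar →L[ℂ] Lp ℂ 2 Bohr.haar :=
  mulOp (weilSymbol I q)

/-- The random variable `𝔚_{I,q} 1`. -/
def weilOpOne (I : Finset Nat.Primes) (q : ℝ) : Lp ℂ 2 Bohr.haar :=
  weilOp I q (ContinuousMap.toLp 2 Bohr.haar ℂ (1 : C(Bohr, ℂ)))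

/-- The expected value `E[M_{I,q}(g) · 𝔚_{I,q} 1]`. -/
def weilExpect (I : Finset Nat.Primes) (q : ℝ) (g : ℝ → ℂ) : ℂ :=
  expect (fun χ => totalMellin I q g χ * weilOpOne I q χ)

/-- The covariance `Cov[M_{I,q}(g), 𝔚_{I,q} 1]`. -/
def weilCovar (I : Finset Nat.Primes) (q : ℝ) (g : ℝ → ℂ) : ℂ :=
  covar (fun χ => totalMellin I q g χ) (fun χ => weilOpOne I q χ)

/-- The admissible values of `q` in `(0, 1)`: `log q` and `log p` are rationally independent for
each `p ∈ I`. -/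
def admissible (I : Finset Nat.Primes) : Set ℝ :=
  {q | 0 < q ∧ q < 1 ∧ ∀ p ∈ I, Irrational (Real.log q / Real.log ((p : ℕ) : ℝ))}

/-- The square of the norm of `f` in `L²(G_q)`, `G_q = q ^ ℤ`, for the measure that gives the point
`x ∈ G_q` the mass `(1 - q) x`. -/
def qNormSq (q : ℝ) (f : ℝ → ℂ) : ℝ :=
  ∑' k : ℤ, ‖f (q ^ k)‖ ^ 2 * ((1 - q) * q ^ k)

end BohrWeil

end

noncomputable section

namespace BohrWeil

open Set Asymptotics

/-! ### Mellin transforms of functions supported in a compact interval of `(0, ∞)` -/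

/-! Put g = f * conj f^* and Φ(t) = |M(f)(1/2 + it)|². On the critical line M(g) = Φ, so g(e^u) =
e^{-u/2} φ(u), where φ is the Fourier transform of Φ (`critSq`, `critFourier`). This φ has compact
support, and φ(0) = ∫ |f|². Hence W_p(g) is the sum of Λ(n) n^{-1/2} (φ(log n) + φ(-log n)) over the
powers n = p^k, and the archimedean term is φ(0) log π plus the integral over (0, ∞) of a kernel
whose singularities at 0 cancel (`weilTerm_zetaFactor`, `IsTest.weilTerm_Gammaℝ_eq`).

Convergence. T_k has mean zero for k ≠ 0, so the expectation of a product only pairs opposite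
frequencies. For admissible q, log q and log p are independent over ℚ, and so are the logarithms of
two distinct primes; no mixed pairs occur. The multiples of log p, p in I, give exactly W_p(g). The
multiples of h = -log q, once log(1 - q²) = -∑ q^{2k}/k is distributed over them, give φ(0) log π
plus the Riemann sum of step h of the archimedean kernel (`IsTest.weilExpect_eq`,
`tendsto_riemannSum`). The covariance is the expectation minus φ(0)(log π + log(1 - q²)), and the
squared norm on q^ℤ is φ(0) + O(1 - q), so the covariance minus its proposed upper bound tends to
W(g) as well.

Reduction. Both criteria come from Weil's criterion, that the Riemann hypothesis is equivalent to
W(g) ≤ 0 for all f with M(f)(0) = M(f)(1) = 0. Nonpositivity passes to the limit in one direction.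
In the other, W(g) < 0 is needed for f ≠ 0, so that the approximations are eventually negative
(`weilSum_neg_of_nonpos`): at a null vector of a semidefinite quadratic form the first variation
vanishes, which kills the moments ∫ Φ(t) t^{4m} w(t) dt for every m, and this is absurd because the
weight w tends to -∞.

The Riemann hypothesis implies W ≤ 0 without any sum over zeros. Under it ξ(s - d)/ξ(s + d) is
holomorphic for Re s ≥ 1/2 and of modulus one on the critical line, so Phragmén–Lindelöf bounds it
by 1; letting d → 0 gives Re ξ'/ξ ≥ 0 to the right of the line (`re_logDeriv_xi_nonneg`).
Integrating Φ against ξ'/ξ on Re s = 1/2 + η, moving the line into the region of absolute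
convergence and letting η → 0 gives -π W(g) ≥ 0.

Conversely, Cauchy–Schwarz for the semidefinite form, applied to f and its dilate by x, yields ∑
Λ(n) g(n/x) = O(x^{1/2}) (`norm_mangoldtSum_le`). The Mellin transform of this sum is -(ζ'/ζ) M(g),
which therefore continues to Re s > 1/2; a zero ρ of ζ there with M(g)(ρ) ≠ 0 would be a pole. -/

/-- `f` vanishes outside the interval `[a, b]`. -/
def SuppIn (a b : ℝ) (f : ℝ → ℂ) : Prop := ∀ x, x ∉ Icc a b → f x = 0

lemma SuppIn.mono {a b a' b' : ℝ} {f : ℝ → ℂ} (h : SuppIn a b f) (ha : a' ≤ a) (hb : b ≤ b') :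
    SuppIn a' b' f := fun x hx => h x fun hx' => hx ⟨ha.trans hx'.1, hx'.2.trans hb⟩

lemma SuppIn.bound {a b : ℝ} {f : ℝ → ℂ} (h : SuppIn a b f) (hf : Continuous f) :
    ∃ C, 0 ≤ C ∧ ∀ x, ‖f x‖ ≤ C := by
  obtain ⟨C, hC⟩ := (isCompact_Icc (a := a) (b := b)).exists_bound_of_continuousOn hf.continuousOn
  refine ⟨max C 0, le_max_right _ _, fun x => ?_⟩
  by_cases hx : x ∈ Icc a b
  · exact (hC x hx).trans (le_max_left _ _)
  · rw [h x hx, norm_zero]; exact le_max_right _ _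

lemma SuppIn.isBigO_top {a b : ℝ} {f : ℝ → ℂ} (h : SuppIn a b f) (c : ℝ) :
    f =O[atTop] (fun x : ℝ => x ^ c) := by
  refine IsBigO.of_bound 0 ?_
  filter_upwards [eventually_gt_atTop b] with x hx
  rw [h x fun hx' => absurd hx'.2 (not_le.2 hx)]
  simp

lemma SuppIn.isBigO_zero {a b : ℝ} {f : ℝ → ℂ} (ha : 0 < a) (h : SuppIn a b f) (c : ℝ) :
    f =O[𝓝[>] 0] (fun x : ℝ => x ^ c) := by
  refine IsBigO.of_bound 0 ?_
  filter_upwards [nhdsWithin_le_nhds (Iio_mem_nhds ha)] with x hx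
  rw [h x fun hx' => absurd hx'.1 (not_le.2 hx)]
  simp

lemma SuppIn.mellinConvergent {a b : ℝ} {f : ℝ → ℂ} (ha : 0 < a) (h : SuppIn a b f)
    (hf : Continuous f) (s : ℂ) : MellinConvergent f s :=
  mellinConvergent_of_isBigO_rpow (a := s.re + 1) (b := s.re - 1)
    (hf.locallyIntegrable.locallyIntegrableOn _) (h.isBigO_top _) (by linarith)
    (h.isBigO_zero ha _) (by linarith)

lemma SuppIn.differentiable_mellin {a b : ℝ} {f : ℝ → ℂ} (ha : 0 < a) (h : SuppIn a b f)
    (hf : Continuous f) : Differentiable ℂ (mellin f) := fun s =>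
  mellin_differentiableAt_of_isBigO_rpow (a := s.re + 1) (b := s.re - 1)
    (hf.locallyIntegrable.locallyIntegrableOn _) (h.isBigO_top _) (by linarith)
    (h.isBigO_zero ha _) (by linarith)

lemma norm_mellin_le (f : ℝ → ℂ) (s : ℂ) :
    ‖mellin f s‖ ≤ ∫ x in Ioi (0 : ℝ), x ^ (s.re - 1) * ‖f x‖ := by
  refine (norm_integral_le_integral_norm _).trans (le_of_eq ?_)
  refine setIntegral_congr_fun measurableSet_Ioi fun x hx => ?_
  simp only [norm_smul, Complex.norm_cpow_eq_rpow_re_of_pos hx, Complex.sub_re, Complex.one_re]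

/-! ### Test functions -/

lemma IsTest.exists_suppIn {f : ℝ → ℂ} (hf : IsTest f) : ∃ a b, 0 < a ∧ a ≤ b ∧ SuppIn a b f := by
  rcases (tsupport f).eq_empty_or_nonempty with h | h
  · refine ⟨1, 1, one_pos, le_rfl, fun x _ => ?_⟩
    by_contra hx
    have : x ∈ tsupport f := subset_tsupport f hx
    simp [h] at this
  · obtain ⟨a, ha, hamin⟩ := hf.compact.isCompact.exists_isLeast h
    obtain ⟨b, hb, hbmax⟩ := hf.compact.isCompact.exists_isGreatest h
    refine ⟨a, b, hf.support ha, hbmax ha, fun x hx => ?_⟩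
    by_contra h'
    have : x ∈ tsupport f := subset_tsupport f h'
    exact hx ⟨hamin this, hbmax this⟩

lemma IsTest.of_suppIn {f : ℝ → ℂ} {a b : ℝ} (ha : 0 < a) (hf : ContDiff ℝ ∞ f)
    (h : SuppIn a b f) : IsTest f := by
  have hs : tsupport f ⊆ Icc a b := closure_minimal
    (fun x hx => by by_contra h'; exact hx (h x h')) isClosed_Icc
  exact ⟨hf, isCompact_Icc.of_isClosed_subset (isClosed_tsupport f) hs,
    hs.trans fun x hx => ha.trans_le hx.1⟩

lemma IsTest.continuous {f : ℝ → ℂ} (hf : IsTest f) : Continuous f := hf.smooth.continuous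

/-- The operator `x d/dx`. -/
def eulerD (f : ℝ → ℂ) (x : ℝ) : ℂ := x * deriv f x

lemma SuppIn.eulerD {a b : ℝ} {f : ℝ → ℂ} (h : SuppIn a b f) : SuppIn a b (eulerD f) := by
  intro x hx
  have : f =ᶠ[𝓝 x] fun _ => 0 := by
    filter_upwards [isClosed_Icc.isOpen_compl.mem_nhds hx] with y hy using h y hy
  simp [BohrWeil.eulerD, this.deriv_eq]

lemma contDiff_eulerD {f : ℝ → ℂ} (hf : ContDiff ℝ ∞ f) : ContDiff ℝ ∞ (eulerD f) := by
  have h1 : ContDiff ℝ ∞ (deriv f) := (contDiff_infty_iff_deriv.1 hf).2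
  exact (Complex.ofRealCLM.contDiff).mul h1

/-- Integration by parts; the boundary terms vanish because the function is zero near 0 and near ∞.
It is the source of all decay estimates and of the multiplication of Mellin transforms by
polynomials. -/
lemma mellin_eulerD {a b : ℝ} {f : ℝ → ℂ} (ha : 0 < a) (h : SuppIn a b f)
    (hf : ContDiff ℝ ∞ f) (s : ℂ) : mellin (eulerD f) s = -s * mellin f s := by
  have hd : Differentiable ℝ f := hf.differentiable (by simp)
  have hconv := h.mellinConvergent ha hf.continuous s
  have hconv' := h.eulerD.mellinConvergent ha (contDiff_eulerD hf).continuous s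
  have key : ∫ x in Ioi (0 : ℝ), (x : ℂ) ^ s * deriv f x =
      0 - 0 - ∫ x in Ioi (0 : ℝ), s * (x : ℂ) ^ (s - 1) * f x := by
    refine integral_Ioi_mul_deriv_eq_deriv_mul (fun x hx => ?_) (fun x hx => ?_) ?_ ?_ ?_ ?_
    · rcases eq_or_ne s 0 with rfl | hs
      · simp only [Complex.cpow_zero, zero_mul]
        exact hasDerivAt_const x 1
      · exact hasDerivAt_ofReal_cpow_const (ne_of_gt hx) hs |>.congr_deriv (by ring)
    · exact (hd x).hasDerivAt
    · refine hconv'.congr_fun (fun x hx => ?_) measurableSet_Ioi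
      have hx' : (x : ℂ) ≠ 0 := by exact_mod_cast (ne_of_gt hx)
      simp only [BohrWeil.eulerD, smul_eq_mul, Pi.mul_apply, Complex.cpow_sub _ _ hx',
        Complex.cpow_one]
      field_simp
    · refine IntegrableOn.congr_fun (Integrable.const_mul hconv s) (fun x hx => ?_)
        measurableSet_Ioi
      simp [mul_assoc]
    · refine tendsto_const_nhds.congr' ?_
      filter_upwards [nhdsWithin_le_nhds (Iio_mem_nhds ha)] with x hx
      simp [h x fun hx' => absurd hx'.1 (not_le.2 hx)]
    · refine tendsto_const_nhds.congr' ?_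
      filter_upwards [eventually_gt_atTop b] with x hx
      simp [h x fun hx' => absurd hx'.2 (not_le.2 hx)]
  have e1 : mellin (eulerD f) s = ∫ x in Ioi (0 : ℝ), (x : ℂ) ^ s * deriv f x := by
    refine setIntegral_congr_fun measurableSet_Ioi fun x hx => ?_
    have hx' : (x : ℂ) ≠ 0 := by exact_mod_cast (ne_of_gt hx)
    simp only [BohrWeil.eulerD, smul_eq_mul, Complex.cpow_sub _ _ hx', Complex.cpow_one]
    field_simp
  rw [e1, key, mellin, sub_zero, zero_sub, neg_mul, ← integral_const_mul]
  simp [mul_assoc]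

lemma IsTest.eulerD {f : ℝ → ℂ} (hf : IsTest f) : IsTest (eulerD f) := by
  obtain ⟨a, b, ha, -, h⟩ := hf.exists_suppIn
  exact .of_suppIn ha (contDiff_eulerD hf.smooth) h.eulerD

/-- The Mellin transform on the line `Re s = 1 / 2`. -/
def critMellin (f : ℝ → ℂ) (t : ℝ) : ℂ := mellin f (1 / 2 + t * Complex.I)

lemma IsTest.continuous_critMellin {f : ℝ → ℂ} (hf : IsTest f) : Continuous (critMellin f) := by
  obtain ⟨a, b, ha, -, h⟩ := hf.exists_suppIn
  have := (h.differentiable_mellin ha hf.continuous).continuous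
  unfold critMellin
  fun_prop

/-- Each application of `eulerD` multiplies the transform by -s, and |s| ≥ |t|; the transform itself
is bounded by an absolutely convergent integral. -/
lemma IsTest.critMellin_decay {f : ℝ → ℂ} (hf : IsTest f) (n : ℕ) :
    ∃ C, 0 ≤ C ∧ ∀ t : ℝ, |t| ^ n * ‖critMellin f t‖ ≤ C := by
  induction n generalizing f with
  | zero =>
    refine ⟨∫ x in Ioi (0 : ℝ), x ^ ((1 / 2 : ℝ) - 1) * ‖f x‖, ?_, fun t => ?_⟩
    · exact setIntegral_nonneg measurableSet_Ioi fun x hx =>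
        mul_nonneg (Real.rpow_nonneg (le_of_lt hx) _) (norm_nonneg _)
    · have := norm_mellin_le f (1 / 2 + t * Complex.I)
      simpa [critMellin] using this
  | succ n ih =>
    obtain ⟨C, hC0, hC⟩ := ih hf.eulerD
    obtain ⟨a, b, ha, -, h⟩ := hf.exists_suppIn
    refine ⟨C, hC0, fun t => le_trans ?_ (hC t)⟩
    rw [pow_succ, mul_assoc, critMellin, critMellin, mellin_eulerD ha h hf.smooth, norm_mul,
      norm_neg]
    gcongr
    have := Complex.abs_im_le_norm (1 / 2 + t * Complex.I)
    simpa using this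

/-- The function `t ↦ |M(f)(1/2 + i t)|²`. -/
def critSq (f : ℝ → ℂ) (t : ℝ) : ℝ := ‖critMellin f t‖ ^ 2

lemma critSq_nonneg (f : ℝ → ℂ) (t : ℝ) : 0 ≤ critSq f t := sq_nonneg _

lemma IsTest.continuous_critSq {f : ℝ → ℂ} (hf : IsTest f) : Continuous (critSq f) :=
  hf.continuous_critMellin.norm.pow 2

/-- One of the two factors |M(f)| is merely bounded while the other decays to order n + 2; the two
spare powers provide the integrable majorant. -/
lemma IsTest.critSq_decay {f : ℝ → ℂ} (hf : IsTest f) (n : ℕ) :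
    ∃ C, 0 ≤ C ∧ ∀ t : ℝ, (1 + |t|) ^ n * critSq f t ≤ C * (1 + t ^ 2)⁻¹ := by
  obtain ⟨C₀, h₀, hC₀⟩ := hf.critMellin_decay 0
  obtain ⟨C₁, h₁, hC₁⟩ := hf.critMellin_decay (n + 2)
  refine ⟨2 ^ (n + 2) * (C₀ + C₁) * C₀, by positivity, fun t => ?_⟩
  rw [← div_eq_mul_inv, le_div_iff₀ (by positivity)]
  have hb : ‖critMellin f t‖ ≤ C₀ := by simpa using hC₀ t
  have key : (1 + |t|) ^ (n + 2) * ‖critMellin f t‖ ≤ 2 ^ (n + 2) * (C₀ + C₁) := by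
    rcases le_total |t| 1 with ht | ht
    · have h1 : 1 + |t| ≤ 2 := by linarith
      have h2 : ‖critMellin f t‖ ≤ C₀ + C₁ := by linarith
      gcongr
    · calc (1 + |t|) ^ (n + 2) * ‖critMellin f t‖
          ≤ (2 * |t|) ^ (n + 2) * ‖critMellin f t‖ := by gcongr; linarith
        _ = 2 ^ (n + 2) * (|t| ^ (n + 2) * ‖critMellin f t‖) := by ring
        _ ≤ 2 ^ (n + 2) * (C₀ + C₁) := by gcongr; linarith [hC₁ t]
  have h2 : 1 + t ^ 2 ≤ (1 + |t|) ^ 2 := by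
    have := sq_abs t; nlinarith [abs_nonneg t]
  have h3 := critSq_nonneg f t
  calc (1 + |t|) ^ n * critSq f t * (1 + t ^ 2)
      ≤ (1 + |t|) ^ n * critSq f t * (1 + |t|) ^ 2 := by gcongr
    _ = ((1 + |t|) ^ (n + 2) * ‖critMellin f t‖) * ‖critMellin f t‖ := by rw [critSq]; ring
    _ ≤ 2 ^ (n + 2) * (C₀ + C₁) * C₀ := by gcongr

/-- Integrability of `|M(f)(1/2 + i t)|²` against functions of polynomial growth. -/
lemma IsTest.integrable_critSq_mul {f : ℝ → ℂ} (hf : IsTest f) {E : Type*} [NormedAddCommGroup E]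
    [NormedSpace ℝ E] {S : ℝ → E} (hS : AEStronglyMeasurable S) {K : ℝ} {n : ℕ}
    (hK : ∀ t, ‖S t‖ ≤ K * (1 + |t|) ^ n) : Integrable fun t => critSq f t • S t := by
  obtain ⟨C, h₀, hC⟩ := hf.critSq_decay n
  have hK0 : 0 ≤ K := by
    have := (norm_nonneg _).trans (hK 0)
    simpa using this
  refine (integrable_inv_one_add_sq.const_mul (K * C)).mono'
    (hf.continuous_critSq.aestronglyMeasurable.smul hS) (ae_of_all _ fun t => ?_)
  rw [norm_smul, Real.norm_of_nonneg (critSq_nonneg _ _)]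
  calc critSq f t * ‖S t‖ ≤ critSq f t * (K * (1 + |t|) ^ n) := by
        gcongr; exact critSq_nonneg _ _; exact hK t
    _ = K * ((1 + |t|) ^ n * critSq f t) := by ring
    _ ≤ K * (C * (1 + t ^ 2)⁻¹) := mul_le_mul_of_nonneg_left (hC t) hK0
    _ = _ := by ring

lemma IsTest.integrable_critSq {f : ℝ → ℂ} (hf : IsTest f) : Integrable (critSq f) := by
  simpa using hf.integrable_critSq_mul (S := fun _ => (1 : ℝ)) (K := 1) (n := 0)
    aestronglyMeasurable_const (by simp)

/-! ### Multiplicative convolution -/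

lemma SuppIn.integrableOn_mul {a b : ℝ} {f k : ℝ → ℂ} (ha : 0 < a) (h : SuppIn a b f)
    (hf : Continuous f) (hk : ContinuousOn k (Ioi 0)) :
    IntegrableOn (fun y => f y * k y) (Ioi 0) := by
  refine IntegrableOn.of_forall_sdiff_eq_zero (s := Icc a b) ?_ measurableSet_Ioi fun x hx => ?_
  · exact (hf.continuousOn.mul (hk.mono fun x hx => ha.trans_le hx.1)).integrableOn_compact
      isCompact_Icc
  · simp [h x hx.2]

lemma SuppIn.starConj {a b : ℝ} {f : ℝ → ℂ} (ha : 0 < a) (h : SuppIn a b f) :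
    SuppIn b⁻¹ a⁻¹ (starConj f) := by
  intro x hx
  have : f x⁻¹ = 0 := by
    refine h _ fun hx' => hx ?_
    have hx0 : 0 < x := inv_pos.1 (ha.trans_le hx'.1)
    exact ⟨inv_le_of_inv_le₀ hx0 hx'.2, le_inv_of_le_inv₀ ha hx'.1⟩
  simp [BohrWeil.starConj, this]

lemma SuppIn.continuous_starConj {a b : ℝ} {f : ℝ → ℂ} (ha : 0 < a) (hab : a ≤ b)
    (h : SuppIn a b f) (hf : Continuous f) : Continuous (BohrWeil.starConj f) := by
  rw [continuous_iff_continuousAt]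
  intro x
  rcases eq_or_ne x 0 with rfl | hx
  · have hb : 0 < b⁻¹ := inv_pos.2 (ha.trans_le hab)
    have : BohrWeil.starConj f =ᶠ[𝓝 0] fun _ => 0 := by
      filter_upwards [Iio_mem_nhds hb] with x hx
      exact h.starConj ha x fun hx' => absurd hx'.1 (not_le.2 hx)
    exact continuousAt_const.congr this.symm
  · have h1 : ContinuousAt (fun x : ℝ => x⁻¹) x := continuousAt_inv₀ hx
    exact (Complex.continuous_ofReal.continuousAt.comp h1).mul
      (Complex.continuous_conj.continuousAt.comp (hf.continuousAt.comp h1))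

/-- Substitution of 1/x. On Re s = 1/2 the point 1 - conj s is s itself, which makes the product
with M(f)(s) equal to |M(f)(s)|². -/
lemma mellin_starConj (f : ℝ → ℂ) (s : ℂ) :
    mellin (starConj f) s = (starRingEnd ℂ) (mellin f (1 - (starRingEnd ℂ) s)) := by
  have h1 : starConj f = fun x => (fun y : ℝ => (y : ℂ) * (starRingEnd ℂ) (f y)) x⁻¹ := by
    ext x; simp [starConj]
  rw [h1, mellin_comp_inv (fun y : ℝ => (y : ℂ) * (starRingEnd ℂ) (f y)), mellin, mellin,
    ← integral_conj]
  refine setIntegral_congr_fun measurableSet_Ioi fun x hx => ?_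
  have hx' : (x : ℂ) ≠ 0 := by exact_mod_cast (ne_of_gt hx)
  have harg : (x : ℂ).arg ≠ Real.pi := by
    rw [Complex.arg_ofReal_of_nonneg (le_of_lt hx)]; exact Real.pi_pos.ne
  have hc : (starRingEnd ℂ) ((x : ℂ) ^ (1 - (starRingEnd ℂ) s - 1)) = (x : ℂ) ^ (-s) := by
    rw [show 1 - (starRingEnd ℂ) s - 1 = (starRingEnd ℂ) (-s) by simp, Complex.cpow_conj _ _ harg]
    simp
  simp only [smul_eq_mul, map_mul]
  rw [hc, Complex.cpow_sub _ _ hx', Complex.cpow_one]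
  field_simp

lemma SuppIn.mulConv {a b a' b' : ℝ} {f h : ℝ → ℂ} (ha' : 0 < a') (hf : SuppIn a b f)
    (hh : SuppIn a' b' h) : SuppIn (a * a') (b * b') (mulConv f h) := by
  intro x hx
  rw [BohrWeil.mulConv, setIntegral_eq_zero_of_forall_eq_zero]
  intro y hy
  have hy' : 0 < y := hy
  by_cases h1 : y ∈ Icc a b
  · have : h (x / y) = 0 := by
      refine hh _ fun h2 => hx ?_
      have hxy : x = y * (x / y) := by field_simp
      rw [hxy]
      exact ⟨mul_le_mul h1.1 h2.1 ha'.le hy'.le,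
        mul_le_mul h1.2 h2.2 (ha'.le.trans h2.1) (hy'.le.trans h1.2)⟩
    simp [this]
  · simp [hf y h1]

lemma SuppIn.continuous_mulConv {a b a' b' : ℝ} {f h : ℝ → ℂ} (ha : 0 < a) (hf : SuppIn a b f)
    (hh : SuppIn a' b' h) (hfc : Continuous f) (hhc : Continuous h) :
    Continuous (BohrWeil.mulConv f h) := by
  obtain ⟨C, hC0, hC⟩ := hh.bound hhc
  have hinv : ContinuousOn (fun y : ℝ => ((y⁻¹ : ℝ) : ℂ)) (Ioi 0) :=
    Complex.continuous_ofReal.comp_continuousOn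
      (continuousOn_inv₀.mono fun x hx => ne_of_gt hx)
  unfold BohrWeil.mulConv
  refine continuous_of_dominated (bound := fun y => C * ‖f y * ((y⁻¹ : ℝ) : ℂ)‖) (fun x => ?_)
    (fun x => ae_of_all _ fun y => ?_) ((hf.integrableOn_mul ha hfc hinv).norm.const_mul C)
    (ae_of_all _ fun y => by fun_prop)
  · refine ContinuousOn.aestronglyMeasurable ?_ measurableSet_Ioi
    refine (hfc.continuousOn.mul (hhc.comp_continuousOn ?_)).mul hinv
    exact continuousOn_const.div continuousOn_id fun y hy => ne_of_gt hy
  · rw [mul_right_comm, norm_mul, mul_comm]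
    gcongr
    exact hC _

/-- Fubini and a dilation in the inner integral. The double integrand vanishes outside a compact box
inside (0, ∞)², on which it is continuous, so it is integrable. -/
lemma SuppIn.mellin_mulConv {a b a' b' : ℝ} {f h : ℝ → ℂ} (ha : 0 < a) (ha' : 0 < a')
    (hf : SuppIn a b f) (hh : SuppIn a' b' h) (hfc : Continuous f) (hhc : Continuous h) (s : ℂ) :
    mellin (BohrWeil.mulConv f h) s = mellin f s * mellin h s := by
  have hint : Integrable (Function.uncurry fun x y : ℝ =>
      (x : ℂ) ^ (s - 1) * (f y * h (x / y) * ((y⁻¹ : ℝ) : ℂ)))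
      ((volume.restrict (Ioi 0)).prod (volume.restrict (Ioi 0))) := by
    rw [Measure.prod_restrict]
    refine IntegrableOn.of_forall_sdiff_eq_zero (s := Icc (a * a') (b * b') ×ˢ Icc a b) ?_
      (measurableSet_Ioi.prod measurableSet_Ioi) ?_
    · refine ContinuousOn.integrableOn_compact (isCompact_Icc.prod isCompact_Icc) ?_
      have hne : ∀ p ∈ Icc (a * a') (b * b') ×ˢ Icc a b, p.2 ≠ 0 := fun p hp =>
        (ha.trans_le hp.2.1).ne'
      refine ContinuousOn.mul (fun p hp => ?_) (((hfc.comp continuous_snd).continuousOn.mul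
        (hhc.comp_continuousOn (continuousOn_fst.div continuousOn_snd hne))).mul
        (Complex.continuous_ofReal.comp_continuousOn (continuousOn_snd.inv₀ hne)))
      refine ContinuousAt.continuousWithinAt ?_
      have hp0 : 0 < p.1 := (mul_pos ha ha').trans_le hp.1.1
      exact ContinuousAt.comp (f := fun p : ℝ × ℝ => p.1) (g := fun x : ℝ => (x : ℂ) ^ (s - 1))
        (Complex.continuousAt_ofReal_cpow_const _ _ (Or.inr hp0.ne')) continuousAt_fst
    · rintro ⟨x, y⟩ ⟨⟨hx, hy⟩, hxy⟩
      have hy' : 0 < y := hy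
      simp only [Function.uncurry_apply_pair]
      by_cases h1 : y ∈ Icc a b
      · have : h (x / y) = 0 := by
          refine hh _ fun h2 => hxy ⟨?_, h1⟩
          have hxy : x = y * (x / y) := by field_simp
          change x ∈ _
          rw [hxy]
          exact ⟨mul_le_mul h1.1 h2.1 ha'.le hy'.le,
            mul_le_mul h1.2 h2.2 (ha'.le.trans h2.1) (hy'.le.trans h1.2)⟩
        simp [this]
      · simp [hf y h1]
  calc mellin (BohrWeil.mulConv f h) s
      = ∫ x in Ioi (0 : ℝ), ∫ y in Ioi (0 : ℝ),
          (x : ℂ) ^ (s - 1) * (f y * h (x / y) * ((y⁻¹ : ℝ) : ℂ)) := by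
        refine setIntegral_congr_fun measurableSet_Ioi fun x hx => ?_
        simp only [BohrWeil.mulConv, smul_eq_mul, ← integral_const_mul]
    _ = ∫ y in Ioi (0 : ℝ), ∫ x in Ioi (0 : ℝ),
          (x : ℂ) ^ (s - 1) * (f y * h (x / y) * ((y⁻¹ : ℝ) : ℂ)) := integral_integral_swap hint
    _ = ∫ y in Ioi (0 : ℝ), ((y : ℂ) ^ (s - 1) * f y) * mellin h s := by
        refine setIntegral_congr_fun measurableSet_Ioi fun y hy => ?_
        have hy0 : (0 : ℝ) < y⁻¹ := inv_pos.2 hy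
        have hy' : (y : ℂ) ≠ 0 := by exact_mod_cast (ne_of_gt hy)
        have h1 : mellin (fun x => h (y⁻¹ * x)) s = (y : ℂ) ^ s * mellin h s := by
          rw [mellin_comp_mul_left _ _ hy0, smul_eq_mul, Complex.ofReal_inv, Complex.inv_cpow,
            Complex.cpow_neg, inv_inv]
          rw [Complex.arg_ofReal_of_nonneg (le_of_lt hy)]; exact Real.pi_pos.ne
        calc ∫ x in Ioi (0 : ℝ), (x : ℂ) ^ (s - 1) * (f y * h (x / y) * ((y⁻¹ : ℝ) : ℂ))
            = ∫ x in Ioi (0 : ℝ), (f y * ((y⁻¹ : ℝ) : ℂ)) *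
                ((x : ℂ) ^ (s - 1) • h (y⁻¹ * x)) := by
              congr 1; ext x; rw [smul_eq_mul, div_eq_inv_mul]; ring
          _ = (f y * ((y⁻¹ : ℝ) : ℂ)) * ((y : ℂ) ^ s * mellin h s) := by
              rw [integral_const_mul, ← h1]; rfl
          _ = _ := by
              rw [Complex.cpow_sub _ _ hy', Complex.cpow_one, Complex.ofReal_inv]; ring
    _ = mellin f s * mellin h s := by
        rw [integral_mul_const]; rfl

/-! ### The function `f * conj f^*` -/

section autoConv

variable {a b : ℝ} {f : ℝ → ℂ}

lemma SuppIn.autoConv (ha : 0 < a) (hab : a ≤ b) (h : SuppIn a b f) :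
    SuppIn (a / b) (b / a) (autoConv f) :=
  SuppIn.mulConv (inv_pos.2 (ha.trans_le hab)) h (h.starConj ha)

lemma SuppIn.continuous_autoConv (ha : 0 < a) (hab : a ≤ b) (h : SuppIn a b f)
    (hf : Continuous f) : Continuous (BohrWeil.autoConv f) :=
  SuppIn.continuous_mulConv ha h (h.starConj ha) hf (h.continuous_starConj ha hab hf)

lemma IsTest.continuous_autoConv (hf : IsTest f) : Continuous (autoConv f) := by
  obtain ⟨a, b, ha, hab, h⟩ := hf.exists_suppIn
  exact h.continuous_autoConv ha hab hf.continuous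

lemma IsTest.mellin_autoConv (hf : IsTest f) (s : ℂ) :
    mellin (autoConv f) s =
      mellin f s * (starRingEnd ℂ) (mellin f (1 - (starRingEnd ℂ) s)) := by
  obtain ⟨a, b, ha, hab, h⟩ := hf.exists_suppIn
  rw [autoConv, SuppIn.mellin_mulConv ha (inv_pos.2 (ha.trans_le hab)) h (h.starConj ha)
    hf.continuous (h.continuous_starConj ha hab hf.continuous), mellin_starConj]

lemma IsTest.mellin_autoConv_crit (hf : IsTest f) (t : ℝ) :
    mellin (autoConv f) (1 / 2 + t * Complex.I) = (critSq f t : ℂ) := by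
  rw [hf.mellin_autoConv]
  have h1 : 1 - (starRingEnd ℂ) (1 / 2 + t * Complex.I) = 1 / 2 + t * Complex.I := by
    have h2 : (starRingEnd ℂ) (1 / 2 : ℂ) = 1 / 2 := by
      rw [show (1 / 2 : ℂ) = ((1 / 2 : ℝ) : ℂ) by push_cast; rfl, Complex.conj_ofReal]
    rw [map_add, map_mul, Complex.conj_ofReal, Complex.conj_I, h2]
    ring
  rw [h1, Complex.mul_conj, critSq, critMellin, Complex.normSq_eq_norm_sq]

/-- The Fourier transform of `critSq f`. -/
def critFourier (f : ℝ → ℂ) (u : ℝ) : ℂ :=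
  ((1 / (2 * Real.pi) : ℝ) : ℂ) *
    ∫ t : ℝ, (critSq f t : ℂ) * Complex.exp (-(t * u : ℝ) * Complex.I)

lemma norm_exp_neg_ofReal_mul_I (x : ℝ) : ‖Complex.exp (-(x : ℂ) * Complex.I)‖ = 1 := by
  rw [← Complex.ofReal_neg]; exact Complex.norm_exp_ofReal_mul_I _

lemma IsTest.integrable_critSq_exp (hf : IsTest f) (u : ℝ) :
    Integrable fun t : ℝ => (critSq f t : ℂ) * Complex.exp (-(t * u : ℝ) * Complex.I) := by
  have := hf.integrable_critSq_mul (S := fun t : ℝ => Complex.exp (-(t * u : ℝ) * Complex.I))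
    (K := 1) (n := 0) (by fun_prop) (fun t => by rw [norm_exp_neg_ofReal_mul_I]; simp)
  simpa only [Complex.real_smul] using this

/-- Mellin inversion on Re s = 1/2, where the transform is `critSq f`; the factor e^{-u/2} is
x^{-1/2} at x = e^u. -/
lemma IsTest.autoConv_exp (hf : IsTest f) (u : ℝ) :
    autoConv f (Real.exp u) = (Real.exp (-u / 2) : ℂ) * critFourier f u := by
  obtain ⟨a, b, ha, hab, h⟩ := hf.exists_suppIn
  have hpos : 0 < a / b := div_pos ha (ha.trans_le hab)
  have hconv := (h.autoConv ha hab).mellinConvergent hpos hf.continuous_autoConv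
    ((1 / 2 : ℝ) : ℂ)
  have hcrit : ∀ t : ℝ, mellin (autoConv f) (((1 / 2 : ℝ) : ℂ) + t * Complex.I) =
      (critSq f t : ℂ) := fun t => by
    rw [← hf.mellin_autoConv_crit]; push_cast; rfl
  have hv : Complex.VerticalIntegrable (mellin (autoConv f)) (1 / 2) := by
    unfold Complex.VerticalIntegrable
    simp only [hcrit]
    exact hf.integrable_critSq.ofReal
  rw [← mellinInv_mellin_eq (1 / 2) (autoConv f) (Real.exp_pos u) hconv hv
    hf.continuous_autoConv.continuousAt, mellinInv, critFourier]
  simp only [hcrit]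
  rw [mul_left_comm, ← integral_const_mul, ← Complex.real_smul]
  congr 1
  refine integral_congr_ae (ae_of_all _ fun t => ?_)
  simp only [smul_eq_mul]
  rw [mul_left_comm, mul_comm]
  congr 1
  rw [Complex.cpow_def_of_ne_zero (by exact_mod_cast (Real.exp_pos u).ne'), ← Complex.ofReal_log
    (Real.exp_pos u).le, Real.log_exp, Complex.ofReal_exp,
    ← Complex.exp_add]
  congr 1
  push_cast
  ring

lemma IsTest.autoConv_eq (hf : IsTest f) {x : ℝ} (hx : 0 < x) :
    autoConv f x = ((x ^ (-(1 / 2 : ℝ)) : ℝ) : ℂ) * critFourier f (Real.log x) := by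
  have := hf.autoConv_exp (Real.log x)
  rw [Real.exp_log hx] at this
  rw [this, Real.rpow_def_of_pos hx]
  congr 3; ring

lemma critFourier_neg (f : ℝ → ℂ) (u : ℝ) :
    critFourier f (-u) = (starRingEnd ℂ) (critFourier f u) := by
  rw [critFourier, critFourier, map_mul, Complex.conj_ofReal, ← integral_conj]
  congr 2; ext t
  rw [map_mul, Complex.conj_ofReal, ← Complex.exp_conj]
  congr 2
  simp

lemma critFourier_zero (f : ℝ → ℂ) :
    critFourier f 0 = ((1 / (2 * Real.pi) * ∫ t, critSq f t : ℝ) : ℂ) := by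
  rw [critFourier, Complex.ofReal_mul, ← integral_complex_ofReal]
  simp

lemma norm_critFourier_le (f : ℝ → ℂ) (u : ℝ) :
    ‖critFourier f u‖ ≤ 1 / (2 * Real.pi) * ∫ t, critSq f t := by
  rw [critFourier, norm_mul, Complex.norm_real, Real.norm_of_nonneg (by positivity)]
  gcongr
  refine (norm_integral_le_integral_norm _).trans (le_of_eq ?_)
  congr 1; ext t
  rw [norm_mul, norm_exp_neg_ofReal_mul_I, Complex.norm_real,
    Real.norm_of_nonneg (critSq_nonneg _ _), mul_one]

lemma IsTest.autoConv_one (hf : IsTest f) : autoConv f 1 = critFourier f 0 := by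
  have := hf.autoConv_exp 0
  simpa using this

/-- The convolution lives on [a/b, b/a], which settles u > log(b/a); negative u follow by
conjugation. This makes every sum over prime powers below finite. -/
lemma IsTest.critFourier_eq_zero (hf : IsTest f) (ha : 0 < a) (hab : a ≤ b) (h : SuppIn a b f)
    {u : ℝ} (hu : Real.log (b / a) < |u|) : critFourier f u = 0 := by
  have key : ∀ v, Real.log (b / a) < v → critFourier f v = 0 := by
    intro v hv
    have h1 := hf.autoConv_exp v
    rw [h.autoConv ha hab, eq_comm, mul_eq_zero] at h1
    · exact h1.resolve_left (by exact_mod_cast (Real.exp_pos _).ne')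
    · intro hx
      have h2 : Real.exp (Real.log (b / a)) < Real.exp v := Real.exp_lt_exp.2 hv
      rw [Real.exp_log (div_pos (ha.trans_le hab) ha)] at h2
      exact absurd hx.2 (not_le.2 h2)
  rcases le_total 0 u with h0 | h0
  · exact key u (by rwa [abs_of_nonneg h0] at hu)
  · rw [← neg_neg u, critFourier_neg, key (-u) (by rwa [abs_of_nonpos h0] at hu), map_zero]

lemma norm_exp_mul_I_sub_le (x y : ℝ) :
    ‖Complex.exp (-(x : ℂ) * Complex.I) - Complex.exp (-(y : ℂ) * Complex.I)‖ ≤ |x - y| := by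
  have h1 : Complex.exp (-(x : ℂ) * Complex.I) - Complex.exp (-(y : ℂ) * Complex.I) =
      Complex.exp (-(y : ℂ) * Complex.I) * (Complex.exp (Complex.I * ((y - x : ℝ) : ℂ)) - 1) := by
    rw [mul_sub, mul_one, ← Complex.exp_add]
    congr 2; push_cast; ring
  rw [h1, norm_mul, norm_exp_neg_ofReal_mul_I, one_mul, abs_sub_comm]
  exact (Real.norm_exp_I_mul_ofReal_sub_one_le).trans (le_of_eq (Real.norm_eq_abs _))

/-- The first absolute moment of `critSq f` is finite and serves as Lipschitz constant. -/
lemma IsTest.critFourier_lipschitz (hf : IsTest f) :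
    ∃ C, 0 ≤ C ∧ ∀ u v, ‖critFourier f u - critFourier f v‖ ≤ C * |u - v| := by
  have hint : Integrable fun t => critSq f t • |t| := hf.integrable_critSq_mul (K := 1) (n := 1)
    (by fun_prop) (fun t => by rw [Real.norm_eq_abs, abs_abs]; linarith [abs_nonneg t])
  refine ⟨1 / (2 * Real.pi) * ∫ t, critSq f t * |t|, mul_nonneg (by positivity)
    (integral_nonneg fun t => mul_nonneg (critSq_nonneg _ _) (abs_nonneg _)), fun u v => ?_⟩
  rw [critFourier, critFourier, ← mul_sub, ← integral_sub (hf.integrable_critSq_exp u)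
    (hf.integrable_critSq_exp v), norm_mul, Complex.norm_real,
    Real.norm_of_nonneg (by positivity), mul_assoc]
  gcongr
  rw [← integral_mul_const]
  refine norm_integral_le_of_norm_le (hint.mul_const _) (ae_of_all _ fun t => ?_)
  rw [← mul_sub, norm_mul, Complex.norm_real, Real.norm_of_nonneg (critSq_nonneg _ _), mul_assoc]
  gcongr
  · exact critSq_nonneg _ _
  · refine (norm_exp_mul_I_sub_le _ _).trans (le_of_eq ?_)
    rw [← mul_sub, abs_mul]

lemma IsTest.continuous_critFourier (hf : IsTest f) : Continuous (critFourier f) := by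
  obtain ⟨C, hC0, hC⟩ := hf.critFourier_lipschitz
  refine (LipschitzWith.of_dist_le_mul (K := ⟨C, hC0⟩) fun u v => ?_).continuous
  rw [dist_eq_norm, Real.dist_eq]
  exact hC u v

end autoConv

/-! ### The Weil terms at the primes -/

lemma logDeriv_reflect_div {Z : ℂ → ℂ} {s : ℂ} (h1 : DifferentiableAt ℂ Z s)
    (h2 : DifferentiableAt ℂ Z (1 - s)) (h3 : Z s ≠ 0) (h4 : Z (1 - s) ≠ 0) :
    logDeriv (fun s => Z (1 - s) / Z s) s = -logDeriv Z (1 - s) - logDeriv Z s := by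
  have hd : HasDerivAt (fun s : ℂ => 1 - s) (-1) s := by
    simpa using (hasDerivAt_id s).const_sub 1
  have h5 : HasDerivAt (fun s => Z (1 - s)) (deriv Z (1 - s) * -1) s :=
    h2.hasDerivAt.comp s hd
  rw [logDeriv_div (f := fun s => Z (1 - s)) s h4 h3 h5.differentiableAt h1]
  congr 1
  rw [logDeriv_apply, h5.deriv, logDeriv_apply]
  ring

lemma critLine_reflect (t : ℝ) :
    (1 : ℂ) - (1 / 2 + t * Complex.I) = 1 / 2 + ((-t : ℝ) : ℂ) * Complex.I := by
  push_cast; ring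

lemma critLine_re (t : ℝ) : (1 / 2 + t * Complex.I : ℂ).re = 1 / 2 := by simp

lemma exp_log_natCast_lt_one {p : ℕ} (hp : p.Prime) {s : ℂ} (hs : 0 < s.re) :
    ‖(p : ℂ) ^ (-s)‖ < 1 := by
  rw [Complex.norm_natCast_cpow_of_pos hp.pos, Complex.neg_re]
  exact Real.rpow_lt_one_of_one_lt_of_neg (by exact_mod_cast hp.one_lt) (by linarith)

lemma hasDerivAt_one_sub_cpow {p : ℕ} (hp : p.Prime) (s : ℂ) :
    HasDerivAt (fun s : ℂ => 1 - (p : ℂ) ^ (-s)) ((Real.log p : ℂ) * (p : ℂ) ^ (-s)) s := by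
  have hp0 : (p : ℂ) ≠ 0 := by exact_mod_cast hp.ne_zero
  have := ((hasDerivAt_id s).neg.const_cpow (c := (p : ℂ)) (Or.inl hp0)).const_sub 1
  refine this.congr_deriv ?_
  rw [Complex.natCast_log]
  simp only [Pi.neg_apply, id]
  ring

lemma one_sub_cpow_ne_zero {p : ℕ} (hp : p.Prime) {s : ℂ} (hs : 0 < s.re) :
    1 - (p : ℂ) ^ (-s) ≠ 0 := by
  intro h
  have := exp_log_natCast_lt_one hp hs
  rw [← sub_eq_zero.1 h, norm_one] at this
  exact lt_irrefl _ this

lemma zetaFactor_ne_zero {p : ℕ} (hp : p.Prime) {s : ℂ} (hs : 0 < s.re) : zetaFactor p s ≠ 0 :=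
  inv_ne_zero (one_sub_cpow_ne_zero hp hs)

lemma differentiableAt_zetaFactor {p : ℕ} (hp : p.Prime) {s : ℂ} (hs : 0 < s.re) :
    DifferentiableAt ℂ (zetaFactor p) s :=
  (hasDerivAt_one_sub_cpow hp s).differentiableAt.inv (one_sub_cpow_ne_zero hp hs)

lemma hasSum_neg_logDeriv_zetaFactor {p : ℕ} (hp : p.Prime) {s : ℂ} (hs : 0 < s.re) :
    HasSum (fun k : ℕ => (Real.log p : ℂ) * ((p : ℂ) ^ (-s)) ^ (k + 1))
      (-logDeriv (zetaFactor p) s) := by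
  have hne := one_sub_cpow_ne_zero hp hs
  have h1 : logDeriv (zetaFactor p) s =
      -((Real.log p : ℂ) * (p : ℂ) ^ (-s) / (1 - (p : ℂ) ^ (-s))) := by
    have hd := (hasDerivAt_one_sub_cpow hp s).inv hne
    have hd' : deriv (zetaFactor p) s = _ := hd.deriv
    rw [logDeriv_apply, hd', zetaFactor]
    field_simp
  rw [h1, neg_neg]
  have h2 := (hasSum_geometric_of_norm_lt_one (exp_log_natCast_lt_one hp hs)).mul_left
    ((Real.log p : ℂ) * (p : ℂ) ^ (-s))
  rw [← div_eq_mul_inv] at h2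
  refine h2.congr_fun fun k => ?_
  ring

lemma natCast_cpow_crit {n : ℕ} (hn : n ≠ 0) (t : ℝ) :
    (n : ℂ) ^ (-(1 / 2 + t * Complex.I)) =
      (((n : ℝ) ^ (-(1 / 2 : ℝ)) : ℝ) : ℂ) * Complex.exp (-(t * Real.log n : ℝ) * Complex.I) := by
  have hn' : (n : ℂ) ≠ 0 := by exact_mod_cast hn
  rw [Real.rpow_def_of_pos (by positivity), Complex.ofReal_exp, ← Complex.exp_add,
    Complex.cpow_def_of_ne_zero hn', ← Complex.natCast_log]
  congr 1
  push_cast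
  ring

/-- The contribution of `n` to the finite part of the Weil sum. -/
def weilCoeff (f : ℝ → ℂ) (n : ℕ) : ℂ :=
  ((ArithmeticFunction.vonMangoldt n * (n : ℝ) ^ (-(1 / 2 : ℝ)) : ℝ) : ℂ) *
    (critFourier f (Real.log n) + critFourier f (-Real.log n))

lemma weilCoeff_eq_integral {f : ℝ → ℂ} (hf : IsTest f) (n : ℕ) :
    weilCoeff f n = ((1 / (2 * Real.pi) : ℝ) : ℂ) * ∫ t : ℝ, (critSq f t : ℂ) *
      ((ArithmeticFunction.vonMangoldt n * (n : ℝ) ^ (-(1 / 2 : ℝ)) : ℝ) *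
        (Complex.exp (-(t * Real.log n : ℝ) * Complex.I) +
          Complex.exp (-((-t) * Real.log n : ℝ) * Complex.I))) := by
  rw [weilCoeff, critFourier, critFourier, ← mul_add, ← integral_add (hf.integrable_critSq_exp _)
    (hf.integrable_critSq_exp _), mul_left_comm, ← integral_const_mul]
  congr 2
  ext t
  rw [mul_neg, neg_mul t]
  ring

/-- On Re s = 1/2 the logarithmic derivatives at s and at 1 - s both expand into absolutely
convergent geometric series. Integrating term by term against `critSq f` produces values of its
Fourier transform at ± log p^k. -/
lemma weilTerm_zetaFactor {f : ℝ → ℂ} (hf : IsTest f) {p : ℕ} (hp : p.Prime) :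
    HasSum (fun k : ℕ => weilCoeff f (p ^ (k + 1))) (weilTerm (zetaFactor p) (autoConv f)) := by
  have hlog : ∀ t : ℝ, HasSum (fun k : ℕ => (critSq f t : ℂ) *
      ((ArithmeticFunction.vonMangoldt (p ^ (k + 1)) *
        ((p ^ (k + 1) : ℕ) : ℝ) ^ (-(1 / 2 : ℝ)) : ℝ) *
        (Complex.exp (-(t * Real.log ((p ^ (k + 1) : ℕ) : ℝ) : ℝ) * Complex.I) +
          Complex.exp (-((-t) * Real.log ((p ^ (k + 1) : ℕ) : ℝ) : ℝ) * Complex.I))))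
      (mellin (autoConv f) (1 / 2 + t * Complex.I) *
        logDeriv (fun s => zetaFactor p (1 - s) / zetaFactor p s) (1 / 2 + t * Complex.I)) := by
    intro t
    have h1 : 0 < (1 / 2 + t * Complex.I : ℂ).re := by rw [critLine_re]; norm_num
    have h2 : 0 < (1 / 2 + ((-t : ℝ) : ℂ) * Complex.I : ℂ).re := by rw [critLine_re]; norm_num
    have h3 : 0 < (1 - (1 / 2 + t * Complex.I) : ℂ).re := by rw [critLine_reflect]; exact h2
    rw [logDeriv_reflect_div (differentiableAt_zetaFactor hp h1)
      (differentiableAt_zetaFactor hp h3) (zetaFactor_ne_zero hp h1) (zetaFactor_ne_zero hp h3),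
      hf.mellin_autoConv_crit, critLine_reflect]
    have hs := ((hasSum_neg_logDeriv_zetaFactor hp h2).add
      (hasSum_neg_logDeriv_zetaFactor hp h1)).mul_left (critSq f t : ℂ)
    rw [← sub_eq_add_neg] at hs
    refine hs.congr_fun fun k => ?_
    congr 1
    have hne : p ^ (k + 1) ≠ 0 := pow_ne_zero _ hp.ne_zero
    have hpow : ∀ t : ℝ, ((p : ℂ) ^ (-(1 / 2 + (t : ℂ) * Complex.I))) ^ (k + 1) =
        ((p ^ (k + 1) : ℕ) : ℂ) ^ (-(1 / 2 + (t : ℂ) * Complex.I)) := by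
      intro t
      rw [Nat.cast_pow, ← Complex.natCast_cpow_natCast_mul, Complex.cpow_nat_mul]
    rw [hpow, hpow, natCast_cpow_crit hne, natCast_cpow_crit hne,
      ArithmeticFunction.vonMangoldt_apply_pow (Nat.succ_ne_zero k),
      ArithmeticFunction.vonMangoldt_apply_prime hp]
    push_cast
    ring
  have key := hasSum_integral_of_summable_integral_norm (F := fun (k : ℕ) (t : ℝ) =>
    (critSq f t : ℂ) * ((ArithmeticFunction.vonMangoldt (p ^ (k + 1)) *
        ((p ^ (k + 1) : ℕ) : ℝ) ^ (-(1 / 2 : ℝ)) : ℝ) *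
        (Complex.exp (-(t * Real.log ((p ^ (k + 1) : ℕ) : ℝ) : ℝ) * Complex.I) +
          Complex.exp (-((-t) * Real.log ((p ^ (k + 1) : ℕ) : ℝ) : ℝ) * Complex.I)))) (μ := volume)
    ?_ ?_
  · have h1 := key.mul_left ((1 / (2 * Real.pi) : ℝ) : ℂ)
    rw [weilTerm]
    simp only [← weilCoeff_eq_integral hf] at h1
    rwa [integral_congr_ae (ae_of_all _ fun t => (hlog t).tsum_eq)] at h1
  · intro k
    have := hf.integrable_critSq_mul (S := fun t : ℝ =>
      (((ArithmeticFunction.vonMangoldt (p ^ (k + 1)) *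
        ((p ^ (k + 1) : ℕ) : ℝ) ^ (-(1 / 2 : ℝ)) : ℝ) : ℂ) *
        (Complex.exp (-(t * Real.log ((p ^ (k + 1) : ℕ) : ℝ) : ℝ) * Complex.I) +
          Complex.exp (-((-t) * Real.log ((p ^ (k + 1) : ℕ) : ℝ) : ℝ) * Complex.I))))
      (K := ‖((ArithmeticFunction.vonMangoldt (p ^ (k + 1)) *
        ((p ^ (k + 1) : ℕ) : ℝ) ^ (-(1 / 2 : ℝ)) : ℝ) : ℂ)‖ * (1 + 1))
      (n := 0) (by fun_prop) (fun t => by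
        rw [norm_mul, pow_zero, mul_one]
        refine mul_le_mul_of_nonneg_left ((norm_add_le _ _).trans ?_) (norm_nonneg _)
        exact (add_le_add (norm_exp_neg_ofReal_mul_I _).le (norm_exp_neg_ofReal_mul_I _).le))
    simpa only [Complex.real_smul] using this
  -- The integrals of the norms are dominated by a geometric series of ratio p^{-1/2}.
  · have hr : ‖(p : ℝ) ^ (-(1 / 2 : ℝ))‖ < 1 := by
      rw [Real.norm_of_nonneg (by positivity)]
      exact Real.rpow_lt_one_of_one_lt_of_neg (by exact_mod_cast hp.one_lt) (by norm_num)
    have hg := (summable_geometric_of_norm_lt_one hr).mul_left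
      ((∫ t, critSq f t) * (Real.log p * (p : ℝ) ^ (-(1 / 2 : ℝ)) * 2))
    refine Summable.of_nonneg_of_le (fun k => integral_nonneg fun t => norm_nonneg _) (fun k => ?_)
      hg
    rw [mul_assoc, ← integral_mul_const]
    refine integral_mono_of_nonneg (ae_of_all _ fun t => norm_nonneg _)
      (hf.integrable_critSq.mul_const _) (ae_of_all _ fun t => ?_)
    simp only
    rw [norm_mul, norm_mul, Complex.norm_real, Real.norm_of_nonneg (critSq_nonneg _ _)]
    refine mul_le_mul_of_nonneg_left ?_ (critSq_nonneg _ _)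
    have h2 : ‖Complex.exp (-(t * Real.log ((p ^ (k + 1) : ℕ) : ℝ) : ℝ) * Complex.I) +
          Complex.exp (-((-t) * Real.log ((p ^ (k + 1) : ℕ) : ℝ) : ℝ) * Complex.I)‖ ≤ 2 :=
      (norm_add_le _ _).trans ((add_le_add (norm_exp_neg_ofReal_mul_I _).le
        (norm_exp_neg_ofReal_mul_I _).le).trans (by norm_num))
    rw [ArithmeticFunction.vonMangoldt_apply_pow (Nat.succ_ne_zero k),
      ArithmeticFunction.vonMangoldt_apply_prime hp, Complex.norm_real,
      Real.norm_of_nonneg (mul_nonneg (Real.log_natCast_nonneg p) (by positivity))]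
    have h3 : ((p ^ (k + 1) : ℕ) : ℝ) ^ (-(1 / 2 : ℝ)) =
        (p : ℝ) ^ (-(1 / 2 : ℝ)) * ((p : ℝ) ^ (-(1 / 2 : ℝ))) ^ k := by
      rw [Nat.cast_pow, ← Real.rpow_natCast, ← Real.rpow_mul (by positivity), mul_comm,
        Real.rpow_mul (by positivity), Real.rpow_natCast, pow_succ']
    rw [h3]
    calc _ ≤ Real.log p * ((p : ℝ) ^ (-(1 / 2 : ℝ)) * ((p : ℝ) ^ (-(1 / 2 : ℝ))) ^ k) * 2 := by
          refine mul_le_mul_of_nonneg_left h2 ?_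
          exact mul_nonneg (Real.log_natCast_nonneg p) (by positivity)
      _ = _ := by ring

lemma weilCoeff_of_not_isPrimePow (f : ℝ → ℂ) {n : ℕ} (hn : ¬ IsPrimePow n) :
    weilCoeff f n = 0 := by
  simp [weilCoeff, ArithmeticFunction.vonMangoldt_eq_zero_iff.2 hn]

lemma weilCoeff_of_lt {f : ℝ → ℂ} (hf : IsTest f) {a b : ℝ} (ha : 0 < a) (hab : a ≤ b)
    (h : SuppIn a b f) {n : ℕ} (hn : b / a < n) : weilCoeff f n = 0 := by
  have hpos : 0 < b / a := div_pos (ha.trans_le hab) ha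
  have h1 : Real.log (b / a) < Real.log n := Real.log_lt_log hpos hn
  have h2 : 0 ≤ Real.log n := Real.log_natCast_nonneg n
  rw [weilCoeff, hf.critFourier_eq_zero ha hab h (by rwa [abs_of_nonneg h2]),
    hf.critFourier_eq_zero ha hab h (by rwa [abs_neg, abs_of_nonneg h2]), add_zero, mul_zero]

/-- The pairs of a prime and a positive exponent enumerate the prime powers, outside of which Λ
vanishes; the terms n > b/a drop out by the compact support of `critFourier f`. -/
lemma tsum_weilTerm_zetaFactor {f : ℝ → ℂ} (hf : IsTest f) {a b : ℝ} (ha : 0 < a) (hab : a ≤ b)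
    (h : SuppIn a b f) {N : ℕ} (hN : b / a < N) :
    ∑' p : Nat.Primes, weilTerm (zetaFactor p) (autoConv f) =
      ∑ n ∈ Finset.range N, weilCoeff f n := by
  have hz : ∀ n, n ∉ Finset.range N → weilCoeff f n = 0 := fun n hn => by
    refine weilCoeff_of_lt hf ha hab h (hN.trans_le ?_)
    exact_mod_cast not_lt.1 fun h' => hn (Finset.mem_range.2 h')
  have hsum : HasSum (weilCoeff f) (∑ n ∈ Finset.range N, weilCoeff f n) :=
    hasSum_sum_of_ne_finset_zero hz
  have h1 : HasSum (weilCoeff f ∘ (Subtype.val : {n : ℕ | IsPrimePow n} → ℕ))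
      (∑ n ∈ Finset.range N, weilCoeff f n) := by
    refine (hasSum_subtype_iff_of_support_subset fun n hn => ?_).2 hsum
    by_contra h'
    exact hn (weilCoeff_of_not_isPrimePow f h')
  have h2 : HasSum (fun x : Nat.Primes × ℕ => weilCoeff f ((x.1 : ℕ) ^ (x.2 + 1)))
      (∑ n ∈ Finset.range N, weilCoeff f n) := by
    have := (Equiv.hasSum_iff Nat.Primes.prodNatEquiv).2 h1
    refine this.congr_fun fun x => ?_
    rw [Function.comp_apply, Function.comp_apply, Nat.Primes.coe_prodNatEquiv_apply]
  have hp : ∀ p : Nat.Primes, HasSum (fun k : ℕ => weilCoeff f ((p : ℕ) ^ (k + 1)))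
      (weilTerm (zetaFactor p) (autoConv f)) := fun p => weilTerm_zetaFactor hf p.2
  have h3 : HasSum (fun p : Nat.Primes => weilTerm (zetaFactor p) (autoConv f))
      (∑ n ∈ Finset.range N, weilCoeff f n) :=
    HasSum.prod_fiberwise (f := fun x : Nat.Primes × ℕ => weilCoeff f ((x.1 : ℕ) ^ (x.2 + 1)))
      h2 hp
  exact h3.tsum_eq

/-! ### The digamma function -/

/-- Cauchy's formula for the derivative with dominated convergence on the circle: a common bound and
pointwise convergence there suffice. -/
lemma tendsto_deriv_of_bounded_of_tendsto {f : ℕ → ℂ → ℂ} {g : ℂ → ℂ} {z : ℂ} {r M : ℝ}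
    (hr : 0 < r) (hf : ∀ᶠ n in atTop, DifferentiableOn ℂ (f n) (Metric.closedBall z r))
    (hg : DifferentiableOn ℂ g (Metric.closedBall z r))
    (hM : ∀ᶠ n in atTop, ∀ w ∈ Metric.sphere z r, ‖f n w‖ ≤ M)
    (hlim : ∀ w ∈ Metric.sphere z r, Tendsto (fun n => f n w) atTop (𝓝 (g w))) :
    Tendsto (fun n => deriv (f n) z) atTop (𝓝 (deriv g z)) := by
  have hpi : (2 * Real.pi * Complex.I : ℂ) ≠ 0 := by
    simp [Real.pi_ne_zero]
  have h0 : ∀ f : ℂ → ℂ, DifferentiableOn ℂ f (Metric.closedBall z r) →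
      (2 * Real.pi * Complex.I : ℂ)⁻¹ • ∮ w in C(z, r), (1 / (w - z) ^ 2) • f w = deriv f z := by
    intro f hf
    rw [hf.deriv_eq_smul_circleIntegral hr, smul_smul, inv_mul_cancel₀ hpi, one_smul]
  rw [← h0 g hg]
  have h1 : ∀ᶠ n in atTop, (2 * Real.pi * Complex.I : ℂ)⁻¹ •
      ∮ w in C(z, r), (1 / (w - z) ^ 2) • f n w = deriv (f n) z := by
    filter_upwards [hf] with n hn using h0 _ hn
  refine Tendsto.congr' h1 (tendsto_const_nhds.smul ?_)
  have hsph : ∀ θ : ℝ, circleMap z r θ ∈ Metric.sphere z r := circleMap_mem_sphere z hr.le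
  unfold circleIntegral
  refine intervalIntegral.tendsto_integral_filter_of_dominated_convergence
    (fun _ => |r| * (1 / r ^ 2 * M)) ?_ ?_ intervalIntegrable_const ?_
  · filter_upwards [hf] with n hn
    refine Continuous.aestronglyMeasurable ?_
    have hfc : Continuous fun θ : ℝ => f n (circleMap z r θ) :=
      hn.continuousOn.comp_continuous (continuous_circleMap z r)
        fun θ => Metric.sphere_subset_closedBall (hsph θ)
    have hne : ∀ θ : ℝ, (circleMap z r θ - z) ^ 2 ≠ 0 := fun θ => pow_ne_zero _
      (sub_ne_zero.2 (circleMap_ne_center hr.ne'))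
    have hc := continuous_circleMap z r
    have hd : Continuous (deriv (circleMap z r)) := by
      have : deriv (circleMap z r) = fun θ => circleMap 0 r θ * Complex.I := by
        ext θ; exact deriv_circleMap z r θ
      rw [this]; exact (continuous_circleMap 0 r).mul continuous_const
    have hq : Continuous fun θ : ℝ => 1 / (circleMap z r θ - z) ^ 2 :=
      continuous_const.div ((hc.sub continuous_const).pow 2) hne
    exact hd.smul (hq.smul hfc)
  · filter_upwards [hM] with n hn
    refine ae_of_all _ fun θ _ => ?_
    have h2 : ‖circleMap z r θ - z‖ = r := by
      have := hsph θ; rwa [mem_sphere_iff_norm] at this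
    rw [norm_smul, norm_smul, norm_div, norm_pow, h2, norm_one, deriv_circleMap, norm_mul,
      norm_circleMap_zero, Complex.norm_I, mul_one]
    have := hn _ (hsph θ)
    gcongr
  · exact ae_of_all _ fun θ _ => tendsto_const_nhds.smul
      (tendsto_const_nhds.smul (hlim _ (hsph θ)))

/-- `GammaSeq` is the integral of (1 - x/n)^n x^{s-1} over (0, n), and (1 - x/n)^n ≤ e^{-x}. -/
lemma norm_GammaSeq_le {s : ℂ} (hs : 0 < s.re) {n : ℕ} (hn : n ≠ 0) :
    ‖Complex.GammaSeq s n‖ ≤ Real.Gamma s.re := by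
  rw [Complex.GammaSeq_eq_approx_Gamma_integral hs hn, Real.Gamma_eq_integral hs]
  rw [intervalIntegral.integral_of_le (by positivity)]
  refine (norm_integral_le_integral_norm _).trans ?_
  calc ∫ x in Ioc (0 : ℝ) n, ‖(((1 - x / n) ^ n : ℝ) : ℂ) * (x : ℂ) ^ (s - 1)‖
      ≤ ∫ x in Ioc (0 : ℝ) n, Real.exp (-x) * x ^ (s.re - 1) := by
        refine setIntegral_mono_of_nonneg (fun x hx => norm_nonneg _) ?_ ?_
        rotate_left
        · exact (Real.GammaIntegral_convergent hs).mono_set Ioc_subset_Ioi_self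
        · intro x hx
          have hn' : (0 : ℝ) < n := by positivity
          have h1 : 0 ≤ 1 - x / n := by
            rw [sub_nonneg, div_le_one hn']; exact hx.2
          rw [norm_mul, Complex.norm_real, Real.norm_of_nonneg (by positivity),
            Complex.norm_cpow_eq_rpow_re_of_pos hx.1]
          simp only [Complex.sub_re, Complex.one_re]
          exact mul_le_mul_of_nonneg_right (Real.one_sub_div_pow_le_exp_neg hx.2)
            (Real.rpow_nonneg hx.1.le _)
    _ ≤ ∫ x in Ioi (0 : ℝ), Real.exp (-x) * x ^ (s.re - 1) := by
        refine setIntegral_mono_set (Real.GammaIntegral_convergent hs) ?_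
          Ioc_subset_Ioi_self.eventuallyLE
        filter_upwards [ae_restrict_mem measurableSet_Ioi] with x hx
        exact mul_nonneg (Real.exp_nonneg _) (Real.rpow_nonneg (le_of_lt hx) _)

lemma add_natCast_ne_zero {z : ℂ} (hz : 0 < z.re) (j : ℕ) : z + j ≠ 0 := by
  intro h
  have := congrArg Complex.re h
  simp only [Complex.add_re, Complex.natCast_re, Complex.zero_re] at this
  have hj : (0 : ℝ) ≤ j := by positivity
  linarith

lemma differentiableAt_GammaSeq {n : ℕ} (hn : n ≠ 0) {z : ℂ} (hz : 0 < z.re) :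
    DifferentiableAt ℂ (fun s => Complex.GammaSeq s n) z := by
  unfold Complex.GammaSeq
  have hn' : (n : ℂ) ≠ 0 := by exact_mod_cast hn
  refine DifferentiableAt.div ?_ (by fun_prop)
    (Finset.prod_ne_zero_iff.2 fun j _ => add_natCast_ne_zero hz j)
  exact (differentiableAt_id.const_cpow (Or.inl hn')).mul_const _

/-- The partial expressions of the limit formula for the digamma function. -/
def digammaSeq (z : ℂ) (n : ℕ) : ℂ :=
  (Real.log n : ℂ) - ∑ j ∈ Finset.range (n + 1), 1 / (z + j)

lemma logDeriv_GammaSeq {n : ℕ} (hn : n ≠ 0) {z : ℂ} (hz : 0 < z.re) :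
    logDeriv (fun s => Complex.GammaSeq s n) z = digammaSeq z n := by
  have hn' : (n : ℂ) ≠ 0 := by exact_mod_cast hn
  have hc : HasDerivAt (fun s : ℂ => (n : ℂ) ^ s) ((n : ℂ) ^ z * Complex.log n * 1) z :=
    (hasDerivAt_id z).const_cpow (Or.inl hn')
  unfold Complex.GammaSeq
  rw [logDeriv_div (f := fun s : ℂ => (n : ℂ) ^ s * (n.factorial : ℂ)) z (mul_ne_zero (by simp [Complex.cpow_eq_zero_iff, hn'])
    (by exact_mod_cast n.factorial_ne_zero))
    (Finset.prod_ne_zero_iff.2 fun j _ => add_natCast_ne_zero hz j)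
    (hc.differentiableAt.mul_const _) (by fun_prop),
    logDeriv_mul_const _ _ (by exact_mod_cast n.factorial_ne_zero),
    logDeriv_prod (fun j _ => add_natCast_ne_zero hz j) (fun j _ => by fun_prop), digammaSeq,
    logDeriv_apply, hc.deriv]
  congr 1
  · rw [mul_one, mul_div_cancel_left₀ _ (by simp [Complex.cpow_eq_zero_iff, hn']),
      Complex.natCast_log]
  · refine Finset.sum_congr rfl fun j _ => ?_
    rw [logDeriv_apply]
    simp

lemma ne_neg_natCast {z : ℂ} (hz : 0 < z.re) (m : ℕ) : z ≠ -m := fun h =>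
  add_natCast_ne_zero hz m (by rw [h]; simp)

/-- The limit formula `ψ(z) = lim (log n - ∑_{j ≤ n} 1 / (z + j))`. -/
lemma tendsto_digammaSeq {z : ℂ} (hz : 0 < z.re) :
    Tendsto (digammaSeq z) atTop (𝓝 (Complex.digamma z)) := by
  -- A disc of radius Re z / 2 stays in the right half-plane, with real parts in a compact interval
  -- on which the real Gamma function bounds all `GammaSeq`.
  have hr : 0 < z.re / 2 := half_pos hz
  have hball : ∀ w ∈ Metric.closedBall z (z.re / 2), z.re / 2 ≤ w.re ∧ w.re ≤ 3 * z.re / 2 := by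
    intro w hw
    rw [mem_closedBall_iff_norm] at hw
    have := abs_le.1 ((Complex.abs_re_le_norm (w - z)).trans hw)
    rw [Complex.sub_re] at this
    constructor <;> linarith [this.1, this.2]
  have hpos : ∀ w ∈ Metric.closedBall z (z.re / 2), 0 < w.re := fun w hw => hr.trans_le (hball w hw).1
  obtain ⟨M, hM⟩ := (isCompact_Icc (a := z.re / 2) (b := 3 * z.re / 2)).exists_bound_of_continuousOn
    (f := Real.Gamma) (fun x hx => (Real.differentiableAt_Gamma fun m h => by
      have h1 : 0 < x := hr.trans_le hx.1
      have h2 : (0 : ℝ) ≤ m := by positivity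
      linarith).continuousAt.continuousWithinAt)
  have h1 : Tendsto (fun n => deriv (fun s => Complex.GammaSeq s n) z) atTop
      (𝓝 (deriv Complex.Gamma z)) := by
    refine tendsto_deriv_of_bounded_of_tendsto (M := M) hr ?_ ?_ ?_ ?_
    · filter_upwards [eventually_ne_atTop 0] with n hn w hw
      exact (differentiableAt_GammaSeq hn (hpos w hw)).differentiableWithinAt
    · exact fun w hw => (Complex.differentiableAt_Gamma w
        (ne_neg_natCast (hpos w hw))).differentiableWithinAt
    · filter_upwards [eventually_ne_atTop 0] with n hn w hw
      have hw' := Metric.sphere_subset_closedBall hw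
      exact (norm_GammaSeq_le (hpos w hw') hn).trans
        ((le_abs_self _).trans (hM w.re (hball w hw')))
    · exact fun w _ => Complex.GammaSeq_tendsto_Gamma w
  have h2 := h1.div (Complex.GammaSeq_tendsto_Gamma z) (Complex.Gamma_ne_zero_of_re_pos hz)
  refine h2.congr' ?_
  filter_upwards [eventually_ne_atTop 0] with n hn
  rw [← logDeriv_GammaSeq hn hz, logDeriv_apply]
  rfl

lemma abs_log_sub_harmonic_le (n : ℕ) : |Real.log n - harmonic (n + 1)| ≤ 2 := by
  rcases Nat.eq_zero_or_pos n with rfl | hn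
  · norm_num [harmonic]
  have hn' : (0 : ℝ) < n := by exact_mod_cast hn
  have h1 := log_add_one_le_harmonic (n + 1)
  have h2 := harmonic_le_one_add_log (n + 1)
  push_cast at h1 h2 ⊢
  have h3 : Real.log n ≤ Real.log (n + 1 + 1) := Real.log_le_log hn' (by linarith)
  have h4 : Real.log (n + 1) ≤ Real.log n + 1 := by
    have : Real.log (n + 1) ≤ Real.log (2 * n) := Real.log_le_log (by positivity) (by
      have : (1 : ℝ) ≤ n := by exact_mod_cast hn
      linarith)
    rw [Real.log_mul (by norm_num) hn'.ne'] at this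
    linarith [Real.log_two_lt_d9]
  rw [abs_le]
  constructor <;> linarith

/-- Comparison with z = 1, where the sequence is log n minus a harmonic number: 1/(j+1) - 1/(z+j) =
(z-1)/((j+1)(z+j)) is O((1 + |z|)/(j+1)²), uniformly in n. The constant min(c, 1) is what makes |z +
j| ≥ c'(j + 1). -/
lemma norm_digammaSeq_le {c : ℝ} (hc : 0 < c) :
    ∃ K, 0 ≤ K ∧ ∀ z : ℂ, c ≤ z.re → ∀ n, ‖digammaSeq z n‖ ≤ K * (1 + ‖z‖) := by
  set c' := min c 1
  have hc' : 0 < c' := lt_min hc one_pos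
  have hsum : Summable fun j : ℕ => 1 / ((j : ℝ) + 1) ^ 2 := by
    have := (summable_nat_add_iff 1).2 (Real.summable_one_div_nat_pow.2 one_lt_two)
    simpa using this
  set S := ∑' j : ℕ, 1 / ((j : ℝ) + 1) ^ 2
  have hS : 0 ≤ S := tsum_nonneg fun j => by positivity
  refine ⟨2 + c'⁻¹ * S, by positivity, fun z hz n => ?_⟩
  have hz0 : 0 < z.re := hc.trans_le hz
  have h1 : digammaSeq z n = ((Real.log n - harmonic (n + 1) : ℝ) : ℂ) +
      ∑ j ∈ Finset.range (n + 1), (1 / ((j : ℂ) + 1) - 1 / (z + j)) := by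
    rw [digammaSeq, Finset.sum_sub_distrib, harmonic]
    push_cast
    simp only [one_div]
    ring
  have h2 : ∀ j : ℕ, ‖1 / ((j : ℂ) + 1) - 1 / (z + j)‖ ≤
      (1 + ‖z‖) * c'⁻¹ * (1 / ((j : ℝ) + 1) ^ 2) := by
    intro j
    have hj : (j : ℂ) + 1 ≠ 0 := Nat.cast_add_one_ne_zero j
    have hzj := add_natCast_ne_zero hz0 j
    have e : 1 / ((j : ℂ) + 1) - 1 / (z + j) = (z - 1) / (((j : ℂ) + 1) * (z + j)) := by
      field_simp; ring
    have hn1 : ‖(j : ℂ) + 1‖ = (j : ℝ) + 1 := by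
      rw [← Nat.cast_add_one, Complex.norm_natCast]; push_cast; rfl
    have hn2 : c' * ((j : ℝ) + 1) ≤ ‖z + j‖ := by
      refine le_trans ?_ (Complex.re_le_norm _)
      rw [Complex.add_re, Complex.natCast_re]
      have h3 : c' ≤ c := min_le_left _ _
      have h4 : c' ≤ 1 := min_le_right _ _
      have h5 : (0 : ℝ) ≤ j := by positivity
      nlinarith
    rw [e, norm_div, norm_mul, hn1]
    have hnum : ‖z - 1‖ ≤ 1 + ‖z‖ := by
      refine (norm_sub_le _ _).trans ?_; rw [norm_one, add_comm]
    calc ‖z - 1‖ / (((j : ℝ) + 1) * ‖z + j‖)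
        ≤ (1 + ‖z‖) / (((j : ℝ) + 1) * (c' * ((j : ℝ) + 1))) := by gcongr
      _ = _ := by field_simp
  rw [h1]
  refine (norm_add_le _ _).trans ?_
  rw [Complex.norm_real, Real.norm_eq_abs]
  have h3 := abs_log_sub_harmonic_le n
  have h4 : ‖∑ j ∈ Finset.range (n + 1), (1 / ((j : ℂ) + 1) - 1 / (z + j))‖ ≤
      (1 + ‖z‖) * c'⁻¹ * S := by
    refine (norm_sum_le_of_le _ fun j _ => h2 j).trans ?_
    rw [← Finset.mul_sum]
    gcongr
    exact hsum.sum_le_tsum _ fun j _ => by positivity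
  nlinarith [norm_nonneg z]

lemma norm_digamma_le {c : ℝ} (hc : 0 < c) :
    ∃ K, 0 ≤ K ∧ ∀ z : ℂ, c ≤ z.re → ‖Complex.digamma z‖ ≤ K * (1 + ‖z‖) := by
  obtain ⟨K, hK0, hK⟩ := norm_digammaSeq_le hc
  refine ⟨K, hK0, fun z hz => le_of_tendsto (tendsto_digammaSeq (hc.trans_le hz)).norm
    (Eventually.of_forall fun n => hK z hz n)⟩

lemma digamma_conj {z : ℂ} (hz : 0 < z.re) :
    Complex.digamma ((starRingEnd ℂ) z) = (starRingEnd ℂ) (Complex.digamma z) := by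
  have h1 := tendsto_digammaSeq (z := (starRingEnd ℂ) z) (by simpa using hz)
  have h2 := (Complex.continuous_conj.tendsto _).comp (tendsto_digammaSeq hz)
  refine tendsto_nhds_unique h1 (h2.congr fun n => ?_)
  simp only [Function.comp_apply, digammaSeq, map_sub, Complex.conj_ofReal, map_sum, map_div₀,
    map_one, map_add, map_natCast]

lemma continuousAt_digamma {z : ℂ} (hz : 0 < z.re) : ContinuousAt Complex.digamma z := by
  have hopen : IsOpen {w : ℂ | 0 < w.re} := isOpen_lt continuous_const Complex.continuous_re
  have hd : DifferentiableOn ℂ Complex.Gamma {w : ℂ | 0 < w.re} := fun w hw =>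
    (Complex.differentiableAt_Gamma w (ne_neg_natCast hw)).differentiableWithinAt
  have h1 : ContinuousAt (deriv Complex.Gamma) z :=
    ((hd.deriv hopen).differentiableAt (hopen.mem_nhds hz)).continuousAt
  exact h1.div (hd.differentiableAt (hopen.mem_nhds hz)).continuousAt
    (Complex.Gamma_ne_zero_of_re_pos hz)

/-- Re ψ(x + iy) - ψ(x) is the series of the positive terms y²/((x+j)((x+j)²+y²)). For |y| ≥ x + J
each of the first J terms is at least 1/(2(j+1)), as x ≤ 1, and the harmonic series diverges. -/
lemma re_digamma_tendsto (x : ℝ) (hx : 0 < x) (hx1 : x ≤ 1) (M : ℝ) :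
    ∃ T : ℝ, ∀ y : ℝ, T ≤ |y| → M ≤ (Complex.digamma (x + y * Complex.I)).re := by
  obtain ⟨J, hJ⟩ : ∃ J : ℕ, 2 * (M - (Complex.digamma x).re) ≤ (harmonic J : ℝ) := by
    obtain ⟨J, hJ⟩ := ((Real.tendsto_log_atTop.comp tendsto_natCast_atTop_atTop).eventually_ge_atTop
      (2 * (M - (Complex.digamma x).re))).exists
    refine ⟨J, le_trans hJ ?_⟩
    refine le_trans ?_ (log_add_one_le_harmonic J)
    rcases Nat.eq_zero_or_pos J with rfl | h
    · simp
    · exact Real.log_le_log (by exact_mod_cast h) (by push_cast; linarith)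
  refine ⟨x + J, fun y hy => ?_⟩
  have h1 : Tendsto (fun n => (digammaSeq (x + y * Complex.I) n).re - (digammaSeq x n).re) atTop
      (𝓝 ((Complex.digamma (x + y * Complex.I)).re - (Complex.digamma x).re)) :=
    ((Complex.continuous_re.tendsto _).comp (tendsto_digammaSeq (by simpa using hx))).sub
      ((Complex.continuous_re.tendsto _).comp (tendsto_digammaSeq (by simpa using hx)))
  have h2 : ∀ᶠ n : ℕ in atTop, (harmonic J : ℝ) / 2 ≤
      (digammaSeq (x + y * Complex.I) n).re - (digammaSeq x n).re := by
    filter_upwards [eventually_ge_atTop J] with n hn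
    have e : (digammaSeq (x + y * Complex.I) n).re - (digammaSeq x n).re =
        ∑ j ∈ Finset.range (n + 1), (1 / (x + j) - (x + j) / ((x + j) ^ 2 + y ^ 2)) := by
      simp only [digammaSeq, Complex.sub_re, Complex.re_sum, Finset.sum_sub_distrib]
      have e1 : ∀ j : ℕ, (1 / ((x : ℂ) + j)).re = 1 / (x + j) := fun j => by
        rw [show (1 / ((x : ℂ) + j)) = ((1 / (x + j) : ℝ) : ℂ) by push_cast; rfl,
          Complex.ofReal_re]
      have e2 : ∀ j : ℕ, (1 / ((x : ℂ) + y * Complex.I + j)).re =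
          (x + j) / ((x + j) ^ 2 + y ^ 2) := fun j => by
        rw [one_div, Complex.inv_re, Complex.normSq_apply]
        simp [sq]
      simp only [e1, e2]
      ring
    have hterm : ∀ j : ℕ, 1 / (x + j) - (x + j) / ((x + j) ^ 2 + y ^ 2) =
        y ^ 2 / ((x + j) * ((x + j) ^ 2 + y ^ 2)) := fun j => by
      have hxj : 0 < x + j := by positivity
      have : 0 < (x + j) ^ 2 + y ^ 2 := by positivity
      field_simp
      ring
    rw [e, harmonic]
    push_cast
    rw [Finset.sum_div]
    calc ∑ j ∈ Finset.range J, ((j : ℝ) + 1)⁻¹ / 2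
        ≤ ∑ j ∈ Finset.range J, (1 / (x + j) - (x + j) / ((x + j) ^ 2 + y ^ 2)) := by
          refine Finset.sum_le_sum fun j hj => ?_
          have hj' : (j : ℝ) ≤ J := by exact_mod_cast (Finset.mem_range.1 hj).le
          have hxj : 0 < x + j := by positivity
          have hy2 : (x + j) ^ 2 ≤ y ^ 2 := by
            rw [← sq_abs y]; gcongr; linarith
          rw [hterm, inv_eq_one_div, div_div, div_le_div_iff₀ (by positivity) (by positivity)]
          nlinarith
      _ ≤ _ := by
          refine Finset.sum_le_sum_of_subset_of_nonneg
            (Finset.range_mono (by omega)) fun j _ _ => ?_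
          rw [hterm]; positivity
  have h3 := ge_of_tendsto h1 h2
  linarith

/-! ### The archimedean Weil term -/

lemma hasDerivAt_Gammaℝ {s : ℂ} (hs : 0 < s.re) :
    HasDerivAt Complex.Gammaℝ (Complex.Gammaℝ s *
      (-(Real.log Real.pi : ℂ) / 2 + Complex.digamma (s / 2) / 2)) s := by
  have hpi : (Real.pi : ℂ) ≠ 0 := by exact_mod_cast Real.pi_ne_zero
  have hs2 : 0 < (s / 2).re := by
    rw [show s / 2 = ((1 / 2 : ℝ) : ℂ) * s by push_cast; ring, Complex.re_ofReal_mul]; positivity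
  have h1 : HasDerivAt (fun s : ℂ => (Real.pi : ℂ) ^ (-s / 2))
      ((Real.pi : ℂ) ^ (-s / 2) * Complex.log Real.pi * (-1 / 2)) s :=
    (((hasDerivAt_id s).neg).div_const 2).const_cpow (Or.inl hpi)
  have h2 : HasDerivAt (fun s : ℂ => Complex.Gamma (s / 2))
      (deriv Complex.Gamma (s / 2) * (1 / 2)) s :=
    (Complex.differentiableAt_Gamma _ (ne_neg_natCast hs2)).hasDerivAt.comp s
      ((hasDerivAt_id s).div_const 2)
  refine (h1.mul h2).congr_deriv ?_
  rw [Complex.Gammaℝ_def, Complex.digamma_def, logDeriv_apply,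
    Complex.ofReal_log Real.pi_pos.le]
  have := Complex.Gamma_ne_zero_of_re_pos hs2
  field_simp

lemma logDeriv_Gammaℝ {s : ℂ} (hs : 0 < s.re) :
    logDeriv Complex.Gammaℝ s = -(Real.log Real.pi : ℂ) / 2 + Complex.digamma (s / 2) / 2 := by
  rw [logDeriv_apply, (hasDerivAt_Gammaℝ hs).deriv,
    mul_div_cancel_left₀ _ (Complex.Gammaℝ_ne_zero_of_re_pos hs)]

/-- The function `log π - Re ψ(1/4 + i t / 2)`. -/
def archWeight (t : ℝ) : ℝ :=
  Real.log Real.pi - (Complex.digamma (1 / 4 + t / 2 * Complex.I)).re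

lemma quarter_re (t : ℝ) : (1 / 4 + t / 2 * Complex.I : ℂ).re = 1 / 4 := by
  rw [show (1 / 4 + t / 2 * Complex.I : ℂ) = ((1 / 4 : ℝ) : ℂ) + ((t / 2 : ℝ) : ℂ) * Complex.I by
    push_cast; ring]
  simp

lemma continuous_archWeight : Continuous archWeight := by
  unfold archWeight
  refine continuous_const.sub (Complex.continuous_re.comp ?_)
  rw [continuous_iff_continuousAt]
  intro t
  have h : ContinuousAt (fun t : ℝ => (1 / 4 + t / 2 * Complex.I : ℂ)) t := by fun_prop
  exact ContinuousAt.comp (g := Complex.digamma)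
    (continuousAt_digamma (by rw [quarter_re]; norm_num)) h

lemma norm_quarter_le (t : ℝ) : 1 + ‖(1 / 4 + t / 2 * Complex.I : ℂ)‖ ≤ 2 * (1 + |t|) := by
  have h : ‖(1 / 4 + t / 2 * Complex.I : ℂ)‖ ≤ 1 / 4 + |t| / 2 := by
    refine (norm_add_le _ _).trans ?_
    simp
  linarith [abs_nonneg t]

lemma exists_abs_archWeight_le : ∃ K, 0 ≤ K ∧ ∀ t, |archWeight t| ≤ K * (1 + |t|) := by
  obtain ⟨K, hK0, hK⟩ := norm_digamma_le (c := 1 / 4) (by norm_num)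
  have hl : 0 ≤ |Real.log Real.pi| := abs_nonneg _
  refine ⟨|Real.log Real.pi| + 2 * K, by positivity, fun t => ?_⟩
  have h1 := hK (1 / 4 + t / 2 * Complex.I) (quarter_re t).ge
  have h2 := Complex.abs_re_le_norm (Complex.digamma (1 / 4 + t / 2 * Complex.I))
  have h3 := norm_quarter_le t
  have h4 : |archWeight t| ≤ |Real.log Real.pi| +
      |(Complex.digamma (1 / 4 + t / 2 * Complex.I)).re| := abs_sub _ _
  nlinarith [abs_nonneg t]

/-- For Re s = 1/2 one has 1 - s = conj s, so the two logarithmic derivatives are conjugate and add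
up to twice a real part. -/
lemma weilTerm_Gammaℝ {f : ℝ → ℂ} (hf : IsTest f) :
    weilTerm Complex.Gammaℝ (autoConv f) =
      ((1 / (2 * Real.pi) * ∫ t, critSq f t * archWeight t : ℝ) : ℂ) := by
  rw [weilTerm, Complex.ofReal_mul, ← integral_complex_ofReal]
  congr 2
  ext t
  have h1 : 0 < (1 / 2 + t * Complex.I : ℂ).re := by rw [critLine_re]; norm_num
  have h2 : 0 < (1 / 2 + ((-t : ℝ) : ℂ) * Complex.I : ℂ).re := by rw [critLine_re]; norm_num
  have h3 : 0 < (1 - (1 / 2 + t * Complex.I) : ℂ).re := by rw [critLine_reflect]; exact h2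
  rw [hf.mellin_autoConv_crit, logDeriv_reflect_div (hasDerivAt_Gammaℝ h1).differentiableAt
    (hasDerivAt_Gammaℝ h3).differentiableAt (Complex.Gammaℝ_ne_zero_of_re_pos h1)
    (Complex.Gammaℝ_ne_zero_of_re_pos h3), logDeriv_Gammaℝ h1, logDeriv_Gammaℝ h3]
  have e1 : (1 / 2 + t * Complex.I : ℂ) / 2 = 1 / 4 + t / 2 * Complex.I := by ring
  have e2 : (1 - (1 / 2 + t * Complex.I) : ℂ) / 2 =
      (starRingEnd ℂ) (1 / 4 + t / 2 * Complex.I) := by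
    rw [show (1 / 4 + t / 2 * Complex.I : ℂ) = ((1 / 4 : ℝ) : ℂ) + ((t / 2 : ℝ) : ℂ) * Complex.I by
      push_cast; ring]
    rw [map_add, map_mul, Complex.conj_ofReal, Complex.conj_ofReal, Complex.conj_I]
    push_cast
    ring
  rw [e1, e2, digamma_conj (by rw [quarter_re]; norm_num), archWeight]
  have e3 := Complex.add_conj (Complex.digamma (1 / 4 + t / 2 * Complex.I))
  push_cast at e3 ⊢
  linear_combination (-(critSq f t : ℂ) / 2) * e3

/-! ### The Weil sum as an integral over the critical line -/

/-- The weight of the Weil sum on the critical line, truncated at `N`. -/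
def weilWeight (N : ℕ) (t : ℝ) : ℝ :=
  archWeight t + ∑ n ∈ Finset.range N,
    ArithmeticFunction.vonMangoldt n * (n : ℝ) ^ (-(1 / 2 : ℝ)) * (2 * Real.cos (t * Real.log n))

lemma continuous_weilWeight (N : ℕ) : Continuous (weilWeight N) := by
  unfold weilWeight
  exact continuous_archWeight.add (by fun_prop)

lemma exists_abs_weilWeight_sub_archWeight_le (N : ℕ) :
    ∃ K, 0 ≤ K ∧ ∀ t, |weilWeight N t - archWeight t| ≤ K := by
  refine ⟨∑ n ∈ Finset.range N,
    ArithmeticFunction.vonMangoldt n * (n : ℝ) ^ (-(1 / 2 : ℝ)) * 2, ?_, fun t => ?_⟩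
  · exact Finset.sum_nonneg fun n _ => mul_nonneg
      (mul_nonneg ArithmeticFunction.vonMangoldt_nonneg (by positivity)) (by norm_num)
  · rw [weilWeight, add_sub_cancel_left]
    refine (Finset.abs_sum_le_sum_abs _ _).trans (Finset.sum_le_sum fun n _ => ?_)
    have h0 : 0 ≤ ArithmeticFunction.vonMangoldt n * (n : ℝ) ^ (-(1 / 2 : ℝ)) :=
      mul_nonneg ArithmeticFunction.vonMangoldt_nonneg (by positivity)
    rw [abs_mul, abs_of_nonneg h0, abs_mul, abs_two]
    have := Real.abs_cos_le_one (t * Real.log n)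
    exact mul_le_mul_of_nonneg_left (by linarith) h0

lemma exists_abs_weilWeight_le (N : ℕ) : ∃ K, 0 ≤ K ∧ ∀ t, |weilWeight N t| ≤ K * (1 + |t|) := by
  obtain ⟨K, hK0, hK⟩ := exists_abs_archWeight_le
  obtain ⟨K', hK0', hK'⟩ := exists_abs_weilWeight_sub_archWeight_le N
  refine ⟨K + K', by positivity, fun t => ?_⟩
  have h := abs_add_le (weilWeight N t - archWeight t) (archWeight t)
  rw [sub_add_cancel] at h
  nlinarith [hK t, hK' t, abs_nonneg t]

lemma IsTest.integrable_critSq_weilWeight_mul {f : ℝ → ℂ} (hf : IsTest f) (N : ℕ) {S : ℝ → ℝ}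
    (hS : Continuous S) {K : ℝ} {n : ℕ} (hK : ∀ t, |S t| ≤ K * (1 + |t|) ^ n) :
    Integrable fun t => critSq f t * (S t * weilWeight N t) := by
  obtain ⟨K', hK0', hK'⟩ := exists_abs_weilWeight_le N
  refine hf.integrable_critSq_mul (S := fun t => S t * weilWeight N t) (K := K * K') (n := n + 1)
    (hS.mul (continuous_weilWeight N)).aestronglyMeasurable fun t => ?_
  rw [Real.norm_eq_abs, abs_mul]
  calc |S t| * |weilWeight N t| ≤ (K * (1 + |t|) ^ n) * (K' * (1 + |t|)) :=
        mul_le_mul (hK t) (hK' t) (abs_nonneg _) ((abs_nonneg _).trans (hK t))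
    _ = _ := by ring

lemma IsTest.integrable_critSq_weilWeight {f : ℝ → ℂ} (hf : IsTest f) (N : ℕ) :
    Integrable fun t => critSq f t * weilWeight N t := by
  simpa using hf.integrable_critSq_weilWeight_mul N (S := fun _ => 1) continuous_const
    (K := 1) (n := 0) (by simp)

lemma exp_add_exp_eq_cos (x : ℝ) :
    Complex.exp (-(x : ℂ) * Complex.I) + Complex.exp ((x : ℂ) * Complex.I) =
      ((2 * Real.cos x : ℝ) : ℂ) := by
  push_cast
  rw [Complex.cos]
  ring

lemma weilCoeff_eq_ofReal {f : ℝ → ℂ} (hf : IsTest f) (n : ℕ) :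
    weilCoeff f n = ((1 / (2 * Real.pi) * ∫ t, critSq f t *
      (ArithmeticFunction.vonMangoldt n * (n : ℝ) ^ (-(1 / 2 : ℝ)) *
        (2 * Real.cos (t * Real.log n))) : ℝ) : ℂ) := by
  rw [weilCoeff_eq_integral hf, Complex.ofReal_mul (1 / (2 * Real.pi)), ← integral_complex_ofReal]
  congr 2
  ext t
  have h := exp_add_exp_eq_cos (t * Real.log n)
  rw [neg_mul t, Complex.ofReal_neg (t * _), neg_neg, h]
  push_cast
  ring

lemma IsTest.integrable_critSq_cos {f : ℝ → ℂ} (hf : IsTest f) (n : ℕ) :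
    Integrable fun t => critSq f t * (ArithmeticFunction.vonMangoldt n *
      (n : ℝ) ^ (-(1 / 2 : ℝ)) * (2 * Real.cos (t * Real.log n))) := by
  have := hf.integrable_critSq_mul (S := fun t => ArithmeticFunction.vonMangoldt n *
    (n : ℝ) ^ (-(1 / 2 : ℝ)) * (2 * Real.cos (t * Real.log n))) (by fun_prop)
    (K := ArithmeticFunction.vonMangoldt n * (n : ℝ) ^ (-(1 / 2 : ℝ)) * 2) (n := 0) (fun t => by
      have h0 : 0 ≤ ArithmeticFunction.vonMangoldt n * (n : ℝ) ^ (-(1 / 2 : ℝ)) :=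
        mul_nonneg ArithmeticFunction.vonMangoldt_nonneg (by positivity)
      rw [Real.norm_eq_abs, abs_mul, abs_of_nonneg h0, abs_mul, abs_two, pow_zero, mul_one]
      have := Real.abs_cos_le_one (t * Real.log n)
      exact mul_le_mul_of_nonneg_left (by linarith) h0)
  exact this

/-- The Weil sum of `f * conj f^*` as an integral over the critical line. -/
lemma weilSum_eq {f : ℝ → ℂ} (hf : IsTest f) {a b : ℝ} (ha : 0 < a) (hab : a ≤ b)
    (h : SuppIn a b f) {N : ℕ} (hN : b / a < N) :
    weilSum (autoConv f) = ((1 / (2 * Real.pi) * ∫ t, critSq f t * weilWeight N t : ℝ) : ℂ) := by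
  rw [weilSum, tsum_weilTerm_zetaFactor hf ha hab h hN, weilTerm_Gammaℝ hf]
  simp only [weilCoeff_eq_ofReal hf]
  rw [← Complex.ofReal_sum, ← Complex.ofReal_add, ← Finset.mul_sum, ← mul_add,
    ← integral_finsetSum, ← integral_add]
  · congr 3
    ext t
    rw [weilWeight, mul_add, Finset.mul_sum]
  · simpa [weilWeight] using hf.integrable_critSq_weilWeight 0
  · exact integrable_finsetSum _ fun n _ => hf.integrable_critSq_cos n
  · exact fun n _ => hf.integrable_critSq_cos n

/-! ### Linear combinations and differential operators on test functions -/

lemma SuppIn.add {a b : ℝ} {f h : ℝ → ℂ} (hf : SuppIn a b f) (hh : SuppIn a b h) :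
    SuppIn a b (fun x => f x + h x) := fun x hx => by simp [hf x hx, hh x hx]

lemma SuppIn.const_mul {a b : ℝ} {f : ℝ → ℂ} (hf : SuppIn a b f) (c : ℂ) :
    SuppIn a b (fun x => c * f x) := fun x hx => by simp [hf x hx]

lemma IsTest.add {f h : ℝ → ℂ} (hf : IsTest f) (hh : IsTest h) : IsTest (fun x => f x + h x) := by
  obtain ⟨a, b, ha, -, hs⟩ := hf.exists_suppIn
  obtain ⟨a', b', ha', -, hs'⟩ := hh.exists_suppIn
  exact .of_suppIn (lt_min ha ha') (hf.smooth.add hh.smooth)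
    ((hs.mono (min_le_left _ _) (le_max_left _ _)).add (hs'.mono (min_le_right a a')
      (le_max_right b b')))

lemma IsTest.const_mul {f : ℝ → ℂ} (hf : IsTest f) (c : ℂ) : IsTest (fun x => c * f x) := by
  obtain ⟨a, b, ha, -, hs⟩ := hf.exists_suppIn
  exact .of_suppIn ha (contDiff_const.mul hf.smooth) (hs.const_mul c)

lemma IsTest.mellinConvergent {f : ℝ → ℂ} (hf : IsTest f) (s : ℂ) : MellinConvergent f s := by
  obtain ⟨a, b, ha, -, hs⟩ := hf.exists_suppIn
  exact hs.mellinConvergent ha hf.continuous s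

lemma IsTest.mellin_add {f h : ℝ → ℂ} (hf : IsTest f) (hh : IsTest h) (s : ℂ) :
    mellin (fun x => f x + h x) s = mellin f s + mellin h s :=
  (hasMellin_add (hf.mellinConvergent s) (hh.mellinConvergent s)).2

lemma mellin_const_mul (f : ℝ → ℂ) (c s : ℂ) : mellin (fun x => c * f x) s = c * mellin f s :=
  mellin_const_smul f s c

/-- The operator `x d/dx + c`. -/
def shiftD (c : ℂ) (f : ℝ → ℂ) (x : ℝ) : ℂ := eulerD f x + c * f x

lemma IsTest.shiftD {f : ℝ → ℂ} (hf : IsTest f) (c : ℂ) : IsTest (shiftD c f) :=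
  hf.eulerD.add (hf.const_mul c)

lemma SuppIn.shiftD {a b : ℝ} {f : ℝ → ℂ} (hf : SuppIn a b f) (c : ℂ) : SuppIn a b (shiftD c f) :=
  hf.eulerD.add (hf.const_mul c)

lemma IsTest.mellin_shiftD {f : ℝ → ℂ} (hf : IsTest f) (c s : ℂ) :
    mellin (BohrWeil.shiftD c f) s = (c - s) * mellin f s := by
  obtain ⟨a, b, ha, -, hs⟩ := hf.exists_suppIn
  have := hf.eulerD.mellin_add (hf.const_mul c) s
  rw [mellin_eulerD ha hs hf.smooth, mellin_const_mul] at this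
  rw [show BohrWeil.shiftD c f = fun x => BohrWeil.eulerD f x + c * f x from rfl, this]
  ring

lemma IsTest.iterate_shiftD {f : ℝ → ℂ} (hf : IsTest f) (c : ℂ) (n : ℕ) :
    IsTest ((BohrWeil.shiftD c)^[n] f) := by
  induction n with
  | zero => exact hf
  | succ n ih => rw [Function.iterate_succ_apply']; exact ih.shiftD c

lemma SuppIn.iterate_shiftD {a b : ℝ} {f : ℝ → ℂ} (hf : SuppIn a b f) (c : ℂ) (n : ℕ) :
    SuppIn a b ((BohrWeil.shiftD c)^[n] f) := by
  induction n with
  | zero => exact hf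
  | succ n ih => rw [Function.iterate_succ_apply']; exact ih.shiftD c

lemma IsTest.mellin_iterate_shiftD {f : ℝ → ℂ} (hf : IsTest f) (c s : ℂ) (n : ℕ) :
    mellin ((BohrWeil.shiftD c)^[n] f) s = (c - s) ^ n * mellin f s := by
  induction n with
  | zero => simp
  | succ n ih =>
    rw [Function.iterate_succ_apply', (hf.iterate_shiftD c n).mellin_shiftD, ih, pow_succ']
    ring

/-! ### Strict negativity -/

lemma IsTest.eq_zero_of_mellin {f : ℝ → ℂ} (hf : IsTest f) (h : ∀ t, critSq f t = 0) : f = 0 := by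
  obtain ⟨a, b, ha, -, hs⟩ := hf.exists_suppIn
  have hcrit : ∀ t : ℝ, mellin f (((1 / 2 : ℝ) : ℂ) + t * Complex.I) = 0 := fun t => by
    have := h t
    rw [critSq, sq_eq_zero_iff, norm_eq_zero, critMellin] at this
    rw [← this]; push_cast; rfl
  ext x
  rcases le_or_gt x 0 with hx | hx
  · exact hs x fun h' => absurd (ha.trans_le h'.1) (not_lt.2 hx)
  · rw [← mellinInv_mellin_eq (1 / 2) f hx (hf.mellinConvergent _) ?_ hf.continuous.continuousAt,
      mellinInv]
    · simp only [hcrit]; simp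
    · unfold Complex.VerticalIntegrable
      simp only [hcrit]
      exact integrable_zero _ _ _

/-- The Mellin transform is entire; vanishing on a half-line of the critical line would make it
identically zero, and f with it by inversion. -/
lemma IsTest.exists_critSq_pos {f : ℝ → ℂ} (hf : IsTest f) (h0 : f ≠ 0) (T : ℝ) :
    ∃ t, T < t ∧ 0 < critSq f t := by
  by_contra! hcon
  refine h0 (hf.eq_zero_of_mellin ?_)
  obtain ⟨a, b, ha, -, hs⟩ := hf.exists_suppIn
  have hd := hs.differentiable_mellin ha hf.continuous
  have hzero : ∀ t : ℝ, T < t → mellin f (1 / 2 + t * Complex.I) = 0 := fun t ht => by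
    have h1 : critSq f t = 0 := le_antisymm (hcon t ht) (critSq_nonneg _ _)
    simpa [critSq, critMellin] using h1
  have han : AnalyticOnNhd ℂ (mellin f) univ := hd.differentiableOn.analyticOnNhd isOpen_univ
  have hfreq : ∃ᶠ z in 𝓝[≠] (1 / 2 + ((T + 1 : ℝ) : ℂ) * Complex.I), mellin f z = 0 := by
    have hmap : Tendsto (fun t : ℝ => (1 / 2 + (t : ℂ) * Complex.I : ℂ)) (𝓝[≠] (T + 1))
        (𝓝[≠] (1 / 2 + ((T + 1 : ℝ) : ℂ) * Complex.I)) := by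
      refine tendsto_nhdsWithin_iff.2 ⟨?_, ?_⟩
      · refine (Continuous.tendsto (by fun_prop) _).mono_left nhdsWithin_le_nhds
      · filter_upwards [self_mem_nhdsWithin] with t ht h
        refine ht ?_
        have := congrArg Complex.im h
        simpa using this
    refine hmap.frequently (Eventually.frequently ?_)
    filter_upwards [nhdsWithin_le_nhds (Ioi_mem_nhds (show T < T + 1 by linarith))] with t ht
      using hzero t ht
  have := han.eqOn_zero_of_preconnected_of_frequently_eq_zero isPreconnected_univ (mem_univ _) hfreq
  intro t
  rw [critSq, critMellin, this (mem_univ _)]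
  simp

/-- Near x = 0 the linear term dominates the quadratic one; the witness B/(|C| + 1) is small enough
for any C. -/
lemma linear_coeff_eq_zero {B C : ℝ} (h : ∀ x : ℝ, 2 * x * B + x ^ 2 * C ≤ 0) : B = 0 := by
  have hp : 0 < |C| + 1 := by positivity
  have h1 := h (B / (|C| + 1))
  have e : 2 * (B / (|C| + 1)) * B + (B / (|C| + 1)) ^ 2 * C =
      B ^ 2 * (2 * (|C| + 1) + C) / (|C| + 1) ^ 2 := by field_simp
  rw [e, div_le_iff₀ (by positivity), zero_mul] at h1
  have h2 : 0 < 2 * (|C| + 1) + C := by linarith [neg_abs_le C]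
  have h3 : B ^ 2 ≤ 0 := by
    by_contra! hB
    exact absurd (mul_pos hB h2) (not_lt.2 h1)
  exact pow_eq_zero_iff two_ne_zero |>.1 (le_antisymm h3 (sq_nonneg B))

/-- The prime part of the weight is bounded and the archimedean part tends to -∞ with the digamma
function. -/
lemma exists_weilWeight_le (N : ℕ) (M : ℝ) : ∃ T : ℝ, ∀ t, T ≤ |t| → weilWeight N t ≤ M := by
  obtain ⟨K, -, hK⟩ := exists_abs_weilWeight_sub_archWeight_le N
  obtain ⟨T, hT⟩ := re_digamma_tendsto (1 / 4) (by norm_num) (by norm_num)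
    (Real.log Real.pi + K - M)
  refine ⟨2 * T, fun t ht => ?_⟩
  have h1 := hT (t / 2) (by rw [abs_div, abs_two]; linarith)
  have e : (((1 / 4 : ℝ) : ℂ) + ((t / 2 : ℝ) : ℂ) * Complex.I) = 1 / 4 + t / 2 * Complex.I := by
    push_cast; ring
  rw [e] at h1
  have h2 := (abs_le.1 (hK t)).2
  have h3 : archWeight t = Real.log Real.pi - (Complex.digamma (1 / 4 + t / 2 * Complex.I)).re :=
    rfl
  linarith

/-- A Weil sum that is nonpositive for all test functions is negative for nonzero ones. -/
lemma weilSum_neg_of_nonpos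
    (H : ∀ f, IsTest f → mellin f 0 = 0 → mellin f 1 = 0 → (weilSum (autoConv f)).re ≤ 0)
    {f : ℝ → ℂ} (hf : IsTest f) (hf0 : mellin f 0 = 0) (hf1 : mellin f 1 = 0) (hne : f ≠ 0) :
    (weilSum (autoConv f)).re < 0 := by
  refine lt_of_le_of_ne (H f hf hf0 hf1) fun hzero => ?_
  obtain ⟨a, b, ha, hab, hs⟩ := hf.exists_suppIn
  obtain ⟨N, hN⟩ := exists_nat_gt (b / a)
  have hpi : 0 < 1 / (2 * Real.pi) := by positivity
  rw [weilSum_eq hf ha hab hs hN, Complex.ofReal_re, mul_eq_zero, or_iff_right hpi.ne'] at hzero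
  -- the moments vanish
  have habs : ∀ n (t : ℝ), |t ^ n| ≤ 1 * (1 + |t|) ^ n := fun n t => by
    rw [abs_pow, one_mul]; gcongr; linarith
  have hint : ∀ n, Integrable fun t => critSq f t * (t ^ n * weilWeight N t) := fun n =>
    hf.integrable_critSq_weilWeight_mul N (by fun_prop) (habs n)
  have hmom : ∀ m : ℕ, ∫ t, critSq f t * (t ^ (4 * m) * weilWeight N t) = 0 := by
    intro m
    -- The operator D = y d/dy + 1/2 multiplies the Mellin transform on the critical line by -it, so
    -- D^{4m} multiplies it by the real number t^{4m}. The Weil sum of f + x D^{4m} f is nonpositive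
    -- for all real x and is, up to a positive factor, a quadratic polynomial in x without constant
    -- term, whose linear coefficient is twice the moment.
    refine linear_coeff_eq_zero (C := ∫ t, critSq f t * (t ^ (8 * m) * weilWeight N t)) fun x => ?_
    set f' : ℝ → ℂ := fun y => f y + x * ((shiftD (1 / 2))^[4 * m] f) y
    have hD := hf.iterate_shiftD (1 / 2) (4 * m)
    have hf' : IsTest f' := hf.add (hD.const_mul x)
    have hs' : SuppIn a b f' := hs.add ((hs.iterate_shiftD _ _).const_mul x)
    have hmel : ∀ s, mellin f' s = (1 + x * (1 / 2 - s) ^ (4 * m)) * mellin f s := fun s => by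
      rw [hf.mellin_add (hD.const_mul x), mellin_const_mul, hf.mellin_iterate_shiftD]; ring
    have hsq : ∀ t, critSq f' t = critSq f t * (1 + x * t ^ (4 * m)) ^ 2 := fun t => by
      have e : (1 + x * (1 / 2 - (1 / 2 + t * Complex.I)) ^ (4 * m) : ℂ) =
          ((1 + x * t ^ (4 * m) : ℝ) : ℂ) := by
        have h4 : (-(t * Complex.I)) ^ 4 = (t : ℂ) ^ 4 := by
          rw [neg_pow, mul_pow, Complex.I_pow_four]; ring
        rw [sub_add_cancel_left, pow_mul, h4, ← pow_mul]
        push_cast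
        rfl
      rw [critSq, critMellin, hmel, e, norm_mul, mul_pow, Complex.norm_real, Real.norm_eq_abs,
        sq_abs, mul_comm]
      rfl
    have h1 := H f' hf' (by rw [hmel, hf0, mul_zero]) (by rw [hmel, hf1, mul_zero])
    rw [weilSum_eq hf' ha hab hs' hN, Complex.ofReal_re] at h1
    have h2 := nonpos_of_mul_nonpos_right h1 hpi
    have e2 : ∫ t, critSq f' t * weilWeight N t = ∫ t, (critSq f t * weilWeight N t +
        2 * x * (critSq f t * (t ^ (4 * m) * weilWeight N t)) +
        x ^ 2 * (critSq f t * (t ^ (8 * m) * weilWeight N t))) := by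
      congr 1; ext t
      rw [hsq, show 8 * m = 4 * m * 2 by ring, pow_mul t (4 * m) 2]
      ring
    have i1 := hf.integrable_critSq_weilWeight N
    have i2 := (hint (4 * m)).const_mul (2 * x)
    have i3 := (hint (8 * m)).const_mul (x ^ 2)
    have e3 := integral_add (i1.add i2) i3
    have e4 := integral_add i1 i2
    simp only [Pi.add_apply] at e3
    rw [e2, e3, e4, integral_const_mul, integral_const_mul, hzero, zero_add] at h2
    exact h2
  obtain ⟨K, hK0, hK⟩ := exists_abs_weilWeight_le N
  obtain ⟨T₀, hT₀⟩ := exists_weilWeight_le N (-1)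
  -- Beyond T the weight is at most -1. In the moment of order 4m the part |t| < T contributes at
  -- most T^{4m} A and the part t > 2T at most -(2T)^{4m} B; since the total is zero, 16^m B ≤ A for
  -- every m, which is impossible as B > 0.
  set T := max T₀ 1
  have hT1 : 1 ≤ T := le_max_right _ _
  set A := K * (1 + T) * ∫ t, critSq f t
  set B := ∫ t in Ioi (2 * T), critSq f t
  have hB : 0 < B := by
    obtain ⟨t₀, ht₀, hpos⟩ := hf.exists_critSq_pos hne (2 * T)
    refine (setIntegral_pos_iff_support_of_nonneg_ae (ae_of_all _ fun t => critSq_nonneg f t)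
      hf.integrable_critSq.integrableOn).2 ?_
    have hopen : IsOpen (Function.support (critSq f) ∩ Ioi (2 * T)) :=
      (isOpen_ne.preimage hf.continuous_critSq).inter isOpen_Ioi
    exact hopen.measure_pos _ ⟨t₀, hpos.ne', ht₀⟩
  have hbound : ∀ m : ℕ, (16 : ℝ) ^ m * B ≤ A := by
    intro m
    have hpt : ∀ t, critSq f t * (t ^ (4 * m) * weilWeight N t) ≤
        T ^ (4 * m) * (K * (1 + T)) * critSq f t -
          (Ioi (2 * T)).indicator (fun t => (2 * T) ^ (4 * m) * critSq f t) t := by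
      intro t
      have hc := critSq_nonneg f t
      have hev : t ^ (4 * m) = |t| ^ (4 * m) := by
        rw [Even.pow_abs ((even_iff_two_dvd.2 ⟨2 * m, by ring⟩))]
      have hA : 0 ≤ T ^ (4 * m) * (K * (1 + T)) * critSq f t := by positivity
      rcases lt_or_ge |t| T with ht | ht
      · rw [indicator_of_notMem (fun h => by
          have : 2 * T < t := h
          linarith [le_abs_self t]), sub_zero, hev]
        have h1 : weilWeight N t ≤ K * (1 + T) := (le_abs_self _).trans ((hK t).trans (by gcongr))
        calc critSq f t * (|t| ^ (4 * m) * weilWeight N t)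
            ≤ critSq f t * (|t| ^ (4 * m) * (K * (1 + T))) := by gcongr
          _ ≤ critSq f t * (T ^ (4 * m) * (K * (1 + T))) := by gcongr
          _ = _ := by ring
      · have h1 : weilWeight N t ≤ -1 := hT₀ t ((le_max_left _ _).trans ht)
        have h2 : critSq f t * (t ^ (4 * m) * weilWeight N t) ≤ -(|t| ^ (4 * m) * critSq f t) := by
          rw [hev]
          have : 0 ≤ critSq f t * |t| ^ (4 * m) := by positivity
          nlinarith
        by_cases h3 : t ∈ Ioi (2 * T)
        · rw [indicator_of_mem h3]
          have h4 : (2 * T) ^ (4 * m) ≤ |t| ^ (4 * m) := by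
            have : 2 * T < t := h3
            gcongr
            exact this.le.trans (le_abs_self t)
          have := mul_le_mul_of_nonneg_right h4 hc
          linarith
        · rw [indicator_of_notMem h3]
          have : 0 ≤ |t| ^ (4 * m) * critSq f t := by positivity
          linarith
    have hI1 : Integrable fun t => T ^ (4 * m) * (K * (1 + T)) * critSq f t :=
      hf.integrable_critSq.const_mul _
    have hI2 : Integrable ((Ioi (2 * T)).indicator (fun t => (2 * T) ^ (4 * m) * critSq f t)) :=
      (hf.integrable_critSq.const_mul _).indicator measurableSet_Ioi
    have h5 := integral_mono (hint _) (hI1.sub hI2) hpt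
    rw [hmom, integral_sub' hI1 hI2, integral_const_mul, integral_indicator measurableSet_Ioi,
      integral_const_mul, mul_pow, show (2 : ℝ) ^ (4 * m) = 16 ^ m by rw [pow_mul]; norm_num] at h5
    have hTp : 0 < T ^ (4 * m) := by positivity
    have h6 : T ^ (4 * m) * (16 ^ m * B) ≤ T ^ (4 * m) * A := by
      simp only [A, B]; linarith
    exact le_of_mul_le_mul_left h6 hTp
  have hlim : Tendsto (fun m : ℕ => (16 : ℝ) ^ m * B) atTop atTop :=
    (tendsto_pow_atTop_atTop_of_one_lt (by norm_num)).atTop_mul_const hB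
  obtain ⟨m, hm⟩ := (hlim.eventually_gt_atTop A).exists
  exact absurd (hbound m) (not_le.2 hm)

/-! ### Nonpositivity of the Weil sums implies the Riemann hypothesis -/

/-- The completed zeta function is invariant under s ↦ 1 - s, so a nontrivial zero to the left of
the critical line reflects to one on the right. -/
lemma riemannHypothesis_of_ne_zero
    (h : ∀ s : ℂ, 1 / 2 < s.re → s ≠ 1 → riemannZeta s ≠ 0) : RiemannHypothesis := by
  intro s hs htriv hs1
  rcases lt_trichotomy s.re (1 / 2) with hlt | heq | hgt
  · exfalso
    have hs0 : s ≠ 0 := by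
      rintro rfl
      rw [riemannZeta_zero] at hs
      norm_num at hs
    have hG : Complex.Gammaℝ s ≠ 0 := by
      rw [Ne, Complex.Gammaℝ_eq_zero_iff]
      rintro ⟨n, hn⟩
      -- `Gammaℝ` has the default value 0 at its poles -2n: n = 0 is the excluded point s = 0, and
      -- the others are the trivial zeros.
      rcases n with _ | n
      · simp at hn; exact hs0 hn
      · exact htriv ⟨n, by rw [hn]; push_cast; ring⟩
    rw [riemannZeta_def_of_ne_zero hs0, div_eq_zero_iff, or_iff_left hG] at hs
    refine h (1 - s) (by rw [Complex.sub_re, Complex.one_re]; linarith) (by simpa using hs0) ?_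
    rw [riemannZeta_def_of_ne_zero (sub_ne_zero.2 (Ne.symm hs1)), completedRiemannZeta_one_sub, hs,
      zero_div]
  · exact heq
  · exact absurd hs (h s hgt hs1)

/-- The dilation `y ↦ x^{-1/2} f(y / x)`. -/
def dilate (x : ℝ) (f : ℝ → ℂ) (y : ℝ) : ℂ := ((x ^ (-(1 / 2 : ℝ)) : ℝ) : ℂ) * f (x⁻¹ * y)

lemma SuppIn.dilate {a b x : ℝ} {f : ℝ → ℂ} (h : SuppIn a b f) (hx : 0 < x) :
    SuppIn (x * a) (x * b) (dilate x f) := by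
  intro y hy
  have : f (x⁻¹ * y) = 0 := by
    refine h _ fun hy' => hy ?_
    have e : y = x * (x⁻¹ * y) := by field_simp
    rw [e]
    exact ⟨mul_le_mul_of_nonneg_left hy'.1 hx.le, mul_le_mul_of_nonneg_left hy'.2 hx.le⟩
  simp [BohrWeil.dilate, this]

lemma IsTest.dilate {x : ℝ} {f : ℝ → ℂ} (hf : IsTest f) (hx : 0 < x) : IsTest (dilate x f) := by
  obtain ⟨a, b, ha, -, h⟩ := hf.exists_suppIn
  refine .of_suppIn (mul_pos hx ha) ?_ (h.dilate hx)
  exact contDiff_const.mul (hf.smooth.comp (contDiff_const.mul contDiff_id))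

/-- With the normalisation x^{-1/2} the dilation acts on the critical line by the unimodular factor
x^{it}; it also preserves the zeros of M(f), in particular those at 0 and 1. -/
lemma mellin_dilate {x : ℝ} (hx : 0 < x) (f : ℝ → ℂ) (s : ℂ) :
    mellin (dilate x f) s = Complex.exp (Real.log x * (s - 1 / 2)) * mellin f s := by
  have h1 : mellin (fun y => f (x⁻¹ * y)) s = Complex.exp (Real.log x * s) * mellin f s := by
    have hx' : ((x⁻¹ : ℝ) : ℂ) ≠ 0 := by exact_mod_cast (inv_pos.2 hx).ne'
    rw [mellin_comp_mul_left _ _ (inv_pos.2 hx), smul_eq_mul, Complex.cpow_def_of_ne_zero hx',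
      ← Complex.ofReal_log (inv_pos.2 hx).le, Real.log_inv]
    congr 2; push_cast; ring
  unfold dilate
  rw [mellin_const_mul, h1, Real.rpow_def_of_pos hx, ← mul_assoc, Complex.ofReal_exp,
    ← Complex.exp_add]
  congr 2; push_cast; ring

/-! ### The square root bound for weighted sums over primes -/

section Bound

variable {f : ℝ → ℂ} {a b : ℝ}

lemma critSq_add_dilate (hf : IsTest f) {x : ℝ} (hx : 0 < x) {w : ℂ} (hw : ‖w‖ = 1) (t : ℝ) :
    critSq (fun y => f y + w * dilate x f y) t =
      critSq f t * (2 + 2 * (w * Complex.exp (t * Real.log x * Complex.I)).re) := by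
  have hm : critMellin (fun y => f y + w * dilate x f y) t =
      (1 + w * Complex.exp (t * Real.log x * Complex.I)) * critMellin f t := by
    rw [critMellin, hf.mellin_add ((hf.dilate hx).const_mul w), mellin_const_mul,
      mellin_dilate hx, critMellin,
      show (Real.log x : ℂ) * (1 / 2 + t * Complex.I - 1 / 2) = t * Real.log x * Complex.I by ring]
    ring
  have hn : ‖w * Complex.exp (t * Real.log x * Complex.I)‖ = 1 := by
    rw [norm_mul, hw, one_mul, ← Complex.ofReal_mul, Complex.norm_exp_ofReal_mul_I]
  have h2 : ‖1 + w * Complex.exp (t * Real.log x * Complex.I)‖ ^ 2 =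
      2 + 2 * (w * Complex.exp (t * Real.log x * Complex.I)).re := by
    set z := w * Complex.exp (t * Real.log x * Complex.I)
    have h3 : z.re ^ 2 + z.im ^ 2 = 1 := by
      have := Complex.sq_norm z
      rw [hn, Complex.normSq_apply] at this
      linarith
    rw [Complex.sq_norm, Complex.normSq_apply]
    simp only [Complex.add_re, Complex.one_re, Complex.add_im, Complex.one_im]
    linarith
  rw [critSq, hm, norm_mul, mul_pow, h2, critSq, mul_comm]

/-- Cauchy–Schwarz for a semidefinite form: f and its dilate have the same Weil sum, and the
hypothesis applied to f + w · (dilate), for all w of modulus one, bounds the cross term. The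
truncation N must exceed xb/a because this combination is supported in [a, xb]. -/
lemma norm_weil_dilate_le
    (H : ∀ f, IsTest f → mellin f 0 = 0 → mellin f 1 = 0 → (weilSum (autoConv f)).re ≤ 0)
    (hf : IsTest f) (hf0 : mellin f 0 = 0) (hf1 : mellin f 1 = 0) (ha : 0 < a) (hab : a ≤ b)
    (hs : SuppIn a b f) {x : ℝ} (hx : 1 ≤ x) {N : ℕ} (hN : x * b / a < N) :
    ‖((1 / (2 * Real.pi) : ℝ) : ℂ) * ∫ t, (critSq f t : ℂ) *
      (Complex.exp (t * Real.log x * Complex.I) * weilWeight N t)‖ ≤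
      -(weilSum (autoConv f)).re := by
  have hx0 : 0 < x := one_pos.trans_le hx
  have hb : 0 < b := ha.trans_le hab
  have hN' : b / a < N := lt_of_le_of_lt (by gcongr; nlinarith) hN
  set P : ℂ := ((1 / (2 * Real.pi) : ℝ) : ℂ) * ∫ t, (critSq f t : ℂ) *
      (Complex.exp (t * Real.log x * Complex.I) * weilWeight N t) with hP
  obtain ⟨K, hK0, hK⟩ := exists_abs_weilWeight_le N
  have hint : Integrable fun t => (critSq f t : ℂ) *
      (Complex.exp (t * Real.log x * Complex.I) * weilWeight N t) := by
    have := hf.integrable_critSq_mul (S := fun t : ℝ =>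
      Complex.exp (t * Real.log x * Complex.I) * (weilWeight N t : ℂ)) (K := K) (n := 1)
      (((by fun_prop : Continuous fun t : ℝ => Complex.exp (t * Real.log x * Complex.I)).mul
        (Complex.continuous_ofReal.comp (continuous_weilWeight N))).aestronglyMeasurable)
      (fun t => by
        rw [norm_mul, ← Complex.ofReal_mul, Complex.norm_exp_ofReal_mul_I, one_mul,
          Complex.norm_real, pow_one]
        exact hK t)
    simpa only [Complex.real_smul] using this
  have key : ∀ w : ℂ, ‖w‖ = 1 → (w * P).re ≤ -(weilSum (autoConv f)).re := by
    intro w hw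
    have hd := (hf.dilate hx0).const_mul w
    have hmel : ∀ s, mellin f s = 0 → mellin (fun y => f y + w * dilate x f y) s = 0 := by
      intro s h0
      rw [hf.mellin_add hd, mellin_const_mul, mellin_dilate hx0, h0]; simp
    have hsupp : SuppIn a (x * b) (fun y => f y + w * dilate x f y) :=
      (hs.mono le_rfl (by nlinarith)).add
        (((hs.dilate hx0).mono (by nlinarith) le_rfl).const_mul w)
    have h1 := H _ (hf.add hd) (hmel 0 hf0) (hmel 1 hf1)
    rw [weilSum_eq (hf.add hd) ha (by nlinarith) hsupp hN, Complex.ofReal_re] at h1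
    have e1 : ∫ t, critSq (fun y => f y + w * dilate x f y) t * weilWeight N t =
        2 * ∫ t, critSq f t * weilWeight N t + (2 * w * ((critSq f t : ℂ) *
          (Complex.exp (t * Real.log x * Complex.I) * weilWeight N t))).re / 2 := by
      rw [← integral_const_mul]
      congr 1; ext t
      rw [critSq_add_dilate hf hx0 hw]
      have e : (2 * w * ((critSq f t : ℂ) *
          (Complex.exp (t * Real.log x * Complex.I) * weilWeight N t))) =
          ((2 * critSq f t * weilWeight N t : ℝ) : ℂ) *
            (w * Complex.exp (t * Real.log x * Complex.I)) := by
        push_cast; ring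
      rw [e, Complex.re_ofReal_mul]
      ring
    have i2 : Integrable fun t => (2 * w * ((critSq f t : ℂ) *
          (Complex.exp (t * Real.log x * Complex.I) * weilWeight N t))).re :=
      (hint.const_mul (2 * w)).re
    have e2 : ∫ t, (2 * w * ((critSq f t : ℂ) *
          (Complex.exp (t * Real.log x * Complex.I) * weilWeight N t))).re =
        (2 * w * ∫ t, ((critSq f t : ℂ) *
          (Complex.exp (t * Real.log x * Complex.I) * weilWeight N t))).re := by
      rw [← integral_const_mul]
      exact integral_re (hint.const_mul (2 * w))
    rw [e1, integral_add (hf.integrable_critSq_weilWeight N) (i2.div_const 2), integral_div, e2]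
      at h1
    rw [weilSum_eq hf ha hab hs hN', Complex.ofReal_re]
    have e3 : (w * P).re = 1 / (2 * Real.pi) * ((2 * w * ∫ t, ((critSq f t : ℂ) *
          (Complex.exp (t * Real.log x * Complex.I) * weilWeight N t))).re / 2) := by
      rw [hP, mul_left_comm, Complex.re_ofReal_mul, mul_assoc 2 w]
      have : ∀ z : ℂ, (2 * z).re = 2 * z.re := fun z => by simp
      rw [this]; ring
    rw [e3]
    linarith
  rcases eq_or_ne P 0 with h0 | h0
  · rw [h0, norm_zero]
    have := H f hf hf0 hf1
    linarith
  · have hn : ‖P‖ ≠ 0 := norm_ne_zero_iff.2 h0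
    -- This w rotates the cross term onto the positive real axis.
    have h1 := key ((starRingEnd ℂ) P / ‖P‖) (by
      rw [norm_div, Complex.norm_real, norm_norm, RCLike.norm_conj, div_self hn])
    rw [div_mul_eq_mul_div, mul_comm ((starRingEnd ℂ) P), Complex.mul_conj, Complex.normSq_eq_norm_sq,
      ← Complex.ofReal_div, Complex.ofReal_re, sq, mul_div_cancel_right₀ _ hn] at h1
    exact h1

/-- The sum `∑ Λ(n) g(n / x)`. -/
def mangoldtSum (g : ℝ → ℂ) (x : ℝ) : ℂ :=
  ∑' n : ℕ, (ArithmeticFunction.vonMangoldt n : ℂ) * g (n / x)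

lemma SuppIn.mangoldtSum_eq {g : ℝ → ℂ} (hg : SuppIn a b g) {x : ℝ} (hx : 0 < x) {N : ℕ}
    (hN : x * b < N) : mangoldtSum g x =
      ∑ n ∈ Finset.range N, (ArithmeticFunction.vonMangoldt n : ℂ) * g (n / x) := by
  refine tsum_eq_sum fun n hn => ?_
  rw [hg, mul_zero]
  intro h
  have h1 : (N : ℝ) ≤ n := by exact_mod_cast not_lt.1 fun h' => hn (Finset.mem_range.2 h')
  have h2 := (div_le_iff₀ hx).1 h.2
  linarith

lemma SuppIn.continuousOn_mangoldtSum {g : ℝ → ℂ} (hg : SuppIn a b g) (hgc : Continuous g) :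
    ContinuousOn (mangoldtSum g) (Ioi 0) := by
  intro x hx
  have hx0 : 0 < x := hx
  refine ContinuousAt.continuousWithinAt ?_
  obtain ⟨N, hN⟩ := exists_nat_gt (x * b)
  have h1 : ∀ᶠ y in 𝓝 x, 0 < y ∧ y * b < N :=
    (lt_mem_nhds hx0).and (((continuous_mul_const b).tendsto x).eventually (gt_mem_nhds hN))
  have h2 : (fun y => ∑ n ∈ Finset.range N, (ArithmeticFunction.vonMangoldt n : ℂ) * g (n / y))
      =ᶠ[𝓝 x] mangoldtSum g := by
    filter_upwards [h1] with y hy using (hg.mangoldtSum_eq hy.1 hy.2).symm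
  refine ContinuousAt.congr ?_ h2
  refine tendsto_finsetSum _ fun n _ => ?_
  refine tendsto_const_nhds.mul ((hgc.tendsto _).comp ?_)
  exact (continuousAt_const.div continuousAt_id hx0.ne')

lemma SuppIn.mangoldtSum_eq_zero {g : ℝ → ℂ} (hg : SuppIn a b g) {x : ℝ} (hx : 0 < x)
    (hxb : x * b < 1) : mangoldtSum g x = 0 := by
  rw [hg.mangoldtSum_eq hx (N := 1) (by exact_mod_cast hxb)]
  simp

/-- Nonpositivity of the Weil sums implies a square root bound for sums over primes. -/
lemma norm_mangoldtSum_le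
    (H : ∀ f, IsTest f → mellin f 0 = 0 → mellin f 1 = 0 → (weilSum (autoConv f)).re ≤ 0)
    (hf : IsTest f) (hf0 : mellin f 0 = 0) (hf1 : mellin f 1 = 0) :
    ∃ C x₀ : ℝ, ∀ x, x₀ ≤ x → ‖mangoldtSum (autoConv f) x‖ ≤ C * x ^ (1 / 2 : ℝ) := by
  obtain ⟨a, b, ha, hab, hs⟩ := hf.exists_suppIn
  have hb : 0 < b := ha.trans_le hab
  set C₁ := 1 / (2 * Real.pi) * ∫ t, critSq f t * |archWeight t|
  refine ⟨-(weilSum (autoConv f)).re + C₁, b / a + 1, fun x hx => ?_⟩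
  have hba : 1 ≤ b / a := (one_le_div ha).2 hab
  have hx1 : 1 ≤ x := by linarith
  have hx0 : 0 < x := by linarith
  obtain ⟨N, hN⟩ := exists_nat_gt (x * b / a)
  have hP := norm_weil_dilate_le H hf hf0 hf1 ha hab hs hx1 hN
  obtain ⟨K, hK0, hK⟩ := exists_abs_archWeight_le
  have hexpc : Continuous fun t : ℝ => Complex.exp (t * Real.log x * Complex.I) := by fun_prop
  have hexpn : ∀ t : ℝ, ‖Complex.exp (t * Real.log x * Complex.I)‖ = 1 := fun t => by
    rw [← Complex.ofReal_mul, Complex.norm_exp_ofReal_mul_I]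
  have iA : Integrable fun t => (critSq f t : ℂ) *
      (Complex.exp (t * Real.log x * Complex.I) * archWeight t) := by
    have := hf.integrable_critSq_mul (S := fun t : ℝ =>
      Complex.exp (t * Real.log x * Complex.I) * (archWeight t : ℂ)) (K := K) (n := 1)
      ((hexpc.mul (Complex.continuous_ofReal.comp continuous_archWeight)).aestronglyMeasurable)
      (fun t => by rw [norm_mul, hexpn, one_mul, Complex.norm_real, pow_one]; exact hK t)
    simpa only [Complex.real_smul] using this
  -- The archimedean part of the cross term is bounded independently of x, so it may be moved to the
  -- other side.
  have hA : ‖((1 / (2 * Real.pi) : ℝ) : ℂ) * ∫ t, (critSq f t : ℂ) *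
      (Complex.exp (t * Real.log x * Complex.I) * archWeight t)‖ ≤ C₁ := by
    rw [norm_mul, Complex.norm_real, Real.norm_of_nonneg (by positivity)]
    refine mul_le_mul_of_nonneg_left ?_ (by positivity)
    refine (norm_integral_le_integral_norm _).trans (le_of_eq ?_)
    congr 1; ext t
    rw [norm_mul, norm_mul, hexpn, one_mul, Complex.norm_real, Complex.norm_real,
      Real.norm_of_nonneg (critSq_nonneg _ _), Real.norm_eq_abs]
  have hterm : ∀ n : ℕ, ((x ^ (-(1 / 2 : ℝ)) : ℝ) : ℂ) *
      ((ArithmeticFunction.vonMangoldt n : ℂ) * autoConv f (n / x)) =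
      ((1 / (2 * Real.pi) : ℝ) : ℂ) * ∫ t, (critSq f t : ℂ) *
        (Complex.exp (t * Real.log x * Complex.I) * ((ArithmeticFunction.vonMangoldt n *
          (n : ℝ) ^ (-(1 / 2 : ℝ)) * (2 * Real.cos (t * Real.log n)) : ℝ) : ℂ)) := by
    intro n
    rcases Nat.eq_zero_or_pos n with rfl | hn
    · simp
    have hn0 : (0 : ℝ) < n := by exact_mod_cast hn
    -- The product x^{it} · 2cos(t log n) has two frequencies. This one lies outside the support of
    -- the Fourier transform because x > b/a; the other one gives g(n/x).
    have e1 : critFourier f (-(Real.log x) - Real.log n) = 0 := by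
      refine hf.critFourier_eq_zero ha hab hs ?_
      rw [← neg_add', abs_neg, abs_of_nonneg (add_nonneg (Real.log_nonneg hx1)
        (Real.log_natCast_nonneg n))]
      have := Real.log_lt_log (by positivity) (show b / a < x by linarith)
      linarith [Real.log_natCast_nonneg n]
    have e2 : autoConv f (n / x) = (((n : ℝ) ^ (-(1 / 2 : ℝ)) * x ^ (1 / 2 : ℝ) : ℝ) : ℂ) *
        critFourier f (Real.log n - Real.log x) := by
      rw [hf.autoConv_eq (div_pos hn0 hx0), Real.log_div hn0.ne' hx0.ne',
        Real.div_rpow hn0.le hx0.le, div_eq_mul_inv, ← Real.rpow_neg hx0.le, neg_neg]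
    have e3 : x ^ (-(1 / 2 : ℝ)) * x ^ (1 / 2 : ℝ) = 1 := by
      rw [← Real.rpow_add hx0]; simp
    have e4 : ((1 / (2 * Real.pi) : ℝ) : ℂ) * ∫ t, (critSq f t : ℂ) *
        (Complex.exp (t * Real.log x * Complex.I) * ((ArithmeticFunction.vonMangoldt n *
          (n : ℝ) ^ (-(1 / 2 : ℝ)) * (2 * Real.cos (t * Real.log n)) : ℝ) : ℂ)) =
        ((ArithmeticFunction.vonMangoldt n * (n : ℝ) ^ (-(1 / 2 : ℝ)) : ℝ) : ℂ) *
          (critFourier f (Real.log n - Real.log x) +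
            critFourier f (-(Real.log x) - Real.log n)) := by
      rw [critFourier, critFourier, ← mul_add, ← integral_add (hf.integrable_critSq_exp _)
        (hf.integrable_critSq_exp _), mul_left_comm, ← integral_const_mul
          ((ArithmeticFunction.vonMangoldt n * (n : ℝ) ^ (-(1 / 2 : ℝ)) : ℝ) : ℂ)]
      congr 2; ext t
      have hc := exp_add_exp_eq_cos (t * Real.log n)
      have h5 : Complex.exp (-((t * (Real.log n - Real.log x) : ℝ) : ℂ) * Complex.I) =
          Complex.exp (t * Real.log x * Complex.I) *
            Complex.exp (-((t * Real.log n : ℝ) : ℂ) * Complex.I) := by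
        rw [← Complex.exp_add]; congr 1; push_cast; ring
      have h6 : Complex.exp (-((t * (-(Real.log x) - Real.log n) : ℝ) : ℂ) * Complex.I) =
          Complex.exp (t * Real.log x * Complex.I) *
            Complex.exp (((t * Real.log n : ℝ) : ℂ) * Complex.I) := by
        rw [← Complex.exp_add]; congr 1; push_cast; ring
      rw [h5, h6, Complex.ofReal_mul _ (2 * _), ← hc]
      ring
    rw [e4, e1, add_zero, e2]
    have e3' : ((x ^ (-(1 / 2 : ℝ)) : ℝ) : ℂ) * ((x ^ (1 / 2 : ℝ) : ℝ) : ℂ) = 1 := by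
      exact_mod_cast e3
    push_cast at e3' ⊢
    linear_combination (((n : ℝ) ^ (-(1 / 2 : ℝ)) : ℝ) : ℂ) *
      (ArithmeticFunction.vonMangoldt n : ℂ) * critFourier f (Real.log n - Real.log x) * e3'
  have iT : ∀ n : ℕ, Integrable fun t => (critSq f t : ℂ) *
        (Complex.exp (t * Real.log x * Complex.I) * ((ArithmeticFunction.vonMangoldt n *
          (n : ℝ) ^ (-(1 / 2 : ℝ)) * (2 * Real.cos (t * Real.log n)) : ℝ) : ℂ)) := by
    intro n
    have h1 := (hf.integrable_critSq_cos n).ofReal (𝕜 := ℂ)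
    have h2 := h1.mul_bdd (c := 1) (g := fun t : ℝ => Complex.exp (t * Real.log x * Complex.I))
      hexpc.aestronglyMeasurable (ae_of_all _ fun t => (hexpn t).le)
    refine h2.congr (ae_of_all _ fun t => ?_)
    simp only [Complex.coe_algebraMap]
    push_cast; ring
  have hsum : ((x ^ (-(1 / 2 : ℝ)) : ℝ) : ℂ) * mangoldtSum (autoConv f) x =
      ((1 / (2 * Real.pi) : ℝ) : ℂ) * (∫ t, (critSq f t : ℂ) *
        (Complex.exp (t * Real.log x * Complex.I) * weilWeight N t)) -
      ((1 / (2 * Real.pi) : ℝ) : ℂ) * ∫ t, (critSq f t : ℂ) *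
        (Complex.exp (t * Real.log x * Complex.I) * archWeight t) := by
    rw [(hs.autoConv ha hab).mangoldtSum_eq hx0 (N := N) (by rwa [← mul_div_assoc]),
      Finset.mul_sum, Finset.sum_congr rfl fun n _ => hterm n, ← Finset.mul_sum,
      ← integral_finsetSum _ fun n _ => iT n, eq_sub_iff_add_eq, ← mul_add,
      ← integral_add (integrable_finsetSum _ fun n _ => iT n) iA]
    congr 2; ext t
    rw [weilWeight]
    push_cast
    rw [mul_add, mul_add, Finset.mul_sum, Finset.mul_sum, add_comm]
  have hxr : 0 < x ^ (1 / 2 : ℝ) := Real.rpow_pos_of_pos hx0 _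
  have hn := congrArg norm hsum
  rw [norm_mul, Complex.norm_real, Real.norm_of_nonneg (by positivity), Real.rpow_neg hx0.le] at hn
  have h7 : (x ^ (1 / 2 : ℝ))⁻¹ * ‖mangoldtSum (autoConv f) x‖ ≤
      -(weilSum (autoConv f)).re + C₁ := by
    rw [hn]; exact (norm_sub_le _ _).trans (add_le_add hP hA)
  rwa [inv_mul_le_iff₀ hxr, mul_comm] at h7

end Bound

/-! ### The Mellin transform of the sums over primes -/

section MangoldtMellin

variable {g : ℝ → ℂ} {a b : ℝ}

lemma mellin_comp_natCast_div (g : ℝ → ℂ) {n : ℕ} (hn : n ≠ 0) (s : ℂ) :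
    mellin (fun x => g (n / x)) (-s) = (n : ℂ) ^ (-s) * mellin g s := by
  have h1 := mellin_comp_inv (fun t => g (n * t)) s
  have h2 : (fun t : ℝ => (fun t => g (n * t)) t⁻¹) = fun x => g (n / x) := by
    ext x; simp only [div_eq_mul_inv]
  rw [h2] at h1
  have h3 := mellin_comp_inv (fun t => g (n * t)) (-s)
  rw [h2, neg_neg, mellin_comp_mul_left _ _ (by positivity : (0 : ℝ) < n), smul_eq_mul] at h3
  simpa using h3

lemma SuppIn.comp_natCast_div (hg : SuppIn a b g) (ha : 0 < a) {n : ℕ} (hn : n ≠ 0) :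
    ∀ x ∈ Ioi (0 : ℝ), x ∉ Icc (n / b) (n / a) → g (n / x) = 0 := by
  intro x hx hx'
  have hx0 : 0 < x := hx
  have hn0 : (0 : ℝ) < n := by positivity
  refine hg _ fun h => hx' ?_
  have hb : 0 < b := ha.trans_le (h.1.trans h.2)
  exact ⟨(div_le_comm₀ hx0 hb).1 h.2, (le_div_comm₀ ha hx0).1 h.1⟩

lemma SuppIn.integrableOn_comp_natCast_div (hg : SuppIn a b g) (ha : 0 < a) (hgc : Continuous g)
    {n : ℕ} (hn : n ≠ 0) (s : ℂ) :
    MellinConvergent (fun x => g (n / x)) s := by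
  rcases le_or_gt b 0 with hb | hb
  · have h0 : ∀ x, g x = 0 := fun x => hg x fun h => by linarith [h.1, h.2]
    simp [h0, MellinConvergent]
  have hn0 : (0 : ℝ) < n := by positivity
  refine IntegrableOn.of_forall_sdiff_eq_zero (s := Icc (n / b) (n / a)) ?_ measurableSet_Ioi ?_
  · refine ContinuousOn.integrableOn_compact isCompact_Icc fun x hx => ?_
    have hx0 : 0 < x := (div_pos hn0 hb).trans_le hx.1
    refine ContinuousAt.continuousWithinAt ?_
    show ContinuousAt (fun x : ℝ => (x : ℂ) ^ (s - 1) • g (n / x)) x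
    have h1 : ContinuousAt (fun x : ℝ => g (n / x)) x :=
      hgc.continuousAt.comp (continuousAt_const.div continuousAt_id hx0.ne')
    exact (Complex.continuousAt_ofReal_cpow_const x (s - 1) (Or.inr hx0.ne')).smul h1
  · intro x hx
    simp only [hg.comp_natCast_div ha hn x hx.1 hx.2, smul_zero]

/-- Each term g(n/x) contributes n^{-s} M(g)(s), so summation produces the Dirichlet series of Λ. -/
lemma SuppIn.mellin_mangoldtSum (hg : SuppIn a b g) (ha : 0 < a) (hgc : Continuous g) {s : ℂ}
    (hs : 1 < s.re) : mellin (mangoldtSum g) (-s) =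
      LSeries (fun n => (ArithmeticFunction.vonMangoldt n : ℂ)) s * mellin g s := by
  set F : ℕ → ℝ → ℂ := fun n x => (x : ℂ) ^ (-s - 1) •
    ((ArithmeticFunction.vonMangoldt n : ℂ) * g (n / x)) with hF
  have hF' : ∀ n x, F n x = (ArithmeticFunction.vonMangoldt n : ℂ) *
      ((x : ℂ) ^ (-s - 1) • g (n / x)) := fun n x => by simp only [hF, smul_eq_mul]; ring
  have hFi : ∀ n, IntegrableOn (F n) (Ioi 0) := by
    intro n
    rcases eq_or_ne n 0 with rfl | hn
    · simp [hF]
    · exact ((hg.integrableOn_comp_natCast_div ha hgc hn (-s)).const_mul _).congr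
        (ae_of_all _ fun x => (hF' n x).symm)
  have hFv : ∀ n, ∫ x in Ioi 0, F n x =
      LSeries.term (fun n => (ArithmeticFunction.vonMangoldt n : ℂ)) s n * mellin g s := by
    intro n
    rcases eq_or_ne n 0 with rfl | hn
    · simp [hF]
    · rw [LSeries.term_of_ne_zero hn, setIntegral_congr_fun measurableSet_Ioi
        fun x _ => hF' n x, integral_const_mul]
      have := mellin_comp_natCast_div g hn s
      rw [mellin] at this
      rw [this, Complex.cpow_neg]
      ring
  -- The norms follow the same computation with ‖g‖ in place of g and Re s in place of s, which
  -- reduces their summability to that of the Dirichlet series at Re s > 1.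
  have hFn : ∀ n, ((∫ x in Ioi 0, ‖F n x‖ : ℝ) : ℂ) =
      LSeries.term (fun n => (ArithmeticFunction.vonMangoldt n : ℂ)) s.re n *
        mellin (fun x => (‖g x‖ : ℂ)) s.re := by
    intro n
    rcases eq_or_ne n 0 with rfl | hn
    · simp [hF]
    · rw [LSeries.term_of_ne_zero hn, ← integral_complex_ofReal]
      have h1 : ∀ x ∈ Ioi (0 : ℝ), ((‖F n x‖ : ℝ) : ℂ) = (ArithmeticFunction.vonMangoldt n : ℂ) *
          ((x : ℂ) ^ (-(s.re : ℂ) - 1) • ((‖g (n / x)‖ : ℝ) : ℂ)) := by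
        intro x hx
        rw [hF', norm_mul, norm_smul, Complex.norm_cpow_eq_rpow_re_of_pos hx, Complex.norm_real,
          Real.norm_of_nonneg ArithmeticFunction.vonMangoldt_nonneg]
        have h2 : (x : ℂ) ^ (-(s.re : ℂ) - 1) = ((x ^ (-s.re - 1) : ℝ) : ℂ) := by
          rw [Complex.ofReal_cpow (le_of_lt hx)]; push_cast; rfl
        rw [h2]
        simp only [Complex.sub_re, Complex.neg_re, Complex.one_re, smul_eq_mul]
        push_cast; rfl
      rw [setIntegral_congr_fun measurableSet_Ioi h1, integral_const_mul]
      have := mellin_comp_natCast_div (fun x => (‖g x‖ : ℂ)) hn s.re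
      rw [mellin] at this
      rw [this, Complex.cpow_neg]
      ring
  have hsum : Summable fun n => ∫ x in Ioi 0, ‖F n x‖ := by
    have h1 : LSeriesSummable (fun n => (ArithmeticFunction.vonMangoldt n : ℂ)) (s.re : ℂ) :=
      ArithmeticFunction.LSeriesSummable_vonMangoldt (by simpa using hs)
    have h2 : Summable fun n => ((∫ x in Ioi 0, ‖F n x‖ : ℝ) : ℂ) :=
      (h1.mul_right _).congr fun n => (hFn n).symm
    exact Complex.summable_ofReal.1 h2
  have h := hasSum_integral_of_summable_integral_norm hFi hsum
  have hR : (∫ x in Ioi 0, ∑' n, F n x) = mellin (mangoldtSum g) (-s) := by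
    rw [mellin]
    refine setIntegral_congr_fun measurableSet_Ioi fun x _ => ?_
    simp only [hF, mangoldtSum, smul_eq_mul, tsum_mul_left]
  rw [hR] at h
  have h3 : HasSum (fun n => ∫ x in Ioi 0, F n x)
      (LSeries (fun n => (ArithmeticFunction.vonMangoldt n : ℂ)) s * mellin g s) := by
    have h4 : LSeriesSummable (fun n => (ArithmeticFunction.vonMangoldt n : ℂ)) s :=
      ArithmeticFunction.LSeriesSummable_vonMangoldt hs
    exact (h4.hasSum.mul_right (mellin g s)).congr_fun fun n => hFv n
  exact h.unique h3

/-- The sum vanishes for x < 1/b and is O(x^c) at infinity, so its Mellin integral at -s converges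
for Re s > c. With c = 1/2 this continues -(ζ'/ζ) M(g) up to the critical line. -/
lemma SuppIn.differentiableAt_mellin_mangoldtSum (hg : SuppIn a b g) (hb : 0 < b)
    (hgc : Continuous g) {c : ℝ} {C x₀ : ℝ} (hC : ∀ x, x₀ ≤ x → ‖mangoldtSum g x‖ ≤ C * x ^ c)
    {s : ℂ} (hs : c < s.re) :
    DifferentiableAt ℂ (fun s => mellin (mangoldtSum g) (-s)) s := by
  have h : DifferentiableAt ℂ (mellin (mangoldtSum g)) (-s) := by
    refine mellin_differentiableAt_of_isBigO_rpow (a := -c) (b := -s.re - 1) ?_ ?_ (by simpa) ?_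
      (by simp)
    · exact (hg.continuousOn_mangoldtSum hgc).locallyIntegrableOn measurableSet_Ioi
    · rw [neg_neg]
      refine IsBigO.of_bound C ?_
      filter_upwards [eventually_ge_atTop x₀, eventually_gt_atTop 0] with x hx hx0
      rw [Real.norm_of_nonneg (Real.rpow_nonneg hx0.le _)]
      exact hC x hx
    · refine (Asymptotics.isBigO_zero _ _).congr' ?_ EventuallyEq.rfl
      filter_upwards [Ioo_mem_nhdsGT (inv_pos.2 hb)] with x hx
      refine (hg.mangoldtSum_eq_zero hx.1 ?_).symm
      rw [← lt_div_iff₀ hb, one_div]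
      exact hx.2
  exact h.comp s differentiableAt_id.neg

end MangoldtMellin

/-- Written with the entire function `riemannZeta₁`, which is (s - 1) ζ(s) away from 1, so that the
pole of ζ becomes an explicit term. -/
lemma logDeriv_riemannZeta_eq {s : ℂ} (hs : 1 < s.re) :
    LSeries (fun n => (ArithmeticFunction.vonMangoldt n : ℂ)) s =
      1 / (s - 1) - deriv riemannZeta₁ s / riemannZeta₁ s := by
  have hs1 : s ≠ 1 := by rintro rfl; simp at hs
  have h0 : s - 1 ≠ 0 := sub_ne_zero.2 hs1
  have hz : riemannZeta s ≠ 0 := riemannZeta_ne_zero_of_one_le_re hs.le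
  have hz1 : riemannZeta₁ s ≠ 0 := fun h => hz (by rw [riemannZeta_eq_inv_sub_mul hs1, h, mul_zero])
  rw [ArithmeticFunction.LSeries_vonMangoldt_eq_deriv_riemannZeta_div hs]
  have hE : riemannZeta =ᶠ[𝓝 s] fun z => (z - 1)⁻¹ * riemannZeta₁ z := by
    filter_upwards [isOpen_ne.mem_nhds hs1] with z hz using riemannZeta_eq_inv_sub_mul hz
  have hd : HasDerivAt (fun z => (z - 1)⁻¹ * riemannZeta₁ z)
      (-1 / (s - 1) ^ 2 * riemannZeta₁ s + (s - 1)⁻¹ * deriv riemannZeta₁ s) s :=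
    (((hasDerivAt_id s).sub_const 1).inv h0).mul (differentiable_riemannZeta₁ s).hasDerivAt
  rw [hE.deriv_eq, hd.deriv, riemannZeta_eq_inv_sub_mul hs1]
  field_simp
  ring

/-- A function analytic near a point with `F' = φ F`, vanishing there, vanishes identically. -/
lemma eventually_eq_zero_of_deriv_eq_mul {F φ : ℂ → ℂ} {z : ℂ} (hF : AnalyticAt ℂ F z)
    (hφ : AnalyticAt ℂ φ z) (h0 : F z = 0) (h : deriv F =ᶠ[𝓝 z] φ * F) : ∀ᶠ w in 𝓝 z, F w = 0 := by
  rw [← analyticOrderAt_eq_top]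
  by_contra htop
  -- At a zero of finite order, F' has order one less than F, whereas φ F has order at least that of
  -- F.
  have h1 := hF.analyticOrderAt_deriv_add_one
  simp only [h0, sub_zero] at h1
  rw [analyticOrderAt_congr h, analyticOrderAt_mul hφ hF] at h1
  obtain ⟨m, hm⟩ := ENat.ne_top_iff_exists.1 htop
  rw [← hm] at h1
  rcases eq_or_ne (analyticOrderAt φ z) ⊤ with h2 | h2
  · rw [h2] at h1; simp at h1
  · obtain ⟨k, hk⟩ := ENat.ne_top_iff_exists.1 h2
    rw [← hk] at h1
    have : k + m + 1 = m := by exact_mod_cast h1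
    omega

/-- A bump around 1, so narrow that |t log x| < 1 on its support: there x^{it} has positive real
part, hence so has the whole Mellin integral. -/
lemma exists_isTest_mellin_ne_zero (t : ℝ) :
    ∃ f, IsTest f ∧ ∀ s : ℂ, s.im = t → mellin f s ≠ 0 := by
  have hcont : ContinuousAt (fun x : ℝ => t * Real.log x) 1 :=
    continuousAt_const.mul (Real.continuousAt_log one_ne_zero)
  have hev : ∀ᶠ x in 𝓝 (1 : ℝ), |t * Real.log x| < 1 ∧ 0 < x := by
    refine (hcont.abs.eventually (gt_mem_nhds ?_)).and (lt_mem_nhds one_pos)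
    simp
  obtain ⟨ε, hε, hball⟩ := Metric.eventually_nhds_iff.1 hev
  let φ : ContDiffBump (1 : ℝ) := ⟨ε / 4, ε / 2, by positivity, by linarith⟩
  have hmem : ∀ x ∈ Icc (1 - ε / 2) (1 + ε / 2), |t * Real.log x| < 1 ∧ 0 < x := by
    intro x hx
    refine hball ?_
    rw [Real.dist_eq, abs_lt]
    constructor <;> linarith [hx.1, hx.2]
  have ha : 0 < 1 - ε / 2 := (hmem _ ⟨le_rfl, by linarith⟩).2
  have hsupp : SuppIn (1 - ε / 2) (1 + ε / 2) fun x => ((φ x : ℝ) : ℂ) := by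
    intro x hx
    have : φ x = 0 := by
      refine φ.zero_of_le_dist ?_
      rw [Real.dist_eq]
      by_contra hlt
      have := abs_lt.1 (not_le.1 hlt)
      simp only [φ] at this
      exact hx ⟨by linarith [this.1], by linarith [this.2]⟩
    simp [this]
  have hf : IsTest fun x => ((φ x : ℝ) : ℂ) :=
    .of_suppIn ha (Complex.ofRealCLM.contDiff.comp φ.contDiff) hsupp
  refine ⟨_, hf, fun s hs h0 => ?_⟩
  have hconv := hsupp.mellinConvergent ha hf.continuous s
  have hre : (mellin (fun x => ((φ x : ℝ) : ℂ)) s).re =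
      ∫ x in Ioi (0 : ℝ), ((x : ℂ) ^ (s - 1) • ((φ x : ℝ) : ℂ)).re := by
    rw [mellin]; exact (integral_re hconv).symm
  have hform : ∀ x : ℝ, 0 < x → ((x : ℂ) ^ (s - 1) • ((φ x : ℝ) : ℂ)).re =
      Real.exp ((s.re - 1) * Real.log x) * Real.cos (t * Real.log x) * φ x := by
    intro x hx
    have hx0 : (x : ℂ) ≠ 0 := by exact_mod_cast hx.ne'
    rw [smul_eq_mul, mul_comm, Complex.re_ofReal_mul, Complex.cpow_def_of_ne_zero hx0,
      ← Complex.ofReal_log hx.le, Complex.exp_re]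
    simp only [Complex.mul_re, Complex.mul_im, Complex.ofReal_re, Complex.ofReal_im,
      Complex.sub_re, Complex.sub_im, Complex.one_re, Complex.one_im, hs]
    ring_nf
  have hcos : ∀ x ∈ Icc (1 - ε / 2) (1 + ε / 2), 0 < Real.cos (t * Real.log x) := by
    intro x hx
    have h1 := abs_lt.1 (hmem x hx).1
    have := Real.pi_gt_three
    exact Real.cos_pos_of_mem_Ioo ⟨by linarith [h1.1], by linarith [h1.2]⟩
  have hpos : 0 < ∫ x in Ioi (0 : ℝ), ((x : ℂ) ^ (s - 1) • ((φ x : ℝ) : ℂ)).re := by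
    rw [setIntegral_pos_iff_support_of_nonneg_ae]
    · have hsub : Metric.ball (1 : ℝ) (ε / 4) ⊆
          Function.support (fun x : ℝ => ((x : ℂ) ^ (s - 1) • ((φ x : ℝ) : ℂ)).re) ∩ Ioi 0 := by
        intro x hx
        have hd := abs_lt.1 (by simpa [Real.dist_eq] using hx : |x - 1| < ε / 4)
        have hI : x ∈ Icc (1 - ε / 2) (1 + ε / 2) := ⟨by linarith [hd.1], by linarith [hd.2]⟩
        have hx0 := (hmem x hI).2
        refine ⟨?_, hx0⟩
        rw [Function.mem_support, hform x hx0, φ.one_of_mem_closedBall (Metric.ball_subset_closedBall hx),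
          mul_one]
        exact (mul_pos (Real.exp_pos _) (hcos x hI)).ne'
      exact (Metric.measure_ball_pos _ _ (by positivity)).trans_le (measure_mono hsub)
    · refine (ae_restrict_iff' measurableSet_Ioi).2 (ae_of_all _ fun x hx => ?_)
      simp only [Pi.zero_apply]
      rw [hform x hx]
      by_cases hI : x ∈ Icc (1 - ε / 2) (1 + ε / 2)
      · exact mul_nonneg (mul_pos (Real.exp_pos _) (hcos x hI)).le φ.nonneg
      · have : φ x = 0 := Complex.ofReal_eq_zero.1 (hsupp x hI)
        rw [this, mul_zero]
    · exact hconv.re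
  rw [← hre, h0] at hpos
  simp at hpos

/-- If the Weil sums of all test functions with `M(f)(0) = M(f)(1) = 0` are nonpositive, then the
Riemann hypothesis holds. -/
theorem riemannHypothesis_of_weilSum_nonpos
    (H : ∀ f, IsTest f → mellin f 0 = 0 → mellin f 1 = 0 → (weilSum (autoConv f)).re ≤ 0) :
    RiemannHypothesis := by
  refine riemannHypothesis_of_ne_zero fun ρ hρ hρ1 hzero => ?_
  obtain ⟨f₀, hf₀, hne⟩ := exists_isTest_mellin_ne_zero ρ.im
  -- This multiplies the Mellin transform by -s(1 - s), which imposes the zeros at 0 and 1 and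
  -- creates no others.
  set f := shiftD 0 (shiftD 1 f₀)
  have hf : IsTest f := (hf₀.shiftD 1).shiftD 0
  have hmel : ∀ s, mellin f s = (0 - s) * ((1 - s) * mellin f₀ s) := fun s => by
    rw [(hf₀.shiftD 1).mellin_shiftD, hf₀.mellin_shiftD]
  obtain ⟨C, x₀, hC⟩ := norm_mangoldtSum_le H hf (by simp [hmel]) (by simp [hmel])
  obtain ⟨a, b, ha, hab, hs⟩ := hf.exists_suppIn
  have hb : 0 < b := ha.trans_le hab
  have hg := hs.autoConv ha hab
  have hgc := hf.continuous_autoConv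
  have hab' : 0 < a / b := div_pos ha hb
  set G := mellin (autoConv f)
  have hGd : Differentiable ℂ G := hg.differentiable_mellin hab' hgc
  -- G(ρ) is the product of M(f)(ρ) and the conjugate of M(f)(1 - conj ρ). Both points have
  -- imaginary part Im ρ, which is why f₀ was chosen without zeros on that whole horizontal line.
  have hGρ : G ρ ≠ 0 := by
    have h0 : ρ ≠ 0 := by rintro rfl; norm_num at hρ
    have h1 : (1 : ℂ) - ρ ≠ 0 := sub_ne_zero.2 (Ne.symm hρ1)
    have key : ∀ s : ℂ, s ≠ 0 → 1 - s ≠ 0 → s.im = ρ.im → mellin f s ≠ 0 := by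
      intro s hs0 hs1 him
      rw [hmel, zero_sub]
      exact mul_ne_zero (neg_ne_zero.2 hs0) (mul_ne_zero hs1 (hne s him))
    show mellin (autoConv f) ρ ≠ 0
    rw [hf.mellin_autoConv]
    refine mul_ne_zero (key ρ h0 h1 rfl) ((map_ne_zero _).2 (key _ ?_ ?_ ?_))
    · intro h
      apply h1
      have := congrArg (starRingEnd ℂ) h
      simpa using this
    · rw [sub_sub_cancel]; exact (map_ne_zero _).2 h0
    · simp
  set E : ℂ → ℂ := fun s => mellin (mangoldtSum (autoConv f)) (-s)
  set U : Set ℂ := {s | 1 / 2 < s.re}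
  have hUo : IsOpen U := isOpen_lt continuous_const Complex.continuous_re
  have hUc : IsPreconnected U := (convex_halfSpace_re_gt (1 / 2)).isPreconnected
  have hEd : DifferentiableOn ℂ E U := fun s hs' =>
    (hg.differentiableAt_mellin_mangoldtSum (div_pos hb ha) hgc hC hs').differentiableWithinAt
  have hZd := differentiable_riemannZeta₁
  have hZ'd : Differentiable ℂ (deriv riemannZeta₁) := hZd.deriv
  have hA : AnalyticOnNhd ℂ (fun s => (s - 1) * riemannZeta₁ s * E s) U :=
    (((differentiable_id.sub_const 1).mul hZd).differentiableOn.mul hEd).analyticOnNhd hUo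
  have hB : AnalyticOnNhd ℂ
      (fun s => G s * (riemannZeta₁ s - (s - 1) * deriv riemannZeta₁ s)) U :=
    (hGd.mul (hZd.sub ((differentiable_id.sub_const 1).mul hZ'd))).differentiableOn.analyticOnNhd hUo
  have h2U : (2 : ℂ) ∈ U := by show (1 / 2 : ℝ) < (2 : ℂ).re; norm_num
  -- The relation E = -(ζ'/ζ) G, cleared of denominators, holds for Re s > 1 and hence, by the
  -- identity theorem, for Re s > 1/2.
  have heq := hA.eqOn_of_preconnected_of_eventuallyEq hB hUc h2U (by
    have : ∀ᶠ s : ℂ in 𝓝 2, 1 < s.re :=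
      (isOpen_lt continuous_const Complex.continuous_re).mem_nhds (by norm_num)
    filter_upwards [this] with s hs'
    have hs1 : s ≠ 1 := by rintro rfl; simp at hs'
    have hz : riemannZeta s ≠ 0 := riemannZeta_ne_zero_of_one_le_re hs'.le
    have hz1 : riemannZeta₁ s ≠ 0 :=
      fun h => hz (by rw [riemannZeta_eq_inv_sub_mul hs1, h, mul_zero])
    have h0 : s - 1 ≠ 0 := sub_ne_zero.2 hs1
    show (s - 1) * riemannZeta₁ s * mellin (mangoldtSum (autoConv f)) (-s) = _
    rw [hg.mellin_mangoldtSum hab' hgc hs', logDeriv_riemannZeta_eq hs']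
    show (s - 1) * riemannZeta₁ s * ((1 / (s - 1) - deriv riemannZeta₁ s / riemannZeta₁ s) * G s) = _
    field_simp)
  have hZρ : riemannZeta₁ ρ = 0 := by
    rw [riemannZeta_eq_inv_sub_mul hρ1] at hzero
    exact (mul_eq_zero.1 hzero).resolve_left (inv_ne_zero (sub_ne_zero.2 hρ1))
  -- Near ρ the relation reads ζ₁' = φ ζ₁ with φ analytic, so a zero at ρ would force ζ₁ = 0
  -- identically, against ζ₁(1) = 1.
  set φ : ℂ → ℂ := fun s => (G s - (s - 1) * E s) / (G s * (s - 1))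
  have hφ : AnalyticAt ℂ φ ρ := by
    have hEa : AnalyticAt ℂ E ρ := hEd.analyticAt (hUo.mem_nhds hρ)
    have h1a : AnalyticAt ℂ (fun s : ℂ => s - 1) ρ := (differentiable_id.sub_const 1).analyticAt ρ
    exact ((hGd.analyticAt ρ).sub (h1a.mul hEa)).div ((hGd.analyticAt ρ).mul h1a)
      (mul_ne_zero hGρ (sub_ne_zero.2 hρ1))
  have hev := eventually_eq_zero_of_deriv_eq_mul (hZd.analyticAt ρ) hφ hZρ (by
    filter_upwards [hUo.mem_nhds hρ, isOpen_ne.mem_nhds hρ1,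
      hGd.continuous.continuousAt.eventually_ne hGρ] with s hs1 hs2 hs3
    have h := heq hs1
    have h0 : s - 1 ≠ 0 := sub_ne_zero.2 hs2
    simp only at h
    simp only [Pi.mul_apply, φ]
    rw [div_mul_eq_mul_div, eq_div_iff (mul_ne_zero hs3 h0)]
    linear_combination h)
  have hall := AnalyticOnNhd.eqOn_of_preconnected_of_eventuallyEq (U := univ)
    (f := riemannZeta₁) (g := fun _ => 0) (fun z _ => hZd.analyticAt z) (fun z _ => analyticAt_const)
    isPreconnected_univ (mem_univ ρ) hev (mem_univ 1)
  rw [riemannZeta₁_one] at hall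
  exact one_ne_zero hall

/-! ### The entire function `ξ` -/

/-- The entire function `s (s - 1) Gammaℝ s ζ(s)`. -/
def xi (s : ℂ) : ℂ := 1 + s * (s - 1) * completedRiemannZeta₀ s

lemma differentiable_xi : Differentiable ℂ xi :=
  ((differentiable_id.mul (differentiable_id.sub_const 1)).mul
    differentiable_completedZeta₀).const_add 1

lemma xi_one : xi 1 = 1 := by simp [xi]

lemma xi_one_sub (s : ℂ) : xi (1 - s) = xi s := by
  rw [xi, xi, completedRiemannZeta₀_one_sub]; ring

lemma xi_eq {s : ℂ} (hs : 0 < s.re) (hs1 : s ≠ 1) :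
    xi s = s * (s - 1) * (Complex.Gammaℝ s * riemannZeta s) := by
  have hs0 : s ≠ 0 := by rintro rfl; simp at hs
  have h1 : s - 1 ≠ 0 := sub_ne_zero.2 hs1
  have h2 : (1 : ℂ) - s ≠ 0 := sub_ne_zero.2 hs1.symm
  rw [riemannZeta_def_of_ne_zero hs0, mul_div_cancel₀ _ (Complex.Gammaℝ_ne_zero_of_re_pos hs),
    completedRiemannZeta_eq, xi]
  field_simp
  ring

lemma Gammaℝ_conj (s : ℂ) :
    Complex.Gammaℝ ((starRingEnd ℂ) s) = (starRingEnd ℂ) (Complex.Gammaℝ s) := by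
  have hpi : (Real.pi : ℂ) ≠ 0 := by exact_mod_cast Real.pi_ne_zero
  rw [Complex.Gammaℝ_def, Complex.Gammaℝ_def, map_mul, ← Complex.Gamma_conj, map_div₀,
    Complex.cpow_def_of_ne_zero hpi, Complex.cpow_def_of_ne_zero hpi, ← Complex.exp_conj,
    ← Complex.ofReal_log Real.pi_pos.le]
  simp [Complex.conj_ofNat]

lemma xi_conj {s : ℂ} (hs : 0 < s.re) : xi ((starRingEnd ℂ) s) = (starRingEnd ℂ) (xi s) := by
  rcases eq_or_ne s 1 with rfl | hs1
  · simp [xi_one]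
  · rw [xi_eq hs hs1, xi_eq (by simpa using hs) (fun h => hs1 (by simpa using congrArg (starRingEnd ℂ) h)),
      riemannZeta_conj, Gammaℝ_conj]
    simp

/-- The functional equation followed by complex conjugation exchanges the two points. Thus ξ(s -
d)/ξ(s + d) has modulus one on the critical line. -/
lemma norm_xi_reflect {d : ℝ} (hd : |d| < 1 / 2) (t : ℝ) :
    ‖xi (1 / 2 - d + t * Complex.I)‖ = ‖xi (1 / 2 + d + t * Complex.I)‖ := by
  have h : (starRingEnd ℂ) (1 / 2 + d + t * Complex.I) = 1 - (1 / 2 - d + t * Complex.I) := by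
    simp [Complex.conj_ofNat]; ring
  rw [← xi_one_sub (1 / 2 - d + t * Complex.I), ← h, xi_conj, RCLike.norm_conj]
  have := (abs_lt.1 hd).1
  simp; linarith

/-- For exponents in between, a power of x is at most the sum of the two extreme powers. -/
lemma norm_mellin_le_of_mem_strip {f : ℝ → ℂ} {σ₁ σ₂ : ℝ}
    (h₁ : MellinConvergent f σ₁) (h₂ : MellinConvergent f σ₂) :
    ∃ C, ∀ s : ℂ, σ₁ ≤ s.re → s.re ≤ σ₂ → ‖mellin f s‖ ≤ C := by
  refine ⟨(∫ x in Ioi (0 : ℝ), ‖(x : ℂ) ^ ((σ₁ : ℂ) - 1) • f x‖) +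
    ∫ x in Ioi (0 : ℝ), ‖(x : ℂ) ^ ((σ₂ : ℂ) - 1) • f x‖, fun s hs₁ hs₂ => ?_⟩
  rw [← integral_add h₁.norm h₂.norm, mellin]
  refine norm_integral_le_of_norm_le (h₁.norm.add h₂.norm) ?_
  refine (ae_restrict_iff' measurableSet_Ioi).2 (ae_of_all _ fun x hx => ?_)
  have hx0 : 0 < x := hx
  rw [norm_smul, norm_smul, norm_smul, ← add_mul]
  refine mul_le_mul_of_nonneg_right ?_ (norm_nonneg _)
  simp only [Complex.norm_cpow_eq_rpow_re_of_pos hx0, Complex.sub_re, Complex.ofReal_re,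
    Complex.one_re]
  rcases le_total x 1 with h1 | h1
  · exact (Real.rpow_le_rpow_of_exponent_ge hx0 h1 (by linarith)).trans
      (le_add_of_nonneg_right (Real.rpow_nonneg hx0.le _))
  · exact (Real.rpow_le_rpow_of_exponent_le h1 (by linarith)).trans
      (le_add_of_nonneg_left (Real.rpow_nonneg hx0.le _))

/-- This entire part of the completed zeta function is half a Mellin transform, taken at s/2, that
converges absolutely everywhere; hence it is bounded on vertical strips. -/
lemma exists_norm_completedRiemannZeta₀_le (σ₁ σ₂ : ℝ) :
    ∃ C, ∀ s : ℂ, σ₁ ≤ s.re → s.re ≤ σ₂ → ‖completedRiemannZeta₀ s‖ ≤ C := by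
  set P := HurwitzZeta.hurwitzEvenFEPair 0
  have hconv : ∀ s, MellinConvergent P.f_modif s := fun s =>
    (P.isStrongFEPair_toStrongFEPair.hasMellin s).1
  obtain ⟨C, hC⟩ := norm_mellin_le_of_mem_strip (hconv ((σ₁ / 2 : ℝ) : ℂ)) (hconv ((σ₂ / 2 : ℝ) : ℂ))
  refine ⟨C / 2, fun s h₁ h₂ => ?_⟩
  have hre : (s / 2).re = s.re / 2 := by simp
  have := hC (s / 2) (by rw [hre]; linarith) (by rw [hre]; linarith)
  rw [completedRiemannZeta₀, HurwitzZeta.completedHurwitzZetaEven₀, norm_div, Complex.norm_ofNat]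
  exact div_le_div_of_nonneg_right this two_pos.le

lemma exists_norm_xi_le (σ₁ σ₂ : ℝ) :
    ∃ C, 0 ≤ C ∧ ∀ s : ℂ, σ₁ ≤ s.re → s.re ≤ σ₂ → ‖xi s‖ ≤ C * (1 + |s.im|) ^ 2 := by
  obtain ⟨C, hC⟩ := exists_norm_completedRiemannZeta₀_le σ₁ σ₂
  set A := |σ₁| + |σ₂| + 1
  have hA : 1 ≤ A := by simp only [A]; linarith [abs_nonneg σ₁, abs_nonneg σ₂]
  refine ⟨1 + A * A * |C|, by positivity, fun s h₁ h₂ => ?_⟩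
  have hC' : ‖completedRiemannZeta₀ s‖ ≤ |C| := (hC s h₁ h₂).trans (le_abs_self C)
  have hT : 1 ≤ 1 + |s.im| := by linarith [abs_nonneg s.im]
  have hre : |s.re| ≤ A - 1 := abs_le.2
    ⟨by simp only [A]; linarith [neg_abs_le σ₁, abs_nonneg σ₂],
      by simp only [A]; linarith [le_abs_self σ₂, abs_nonneg σ₁]⟩
  have hre1 : |(s - 1).re| ≤ A := by
    rw [Complex.sub_re, Complex.one_re]
    exact (abs_sub _ _).trans (by rw [abs_one]; linarith)
  have n1 : ‖s‖ ≤ A * (1 + |s.im|) :=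
    (Complex.norm_le_abs_re_add_abs_im s).trans (by nlinarith [abs_nonneg s.im])
  have n2 : ‖s - 1‖ ≤ A * (1 + |s.im|) := by
    refine (Complex.norm_le_abs_re_add_abs_im _).trans ?_
    have : (s - 1).im = s.im := by simp
    rw [this]
    nlinarith [abs_nonneg s.im]
  have h3 : ‖s * (s - 1) * completedRiemannZeta₀ s‖ ≤
      (A * (1 + |s.im|)) * (A * (1 + |s.im|)) * |C| := by
    rw [norm_mul, norm_mul]
    gcongr
  refine (norm_add_le _ _).trans ?_
  rw [norm_one]
  have : 1 ≤ (1 + |s.im|) ^ 2 := one_le_pow₀ hT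
  nlinarith

/-! ### Bounds for Dirichlet series and Gamma factors -/

lemma norm_LSeries_le {f : ℕ → ℂ} {σ : ℝ} (hf : LSeriesSummable f σ) {s : ℂ} (hs : σ ≤ s.re) :
    ‖LSeries f s‖ ≤ ∑' n, ‖LSeries.term f σ n‖ := by
  have h : ∀ n, ‖LSeries.term f s n‖ ≤ ‖LSeries.term f σ n‖ := fun n =>
    LSeries.norm_term_le_of_re_le_re f (by simpa using hs) n
  have hs2 := hf.norm.of_nonneg_of_le (fun n => norm_nonneg _) h
  exact (norm_tsum_le_tsum_norm hs2).trans (hs2.tsum_le_tsum h hf.norm)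

/-- Both ζ and 1/ζ = ∑ μ(n) n^{-s} are absolutely convergent Dirichlet series for Re s ≥ 2. -/
lemma exists_riemannZeta_bounds :
    ∃ B : ℝ, 0 < B ∧ ∀ s : ℂ, 2 ≤ s.re → ‖riemannZeta s‖ ≤ B ∧ 1 ≤ B * ‖riemannZeta s‖ := by
  have h2 : 1 < ((2 : ℝ) : ℂ).re := by simp
  have hz := ArithmeticFunction.LSeriesSummable_zeta_iff.2 h2
  have hm := ArithmeticFunction.LSeriesSummable_moebius_iff.2 h2
  set B₁ := ∑' n, ‖LSeries.term (fun n => (ArithmeticFunction.zeta n : ℂ)) (2 : ℝ) n‖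
  set B₂ := ∑' n, ‖LSeries.term (fun n => (ArithmeticFunction.moebius n : ℂ)) (2 : ℝ) n‖
  have hB₁ : 0 ≤ B₁ := tsum_nonneg fun n => norm_nonneg _
  have hB₂ : 0 ≤ B₂ := tsum_nonneg fun n => norm_nonneg _
  refine ⟨B₁ + B₂ + 1, by positivity, fun s hs => ?_⟩
  have hs1 : 1 < s.re := by linarith
  have e := ArithmeticFunction.LSeries_zeta_eq_riemannZeta hs1
  have n1 := norm_LSeries_le hz hs
  have n2 := norm_LSeries_le hm hs
  have e2 := congrArg norm (ArithmeticFunction.LSeries_zeta_mul_Lseries_moebius hs1)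
  rw [norm_mul, norm_one] at e2
  rw [← e]
  refine ⟨n1.trans (by linarith), ?_⟩
  rw [← e2, mul_comm]
  exact mul_le_mul_of_nonneg_right (n2.trans (by linarith)) (norm_nonneg _)

lemma exists_norm_logDeriv_riemannZeta_le :
    ∃ B : ℝ, 0 ≤ B ∧ ∀ s : ℂ, 2 ≤ s.re → ‖deriv riemannZeta s / riemannZeta s‖ ≤ B := by
  have h2 : 1 < ((2 : ℝ) : ℂ).re := by simp
  refine ⟨∑' n, ‖LSeries.term (fun n => (ArithmeticFunction.vonMangoldt n : ℂ)) (2 : ℝ) n‖,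
    tsum_nonneg fun n => norm_nonneg _, fun s hs => ?_⟩
  have := norm_LSeries_le (ArithmeticFunction.LSeriesSummable_vonMangoldt h2) hs
  rwa [ArithmeticFunction.LSeries_vonMangoldt_eq_deriv_riemannZeta_div (by linarith), neg_div,
    norm_neg] at this

/-- By the reflection formula |Γ(1/2 + iy)|² = π/|sin π(1/2 + iy)|, and |sin w| ≤ e^{|Im w|}. -/
lemma norm_Gamma_half_add (y : ℝ) :
    Real.exp (-(Real.pi * |y|)) ≤ ‖Complex.Gamma (1 / 2 + y * Complex.I)‖ ^ 2 := by
  have h := Complex.Gamma_mul_Gamma_one_sub (1 / 2 + y * Complex.I)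
  have hc : (1 : ℂ) - (1 / 2 + y * Complex.I) = (starRingEnd ℂ) (1 / 2 + y * Complex.I) := by
    simp [Complex.conj_ofNat]; ring
  have hn := congrArg norm h
  rw [hc, Complex.Gamma_conj, norm_mul, RCLike.norm_conj, ← sq, norm_div, Complex.norm_real,
    Real.norm_of_nonneg Real.pi_pos.le] at hn
  rw [hn]
  set w : ℂ := Real.pi * (1 / 2 + y * Complex.I)
  have hw : w.im = Real.pi * y := by simp [w]
  have hsin : ‖Complex.sin w‖ ≤ Real.exp (Real.pi * |y|) := by
    rw [Complex.sin, norm_div, norm_mul, Complex.norm_I, mul_one, Complex.norm_ofNat,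
      div_le_iff₀ two_pos]
    refine (norm_sub_le _ _).trans ?_
    rw [Complex.norm_exp, Complex.norm_exp]
    have e1 : (-w * Complex.I).re = Real.pi * y := by simp [hw]
    have e2 : (w * Complex.I).re = -(Real.pi * y) := by simp [hw]
    rw [e1, e2]
    have hpi := Real.pi_pos
    have h1 : Real.exp (Real.pi * y) ≤ Real.exp (Real.pi * |y|) :=
      Real.exp_le_exp.2 (by nlinarith [le_abs_self y])
    have h2 : Real.exp (-(Real.pi * y)) ≤ Real.exp (Real.pi * |y|) :=
      Real.exp_le_exp.2 (by nlinarith [neg_abs_le y])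
    linarith
  have hne : 0 < ‖Complex.sin w‖ := by
    rw [norm_pos_iff]
    intro h0
    rw [h0, norm_zero, div_zero, sq_eq_zero_iff, norm_eq_zero] at hn
    exact Complex.Gamma_ne_zero_of_re_pos (by simp) hn
  rw [Real.exp_neg, le_div_iff₀ hne, inv_mul_le_iff₀ (Real.exp_pos _)]
  calc ‖Complex.sin w‖ ≤ Real.exp (Real.pi * |y|) * 1 := by rw [mul_one]; exact hsin
    _ ≤ _ := mul_le_mul_of_nonneg_left (by linarith [Real.pi_gt_three]) (Real.exp_pos _).le

lemma norm_Gammaℝ (s : ℂ) :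
    ‖Complex.Gammaℝ s‖ = Real.pi ^ (-s.re / 2) * ‖Complex.Gamma (s / 2)‖ := by
  rw [Complex.Gammaℝ_def, norm_mul, Complex.norm_cpow_eq_rpow_re_of_pos Real.pi_pos]
  simp

/-- On Re s = 3 every factor of ξ except Γ is bounded below, and Γ(3/2 + it/2) = (1/2 + it/2) Γ(1/2
+ it/2) decays at most exponentially. The rate 2 is crude, from π < 4. -/
lemma exists_le_norm_xi :
    ∃ c : ℝ, 0 < c ∧ ∀ t : ℝ, c * Real.exp (-(2 * |t|)) ≤ ‖xi (3 + t * Complex.I)‖ := by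
  obtain ⟨B, hB, hz⟩ := exists_riemannZeta_bounds
  refine ⟨Real.pi ^ (-(3 : ℝ) / 2) / B, by positivity, fun t => ?_⟩
  set s : ℂ := 3 + t * Complex.I
  have hre : s.re = 3 := by simp [s]
  have hs1 : s ≠ 1 := by intro h; rw [h] at hre; norm_num at hre
  have n1 : 3 ≤ ‖s‖ := by
    have := Complex.abs_re_le_norm s
    rwa [hre, abs_of_pos three_pos] at this
  have n2 : 2 ≤ ‖s - 1‖ := by
    have := Complex.abs_re_le_norm (s - 1)
    rw [Complex.sub_re, hre, Complex.one_re] at this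
    norm_num at this
    exact this
  have n3 : 1 / B ≤ ‖riemannZeta s‖ := by
    rw [div_le_iff₀' hB]
    exact (hz s (by rw [hre]; norm_num)).2
  have n4 : (1 / 2 : ℝ) * Real.exp (-(2 * |t|)) ≤ ‖Complex.Gamma (s / 2)‖ := by
    have hz0 : (1 / 2 : ℂ) + (t / 2 : ℝ) * Complex.I ≠ 0 := by
      intro h
      have := congrArg Complex.re h
      simp at this
    have e : s / 2 = (1 / 2 + (t / 2 : ℝ) * Complex.I) + 1 := by
      simp only [s]; push_cast; ring
    rw [e, Complex.Gamma_add_one _ hz0, norm_mul]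
    refine mul_le_mul ?_ ?_ (Real.exp_pos _).le (norm_nonneg _)
    · have := Complex.abs_re_le_norm ((1 / 2 : ℂ) + (t / 2 : ℝ) * Complex.I)
      simp at this
      simpa using this
    · have h1 := norm_Gamma_half_add (t / 2)
      refine le_of_sq_le_sq ?_ (norm_nonneg _)
      refine le_trans ?_ h1
      rw [← Real.exp_nat_mul, Real.exp_le_exp, abs_div, abs_two]
      have := Real.pi_lt_four
      push_cast
      nlinarith [abs_nonneg t]
  rw [xi_eq (by rw [hre]; norm_num) hs1, norm_mul, norm_mul, norm_mul, norm_Gammaℝ, hre]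
  have hp : (0 : ℝ) < Real.pi ^ (-(3 : ℝ) / 2) := by positivity
  calc Real.pi ^ (-(3 : ℝ) / 2) / B * Real.exp (-(2 * |t|))
      = 1 * 2 * (Real.pi ^ (-(3 : ℝ) / 2) * ((1 / 2 : ℝ) * Real.exp (-(2 * |t|))) * (1 / B)) := by
        ring
    _ ≤ ‖s‖ * ‖s - 1‖ * (Real.pi ^ (-(3 : ℝ) / 2) * ‖Complex.Gamma (s / 2)‖ * ‖riemannZeta s‖) := by
        gcongr
        linarith

/-! ### Consequences of the Borel–Carathéodory theorem -/

lemma borelCaratheodory_ball {g : ℂ → ℂ} {c : ℂ} {R M : ℝ} (hM : 0 < M)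
    (hg : DifferentiableOn ℂ g (Metric.ball c R)) (hre : ∀ z ∈ Metric.ball c R, (g z - g c).re ≤ M)
    {r : ℝ} (hrR : r < R) {z : ℂ} (hz : ‖z - c‖ ≤ r) :
    ‖g z - g c‖ ≤ 2 * M * r / (R - r) := by
  have hr0 : 0 ≤ r := (norm_nonneg _).trans hz
  have hR : 0 < R := hr0.trans_lt hrR
  have hmaps : ∀ w ∈ Metric.ball (0 : ℂ) R, w + c ∈ Metric.ball c R := fun w hw => by
    simpa using hw
  have h := Complex.borelCaratheodory_zero (f := fun w => g (w + c) - g c) (z := z - c) hM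
    ((hg.comp (differentiableOn_id.add_const c) hmaps).sub_const _)
    (fun w hw => hre _ (hmaps w hw)) hR (by simpa using hz.trans_lt hrR) (by simp)
  simp only [sub_add_cancel] at h
  refine h.trans ?_
  have : 0 < R - r := sub_pos.2 hrR
  gcongr

/-- A primitive of f'/f on the disc is a holomorphic logarithm of f. -/
lemma exists_eq_mul_exp {f : ℂ → ℂ} {c : ℂ} {R : ℝ} (hR : 0 < R)
    (hf : DifferentiableOn ℂ f (Metric.ball c R)) (h0 : ∀ z ∈ Metric.ball c R, f z ≠ 0) :
    ∃ g : ℂ → ℂ, DifferentiableOn ℂ g (Metric.ball c R) ∧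
      ∀ z ∈ Metric.ball c R, f z = f c * Complex.exp (g z - g c) := by
  have hc : c ∈ Metric.ball c R := Metric.mem_ball_self hR
  have hd := (hf.deriv Metric.isOpen_ball).div hf h0
  obtain ⟨g, hg⟩ := hd.isExactOn_ball
  refine ⟨g, fun z hz => (hg z hz).differentiableAt.differentiableWithinAt, fun z hz => ?_⟩
  have hder : ∀ w ∈ Metric.ball c R, HasDerivAt (fun w => f w * Complex.exp (-g w)) 0 w := by
    intro w hw
    have h1 := (hf.differentiableAt (Metric.isOpen_ball.mem_nhds hw)).hasDerivAt
    refine (h1.mul (hg w hw).neg.cexp).congr_deriv ?_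
    have := h0 w hw
    simp only [Pi.div_apply]
    field_simp
    ring
  have hconst := Metric.isOpen_ball.is_const_of_deriv_eq_zero
    (convex_ball c R).isPreconnected
    (fun w hw => (hder w hw).differentiableAt.differentiableWithinAt)
    (fun w hw => (hder w hw).deriv) hz hc
  rw [sub_eq_add_neg, add_comm, Complex.exp_add, ← mul_assoc, ← hconst, mul_assoc, ← Complex.exp_add]
  simp

/-- For a zero-free f, log |f/f(c)| is the real part of a holomorphic function. It is bounded above
by M, so Borel–Carathéodory bounds it below on the smaller disc. -/
lemma le_norm_of_ne_zero_on_ball {f : ℂ → ℂ} {c : ℂ} {R M : ℝ} (hM : 0 < M)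
    (hf : DifferentiableOn ℂ f (Metric.ball c R)) (h0 : ∀ z ∈ Metric.ball c R, f z ≠ 0)
    (hle : ∀ z ∈ Metric.ball c R, ‖f z‖ ≤ Real.exp M * ‖f c‖) {r : ℝ} (hrR : r < R) {z : ℂ}
    (hz : ‖z - c‖ ≤ r) : ‖f c‖ * Real.exp (-(2 * M * r / (R - r))) ≤ ‖f z‖ := by
  have hr0 : 0 ≤ r := (norm_nonneg _).trans hz
  have hR : 0 < R := hr0.trans_lt hrR
  obtain ⟨g, hg, hfg⟩ := exists_eq_mul_exp hR hf h0
  have hc : 0 < ‖f c‖ := norm_pos_iff.2 (h0 c (Metric.mem_ball_self hR))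
  have hzb : z ∈ Metric.ball c R := by
    rw [Metric.mem_ball, dist_eq_norm]; exact hz.trans_lt hrR
  have hb := borelCaratheodory_ball hM hg (fun w hw => by
    have h1 := hle w hw
    rw [hfg w hw, norm_mul, Complex.norm_exp, mul_comm, mul_le_mul_iff_left₀ hc,
      Real.exp_le_exp] at h1
    exact h1) hrR hz
  rw [hfg z hzb, norm_mul, Complex.norm_exp]
  refine mul_le_mul_of_nonneg_left (Real.exp_le_exp.2 ?_) hc.le
  have := (abs_le.1 ((Complex.abs_re_le_norm _).trans hb)).1
  exact this

/-! ### Bounds for `ξ` under the Riemann hypothesis -/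

lemma xi_ne_zero (hRH : RiemannHypothesis) {s : ℂ} (hs : 1 / 2 < s.re) : xi s ≠ 0 := by
  rcases eq_or_ne s 1 with rfl | hs1
  · simp [xi_one]
  have hs0 : 0 < s.re := by linarith
  rw [xi_eq hs0 hs1]
  have h0 : s ≠ 0 := by rintro rfl; simp at hs0
  refine mul_ne_zero (mul_ne_zero h0 (sub_ne_zero.2 hs1))
    (mul_ne_zero (Complex.Gammaℝ_ne_zero_of_re_pos hs0) fun hz => ?_)
  have := hRH s hz (by
    rintro ⟨n, hn⟩
    rw [hn] at hs0
    simp at hs0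
    have : (0 : ℝ) ≤ n := n.cast_nonneg
    linarith) hs1
  linarith

/-- The disc of radius 5/2 about 3 + it touches the critical line and is free of zeros of ξ under
the hypothesis. There ξ grows polynomially and is at least exponentially small at the centre, so the
lower bound propagates to distance d from the line. -/
lemma exists_exp_le_norm_xi (hRH : RiemannHypothesis) {d : ℝ} (hd : 0 < d) :
    ∃ K, 0 ≤ K ∧ ∀ s : ℂ, 1 / 2 + d ≤ s.re → s.re ≤ 3 →
      Real.exp (-(K * (1 + |s.im|))) ≤ ‖xi s‖ := by
  obtain ⟨C, hC0, hC⟩ := exists_norm_xi_le (1 / 2) (11 / 2)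
  obtain ⟨c, hc, hlow⟩ := exists_le_norm_xi
  set A := Real.log (C / c + 1) + 16
  have hlog : 0 ≤ Real.log (C / c + 1) := Real.log_nonneg (by
    have : 0 ≤ C / c := by positivity
    linarith)
  have hA : 0 < A := by positivity
  set K₁ := 2 + |Real.log c|
  refine ⟨K₁ + 5 * A / d, by positivity, fun s hs₁ hs₂ => ?_⟩
  have hd' : d ≤ 5 / 2 := by linarith
  set t := s.im
  set w : ℂ := 3 + t * Complex.I
  have hball : ∀ z ∈ Metric.ball w (5 / 2), 1 / 2 < z.re ∧ z.re < 11 / 2 ∧ |z.im| ≤ |t| + 5 / 2 := by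
    intro z hz
    rw [Metric.mem_ball, dist_eq_norm] at hz
    have h1 := abs_lt.1 ((Complex.abs_re_le_norm _).trans_lt hz)
    have h2 := (Complex.abs_im_le_norm _).trans_lt hz
    have e1 : (z - w).re = z.re - 3 := by simp [w]
    have e2 : (z - w).im = z.im - t := by simp [w]
    rw [e1] at h1
    rw [e2] at h2
    refine ⟨by linarith [h1.1], by linarith [h1.2], ?_⟩
    have := abs_sub_abs_le_abs_sub z.im t
    linarith
  have hw := hlow t
  have hM : 0 < A * (1 + |t|) := by positivity
  have hlec : c ≤ Real.exp (2 * |t|) * ‖xi w‖ := by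
    have := mul_le_mul_of_nonneg_left hw (Real.exp_pos (2 * |t|)).le
    rwa [mul_left_comm, ← Real.exp_add, add_neg_cancel, Real.exp_zero, mul_one] at this
  have hupper : ∀ z ∈ Metric.ball w (5 / 2), ‖xi z‖ ≤ Real.exp (A * (1 + |t|)) * ‖xi w‖ := by
    intro z hz
    obtain ⟨h1, h2, h3⟩ := hball z hz
    have hexp : 1 + |z.im| ≤ Real.exp (|t| + 5 / 2) := by
      have := Real.add_one_le_exp (|t| + 5 / 2)
      linarith
    have hsq : (1 + |z.im|) ^ 2 ≤ Real.exp (2 * (|t| + 5 / 2)) := by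
      rw [two_mul, Real.exp_add, ← sq]
      exact pow_le_pow_left₀ (by positivity) hexp 2
    calc ‖xi z‖ ≤ C * (1 + |z.im|) ^ 2 := hC z h1.le h2.le
      _ ≤ C * Real.exp (2 * (|t| + 5 / 2)) := by gcongr
      _ = C / c * Real.exp (2 * (|t| + 5 / 2)) * c := by field_simp
      _ ≤ (C / c + 1) * Real.exp (2 * (|t| + 5 / 2)) * (Real.exp (2 * |t|) * ‖xi w‖) := by
        gcongr; linarith
      _ = Real.exp (Real.log (C / c + 1) + 4 * |t| + 5) * ‖xi w‖ := by
        rw [show Real.log (C / c + 1) + 4 * |t| + 5 =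
          Real.log (C / c + 1) + (2 * (|t| + 5 / 2) + 2 * |t|) by ring, Real.exp_add,
          Real.exp_add, Real.exp_log (by positivity)]
        ring
      _ ≤ _ := by
        gcongr
        simp only [A]
        nlinarith [abs_nonneg t]
  have hz : ‖s - w‖ ≤ 5 / 2 - d := by
    have e : s - w = ((s.re - 3 : ℝ) : ℂ) := by
      apply Complex.ext <;> simp [w, t]
    rw [e, Complex.norm_real, Real.norm_eq_abs, abs_le]
    constructor <;> linarith
  have hmain := le_norm_of_ne_zero_on_ball hM differentiable_xi.differentiableOn
    (fun z hz => xi_ne_zero hRH (hball z hz).1) hupper (by linarith : 5 / 2 - d < 5 / 2) hz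
  refine le_trans ?_ hmain
  have h1 : Real.exp (-(K₁ * (1 + |t|))) ≤ ‖xi w‖ := by
    refine le_trans ?_ hw
    rw [← Real.exp_log hc, ← Real.exp_add, Real.exp_le_exp]
    simp only [K₁]
    nlinarith [neg_abs_le (Real.log c), abs_nonneg t, abs_nonneg (Real.log c)]
  have h2 : Real.exp (-(5 * A / d * (1 + |t|))) ≤
      Real.exp (-(2 * (A * (1 + |t|)) * (5 / 2 - d) / (5 / 2 - (5 / 2 - d)))) := by
    rw [Real.exp_le_exp, neg_le_neg_iff, sub_sub_cancel, div_mul_eq_mul_div]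
    gcongr ?_ / d
    nlinarith
  rw [add_mul, neg_add, Real.exp_add]
  exact mul_le_mul h1 h2 (Real.exp_pos _).le (norm_nonneg _)

/-- Γ(z) Γ(d) is Γ(z + d) times a Beta integral, which for Re z ≥ 1 is at most ∫ (1 - x)^{d-1} dx =
1/d. -/
lemma norm_Gamma_le_mul {z : ℂ} (hz : 1 ≤ z.re) {d : ℝ} (hd : 0 < d) :
    ‖Complex.Gamma z‖ * Real.Gamma d ≤ 1 / d * ‖Complex.Gamma (z + d)‖ := by
  have h := congrArg norm (Complex.Gamma_mul_Gamma_eq_betaIntegral (s := z) (t := d)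
    (by linarith) (by simpa using hd))
  rw [norm_mul, norm_mul, Complex.Gamma_ofReal, Complex.norm_real,
    Real.norm_of_nonneg (Real.Gamma_pos_of_pos hd).le] at h
  rw [h, mul_comm]
  refine mul_le_mul_of_nonneg_right ?_ (norm_nonneg _)
  have hint : IntervalIntegrable (fun x : ℝ => (1 - x) ^ (d - 1)) volume 0 1 := by
    have := (intervalIntegral.intervalIntegrable_rpow' (a := 0) (b := 1)
      (by linarith : -1 < d - 1)).comp_sub_left 1
    simpa using this.symm
  have hval : ∫ x in (0 : ℝ)..1, (1 - x) ^ (d - 1) = 1 / d := by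
    rw [intervalIntegral.integral_comp_sub_left (fun x => x ^ (d - 1)), sub_self, sub_zero,
      integral_rpow (Or.inl (by linarith))]
    simp [Real.zero_rpow hd.ne']
  rw [← hval, Complex.betaIntegral]
  refine intervalIntegral.norm_integral_le_of_norm_le zero_le_one ?_ hint
  have : ∀ᵐ x : ℝ, x ≠ 1 := Measure.ae_ne volume 1
  filter_upwards [this] with x hx1 hx
  have hx' : x < 1 := lt_of_le_of_ne hx.2 hx1
  rw [norm_mul, Complex.norm_cpow_eq_rpow_re_of_pos hx.1]
  have e : (1 - x : ℂ) = ((1 - x : ℝ) : ℂ) := by push_cast; rfl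
  rw [e, Complex.norm_cpow_eq_rpow_re_of_pos (by linarith)]
  have h2 : x ^ (z - 1).re ≤ 1 := Real.rpow_le_one hx.1.le hx.2 (by simp; linarith)
  calc x ^ (z - 1).re * (1 - x) ^ ((d : ℂ) - 1).re ≤ 1 * (1 - x) ^ ((d : ℂ) - 1).re := by
        gcongr
    _ = _ := by simp

/-- Factor by factor, in the region where ζ and 1/ζ are bounded. It controls the quotient of the two
values far to the right, where the strip estimates do not reach. -/
lemma exists_norm_xi_sub_le_xi_add {d : ℝ} (hd : 0 < d) :
    ∃ C, 0 ≤ C ∧ ∀ s : ℂ, 5 / 2 ≤ (s - d).re → ‖xi (s - d)‖ ≤ C * ‖xi (s + d)‖ := by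
  obtain ⟨B, hB, hz⟩ := exists_riemannZeta_bounds
  have hΓ := Real.Gamma_pos_of_pos hd
  set G := Real.pi ^ d * (1 / d / Real.Gamma d)
  have hG : 0 < G := by positivity
  refine ⟨G * (B * B), by positivity, fun s hs => ?_⟩
  have e1 : (s - d).re = s.re - d := by simp
  have e2 : (s + d).re = s.re + d := by simp
  have hne1 : s - d ≠ 1 := by intro h; rw [h] at hs; norm_num at hs
  have hne2 : s + d ≠ 1 := by
    intro h
    have := congrArg Complex.re h
    rw [e2, Complex.one_re] at this
    linarith
  rw [xi_eq (by linarith) hne1, xi_eq (by linarith) hne2]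
  simp only [norm_mul]
  have n1 : ‖s - d‖ ≤ ‖s + d‖ := by
    rw [← sq_le_sq₀ (norm_nonneg _) (norm_nonneg _), Complex.sq_norm, Complex.sq_norm,
      Complex.normSq_apply, Complex.normSq_apply]
    simp
    nlinarith
  have n2 : ‖s - d - 1‖ ≤ ‖s + d - 1‖ := by
    rw [← sq_le_sq₀ (norm_nonneg _) (norm_nonneg _), Complex.sq_norm, Complex.sq_norm,
      Complex.normSq_apply, Complex.normSq_apply]
    simp
    nlinarith
  have n3 : ‖Complex.Gammaℝ (s - d)‖ ≤ G * ‖Complex.Gammaℝ (s + d)‖ := by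
    have h := norm_Gamma_le_mul (z := (s - d) / 2) (by
      rw [Complex.div_ofNat_re]; linarith) hd
    have e : (s - d) / 2 + d = (s + d) / 2 := by ring
    rw [e, ← le_div_iff₀ hΓ] at h
    rw [norm_Gammaℝ, norm_Gammaℝ, e1, e2]
    have hp : Real.pi ^ (-(s.re - d) / 2) = Real.pi ^ d * Real.pi ^ (-(s.re + d) / 2) := by
      rw [← Real.rpow_add Real.pi_pos]; congr 1; ring
    rw [hp]
    calc _ ≤ Real.pi ^ d * Real.pi ^ (-(s.re + d) / 2) *
          (1 / d * ‖Complex.Gamma ((s + d) / 2)‖ / Real.Gamma d) := by gcongr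
      _ = _ := by simp only [G]; ring
  have n4 : ‖riemannZeta (s - d)‖ ≤ B * B * ‖riemannZeta (s + d)‖ := by
    refine (hz (s - d) (by linarith)).1.trans ?_
    have := mul_le_mul_of_nonneg_left (hz (s + d) (by linarith)).2 hB.le
    linarith
  calc _ ≤ ‖s + d‖ * ‖s + d - 1‖ * ((G * ‖Complex.Gammaℝ (s + d)‖) *
        (B * B * ‖riemannZeta (s + d)‖)) := by gcongr
    _ = _ := by ring

/-- Under the Riemann hypothesis, `|ξ(s - d)| ≤ |ξ(s + d)|` to the right of the critical line. -/
lemma norm_xi_sub_le_xi_add (hRH : RiemannHypothesis) {d : ℝ} (hd : 0 < d) (hd4 : d < 1 / 4)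
    {s : ℂ} (hs : 1 / 2 ≤ s.re) : ‖xi (s - d)‖ ≤ ‖xi (s + d)‖ := by
  obtain ⟨K, hK0, hK⟩ := exists_exp_le_norm_xi hRH hd
  obtain ⟨C₁, hC₁, h1⟩ := exists_norm_xi_le 0 3
  obtain ⟨C₂, hC₂, h2⟩ := exists_norm_xi_sub_le_xi_add hd
  have hne : ∀ z : ℂ, 1 / 2 ≤ z.re → xi (z + d) ≠ 0 := fun z hz =>
    xi_ne_zero hRH (by rw [Complex.add_re, Complex.ofReal_re]; linarith)
  -- This quotient has modulus one on the imaginary axis, is bounded on the positive real axis and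
  -- is of exponential order one, below the order 2 that Phragmén–Lindelöf allows in a half-plane.
  set h : ℂ → ℂ := fun z => xi (1 / 2 + z - d) / xi (1 / 2 + z + d)
  have hbound : ∀ z : ℂ, 0 ≤ z.re → ‖h z‖ ≤ (C₁ + C₂) * Real.exp ((K + 2) * (1 + |z.im|)) := by
    intro z hz
    have hre1 : (1 / 2 + z - d : ℂ).re = 1 / 2 + z.re - d := by simp
    have hre2 : (1 / 2 + z + d : ℂ).re = 1 / 2 + z.re + d := by simp
    have him1 : (1 / 2 + z - d : ℂ).im = z.im := by simp
    have him2 : (1 / 2 + z + d : ℂ).im = z.im := by simp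
    have hpos : 0 < ‖xi (1 / 2 + z + d)‖ := norm_pos_iff.2 (hne _ (by simpa using hz))
    have hE : 1 ≤ Real.exp ((K + 2) * (1 + |z.im|)) := Real.one_le_exp (by positivity)
    simp only [h, norm_div]
    rw [div_le_iff₀ hpos]
    -- Left of abscissa 3 the quotient is bounded by the polynomial and exponential strip bounds.
    -- Right of it, d < 1/4 keeps the numerator's point at real part at least 5/2, where the direct
    -- comparison applies.
    rcases le_total (1 / 2 + z.re + d) 3 with h3 | h3
    · have l := hK (1 / 2 + z + d) (by rw [hre2]; linarith) (by rw [hre2]; linarith)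
      have u := h1 (1 / 2 + z - d) (by rw [hre1]; linarith) (by rw [hre1]; linarith)
      rw [him2] at l
      rw [him1] at u
      have hsq : (1 + |z.im|) ^ 2 ≤ Real.exp (2 * (1 + |z.im|)) := by
        rw [two_mul, Real.exp_add, ← sq]
        refine pow_le_pow_left₀ (by positivity) ?_ 2
        linarith [Real.add_one_le_exp (1 + |z.im|)]
      calc _ ≤ C₁ * (1 + |z.im|) ^ 2 := u
        _ ≤ (C₁ + C₂) * Real.exp (2 * (1 + |z.im|)) := by gcongr; linarith
        _ = (C₁ + C₂) * Real.exp ((K + 2) * (1 + |z.im|)) * Real.exp (-(K * (1 + |z.im|))) := by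
          rw [mul_assoc, ← Real.exp_add]; ring_nf
        _ ≤ _ := by gcongr
    · refine (h2 (1 / 2 + z) (by rw [hre1]; linarith)).trans ?_
      gcongr
      nlinarith
  have key := PhragmenLindelof.right_half_plane_of_bounded_on_real (f := h) (C := 1)
    (z := s - 1 / 2) ?_ ?_ ?_ ?_ (by simpa using hs)
  · simp only [h, add_sub_cancel] at key
    rw [norm_div, div_le_one (norm_pos_iff.2 (hne s hs))] at key
    exact key
  · have hdo : DifferentiableOn ℂ h {z | 0 ≤ z.re} := by
      have d1 : Differentiable ℂ fun z : ℂ => xi (1 / 2 + z - d) :=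
        differentiable_xi.comp ((differentiable_id.const_add _).sub_const _)
      have d2 : Differentiable ℂ fun z : ℂ => xi (1 / 2 + z + d) :=
        differentiable_xi.comp ((differentiable_id.const_add _).add_const _)
      refine d1.differentiableOn.div d2.differentiableOn fun z hz => hne _ ?_
      have : 0 ≤ z.re := hz
      simpa using this
    refine DifferentiableOn.diffContOnCl ?_
    rwa [Complex.closure_setOfPred_lt_re]
  · refine ⟨1, one_lt_two, K + 2, IsBigO.of_bound ((C₁ + C₂) * Real.exp (K + 2)) ?_⟩
    rw [eventually_inf_principal]
    refine Eventually.of_forall fun z hz => ?_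
    refine (hbound z (le_of_lt hz)).trans ?_
    rw [Real.norm_of_nonneg (Real.exp_pos _).le, Real.rpow_one, mul_assoc, ← Real.exp_add]
    have := Complex.abs_im_le_norm z
    gcongr
    nlinarith
  · refine isBoundedUnder_of_eventually_le (a := (C₁ + C₂) * Real.exp (K + 2)) ?_
    filter_upwards [eventually_ge_atTop 0] with x hx
    have := hbound x (by simpa using hx)
    simpa using this
  · intro x
    have e1 : (1 / 2 + x * Complex.I - d : ℂ) = 1 / 2 - d + x * Complex.I := by ring
    have e2 : (1 / 2 + x * Complex.I + d : ℂ) = 1 / 2 + d + x * Complex.I := by ring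
    have hpos : 0 < ‖xi (1 / 2 + x * Complex.I + d)‖ := norm_pos_iff.2 (hne _ (by simp))
    simp only [h, norm_div]
    rw [div_le_one hpos, e1, e2, norm_xi_reflect (by rw [abs_of_pos hd]; linarith)]

/-- Under the Riemann hypothesis, `Re (ξ'/ξ) ≥ 0` to the right of the critical line. -/
lemma re_logDeriv_xi_nonneg (hRH : RiemannHypothesis) {s : ℂ} (hs : 1 / 2 < s.re) :
    0 ≤ (logDeriv xi s).re := by
  have hne := xi_ne_zero hRH hs
  -- N(x) - N(-x) vanishes at 0 and is nonnegative for small x > 0, so its derivative at 0, which is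
  -- 4 |ξ|² Re(ξ'/ξ), is nonnegative.
  set N : ℝ → ℝ := fun x => ‖xi (s + x)‖ ^ 2
  have hd1 : HasDerivAt (fun x : ℝ => xi (s + x)) (deriv xi s) 0 := by
    have h1 : HasDerivAt (fun x : ℝ => s + (x : ℂ)) 1 0 :=
      (Complex.ofRealCLM.hasDerivAt (x := (0 : ℝ))).const_add s
    have h2 : HasDerivAt xi (deriv xi s) (s + ((0 : ℝ) : ℂ)) := by
      simpa using (differentiable_xi s).hasDerivAt
    exact (h2.comp (0 : ℝ) h1).congr_deriv (mul_one _)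
  have hd2 : HasDerivAt N (2 * ((starRingEnd ℂ) (xi s) * deriv xi s).re) 0 := by
    have h1 := hd1.norm_sq
    have e : inner ℝ (xi (s + ((0 : ℝ) : ℂ))) (deriv xi s) =
        ((starRingEnd ℂ) (xi s) * deriv xi s).re := by
      simp [Complex.inner, mul_comm]
    rwa [e] at h1
  have hd3 : HasDerivAt (fun x => N x - N (-x))
      (2 * (2 * ((starRingEnd ℂ) (xi s) * deriv xi s).re)) 0 := by
    have h1 : HasDerivAt N (2 * ((starRingEnd ℂ) (xi s) * deriv xi s).re) (-0) := by simpa using hd2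
    have := hd2.sub (h1.comp (0 : ℝ) (hasDerivAt_neg 0))
    refine this.congr_deriv ?_
    ring
  have hpos : 0 ≤ 2 * (2 * ((starRingEnd ℂ) (xi s) * deriv xi s).re) := by
    have hw := hd3.hasDerivWithinAt (s := Ioi 0)
    rw [hasDerivWithinAt_iff_tendsto_slope' (by simp)] at hw
    refine ge_of_tendsto hw ?_
    filter_upwards [Ioo_mem_nhdsGT (by norm_num : (0 : ℝ) < 1 / 4)] with x hx
    have := norm_xi_sub_le_xi_add hRH hx.1 hx.2 hs.le
    have h2 : N (-x) ≤ N x := by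
      simp only [N]
      refine pow_le_pow_left₀ (norm_nonneg _) ?_ 2
      simpa [sub_eq_add_neg] using this
    rw [slope_def_field]
    have hx0 := hx.1
    refine div_nonneg ?_ (by linarith)
    simp only [neg_zero, sub_self, sub_zero]
    linarith
  have hL : (logDeriv xi s).re = ((starRingEnd ℂ) (xi s) * deriv xi s).re / ‖xi s‖ ^ 2 := by
    rw [logDeriv_apply, Complex.div_re, Complex.sq_norm, Complex.mul_re, Complex.conj_re,
      Complex.conj_im]
    ring
  rw [hL]
  exact div_nonneg (by linarith) (by positivity)

/-! ### Shifting vertical lines of integration -/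

lemma integrable_vertical {Q : ℂ → ℂ} {σ C : ℝ} (hc : Continuous fun t : ℝ => Q (σ + t * Complex.I))
    (hb : ∀ t : ℝ, ‖Q (σ + t * Complex.I)‖ ≤ C * (1 + t ^ 2)⁻¹) :
    Integrable fun t : ℝ => Q (σ + t * Complex.I) :=
  (integrable_inv_one_add_sq.const_mul C).mono' hc.aestronglyMeasurable (ae_of_all _ hb)

/-- Cauchy's theorem on rectangles of height 2T; the horizontal sides are O(1/(1 + T²)). -/
lemma integral_vertical_eq {Q : ℂ → ℂ} {σ₁ σ₂ C : ℝ} (hσ : σ₁ ≤ σ₂)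
    (hQ : DifferentiableOn ℂ Q {s | σ₁ ≤ s.re ∧ s.re ≤ σ₂})
    (hb : ∀ s : ℂ, σ₁ ≤ s.re → s.re ≤ σ₂ → ‖Q s‖ ≤ C * (1 + s.im ^ 2)⁻¹) :
    ∫ t : ℝ, Q (σ₁ + t * Complex.I) = ∫ t : ℝ, Q (σ₂ + t * Complex.I) := by
  have hint : ∀ σ, σ₁ ≤ σ → σ ≤ σ₂ → Integrable fun t : ℝ => Q (σ + t * Complex.I) := by
    intro σ h1 h2
    refine integrable_vertical (C := C) ?_ fun t => ?_
    · exact hQ.continuousOn.comp_continuous (by fun_prop) fun t => by simp [h1, h2]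
    · simpa using hb (σ + t * Complex.I) (by simpa using h1) (by simpa using h2)
  have hlim : ∀ σ, σ₁ ≤ σ → σ ≤ σ₂ → Tendsto (fun T : ℝ => ∫ t in -T..T, Q (σ + t * Complex.I))
      atTop (𝓝 (∫ t : ℝ, Q (σ + t * Complex.I))) := fun σ h1 h2 =>
    intervalIntegral_tendsto_integral (hint σ h1 h2) tendsto_neg_atTop_atBot tendsto_id
  have hrect : ∀ T : ℝ, Complex.I * ((∫ t in -T..T, Q (σ₂ + t * Complex.I)) -
      ∫ t in -T..T, Q (σ₁ + t * Complex.I)) =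
      (∫ x in σ₁..σ₂, Q (x + T * Complex.I)) - ∫ x in σ₁..σ₂, Q (x + (-T : ℝ) * Complex.I) := by
    intro T
    have h := Complex.integral_boundary_rect_eq_zero_of_differentiableOn Q
      (σ₁ + (-T : ℝ) * Complex.I) (σ₂ + T * Complex.I) (hQ.mono fun s hs => by
        have h1 := hs.1
        simp only [Complex.add_re, Complex.ofReal_re, Complex.mul_re, Complex.I_re, mul_zero,
          Complex.ofReal_im, Complex.I_im, mul_one, sub_self, add_zero, mem_preimage,
          uIcc_of_le hσ] at h1
        exact h1)
    simp only [Complex.add_re, Complex.ofReal_re, Complex.mul_re, Complex.I_re, mul_zero,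
      Complex.ofReal_im, Complex.I_im, mul_one, sub_self, add_zero, Complex.add_im, Complex.mul_im,
      zero_add, smul_eq_mul] at h
    linear_combination h
  have hhor : ∀ τ : ℝ, ‖∫ x in σ₁..σ₂, Q (x + τ * Complex.I)‖ ≤ C * (1 + τ ^ 2)⁻¹ * |σ₂ - σ₁| := by
    intro τ
    refine intervalIntegral.norm_integral_le_of_norm_le_const fun x hx => ?_
    rw [uIoc_of_le hσ] at hx
    simpa using hb (x + τ * Complex.I) (by simpa using hx.1.le) (by simpa using hx.2)
  have hsq : Tendsto (fun T : ℝ => C * (1 + T ^ 2)⁻¹ * |σ₂ - σ₁|) atTop (𝓝 0) := by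
    have h1 : Tendsto (fun T : ℝ => (1 + T ^ 2)⁻¹) atTop (𝓝 0) :=
      (tendsto_atTop_add_const_left _ 1 (tendsto_pow_atTop two_ne_zero)).inv_tendsto_atTop
    simpa using (h1.const_mul C).mul_const |σ₂ - σ₁|
  have hz : Tendsto (fun T : ℝ => (∫ x in σ₁..σ₂, Q (x + T * Complex.I)) -
      ∫ x in σ₁..σ₂, Q (x + (-T : ℝ) * Complex.I)) atTop (𝓝 0) := by
    have h1 : Tendsto (fun T : ℝ => ∫ x in σ₁..σ₂, Q (x + T * Complex.I)) atTop (𝓝 0) :=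
      squeeze_zero_norm hhor hsq
    have h2 : Tendsto (fun T : ℝ => ∫ x in σ₁..σ₂, Q (x + (-T : ℝ) * Complex.I)) atTop (𝓝 0) :=
      squeeze_zero_norm (fun T => by simpa using hhor (-T)) hsq
    simpa using h1.sub h2
  have hl := ((hlim σ₂ hσ le_rfl).sub (hlim σ₁ le_rfl hσ)).const_mul Complex.I
  have := tendsto_nhds_unique (hl.congr hrect) hz
  have h2 := (mul_eq_zero.1 this).resolve_left Complex.I_ne_zero
  exact (sub_eq_zero.1 h2).symm

/-! ### Decay of Mellin transforms in vertical strips -/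

lemma IsTest.mellin_decay {f : ℝ → ℂ} (hf : IsTest f) (σ₁ σ₂ : ℝ) (n : ℕ) :
    ∃ C, 0 ≤ C ∧ ∀ s : ℂ, σ₁ ≤ s.re → s.re ≤ σ₂ → (1 + |s.im|) ^ n * ‖mellin f s‖ ≤ C := by
  -- With c one unit to the left of the strip, |c - s| is at least 1 and at least |Im s|, so
  -- division by (c - s)^n is harmless.
  set c : ℂ := ((σ₁ - 1 : ℝ) : ℂ)
  have hg := hf.iterate_shiftD c n
  obtain ⟨C, hC⟩ := norm_mellin_le_of_mem_strip (hg.mellinConvergent σ₁) (hg.mellinConvergent σ₂)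
  refine ⟨2 ^ n * |C|, by positivity, fun s h1 h2 => ?_⟩
  have h := hC s h1 h2
  rw [hf.mellin_iterate_shiftD, norm_mul, norm_pow] at h
  have h3 : 1 + |s.im| ≤ 2 * ‖c - s‖ := by
    have e1 := Complex.abs_re_le_norm (c - s)
    have e2 := Complex.abs_im_le_norm (c - s)
    simp only [c, Complex.sub_re, Complex.sub_im, Complex.ofReal_re, Complex.ofReal_im, zero_sub,
      abs_neg] at e1 e2
    rw [abs_of_nonpos (by linarith)] at e1
    linarith
  calc (1 + |s.im|) ^ n * ‖mellin f s‖ ≤ (2 * ‖c - s‖) ^ n * ‖mellin f s‖ := by gcongr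
    _ = 2 ^ n * (‖c - s‖ ^ n * ‖mellin f s‖) := by rw [mul_pow]; ring
    _ ≤ 2 ^ n * |C| := by gcongr; exact h.trans (le_abs_self C)

lemma one_add_abs_sq_le (t : ℝ) : 1 + t ^ 2 ≤ (1 + |t|) ^ 2 := by
  have := sq_abs t
  nlinarith [abs_nonneg t]

/-- The factor M(f)(1 - conj s) is only bounded, on the reflected strip; M(f)(s) decays to third
order. The extra 1 + |Im s| leaves room for the linear growth of the logarithmic derivatives. -/
lemma IsTest.mellin_autoConv_decay {f : ℝ → ℂ} (hf : IsTest f) (σ₁ σ₂ : ℝ) :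
    ∃ C, 0 ≤ C ∧ ∀ s : ℂ, σ₁ ≤ s.re → s.re ≤ σ₂ →
      ‖mellin (autoConv f) s‖ * (1 + |s.im|) ≤ C * (1 + s.im ^ 2)⁻¹ := by
  obtain ⟨C₁, hC₁, h1⟩ := hf.mellin_decay σ₁ σ₂ 3
  obtain ⟨C₂, hC₂, h2⟩ := hf.mellin_decay (1 - σ₂) (1 - σ₁) 0
  refine ⟨C₁ * C₂, by positivity, fun s hs1 hs2 => ?_⟩
  have e1 := h1 s hs1 hs2
  have e2 := h2 (1 - (starRingEnd ℂ) s) (by simp; linarith) (by simp; linarith)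
  rw [pow_zero, one_mul] at e2
  rw [hf.mellin_autoConv, norm_mul, RCLike.norm_conj, ← div_eq_mul_inv, le_div_iff₀ (by positivity)]
  calc _ ≤ ‖mellin f s‖ * ‖mellin f (1 - (starRingEnd ℂ) s)‖ * (1 + |s.im|) * (1 + |s.im|) ^ 2 := by
        gcongr; exact one_add_abs_sq_le _
    _ = ((1 + |s.im|) ^ 3 * ‖mellin f s‖) * ‖mellin f (1 - (starRingEnd ℂ) s)‖ := by ring
    _ ≤ C₁ * C₂ := by gcongr

/-! ### The logarithmic derivatives -/

lemma exists_norm_logDeriv_Gammaℝ_le {c : ℝ} (hc : 0 < c) :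
    ∃ K, 0 ≤ K ∧ ∀ s : ℂ, c ≤ s.re → ‖logDeriv Complex.Gammaℝ s‖ ≤ K * (1 + ‖s‖) := by
  obtain ⟨K, hK0, hK⟩ := norm_digamma_le (half_pos hc)
  refine ⟨|Real.log Real.pi| + K, by positivity, fun s hs => ?_⟩
  have h := hK (s / 2) (by rw [Complex.div_ofNat_re]; linarith)
  rw [logDeriv_Gammaℝ (by linarith)]
  refine (norm_add_le _ _).trans ?_
  rw [norm_div, norm_div, norm_neg, Complex.norm_real, Complex.norm_ofNat, Real.norm_eq_abs]
  rw [norm_div, Complex.norm_ofNat] at h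
  have := abs_nonneg (Real.log Real.pi)
  have := norm_nonneg s
  nlinarith

lemma differentiableAt_Gammaℝ {s : ℂ} (hs : 0 < s.re) : DifferentiableAt ℂ Complex.Gammaℝ s :=
  (hasDerivAt_Gammaℝ hs).differentiableAt

lemma differentiableOn_logDeriv_Gammaℝ :
    DifferentiableOn ℂ (logDeriv Complex.Gammaℝ) {s | 0 < s.re} := by
  have ho : IsOpen {s : ℂ | 0 < s.re} := isOpen_lt continuous_const Complex.continuous_re
  have hd : DifferentiableOn ℂ Complex.Gammaℝ {s | 0 < s.re} := fun s hs =>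
    (differentiableAt_Gammaℝ hs).differentiableWithinAt
  exact (hd.deriv ho).div hd fun s hs => Complex.Gammaℝ_ne_zero_of_re_pos hs

lemma differentiableOn_logDeriv_xi (hRH : RiemannHypothesis) :
    DifferentiableOn ℂ (logDeriv xi) {s | 1 / 2 < s.re} :=
  differentiable_xi.deriv.differentiableOn.div differentiable_xi.differentiableOn
    fun _ hs => xi_ne_zero hRH hs

lemma logDeriv_xi {s : ℂ} (hs : 1 < s.re) :
    logDeriv xi s = 1 / s + 1 / (s - 1) + logDeriv Complex.Gammaℝ s +
      deriv riemannZeta s / riemannZeta s := by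
  have hs0 : s ≠ 0 := by rintro rfl; simp at hs; linarith
  have hs1 : s ≠ 1 := by rintro rfl; simp at hs
  have hpos : 0 < s.re := by linarith
  have hG := Complex.Gammaℝ_ne_zero_of_re_pos hpos
  have hz : riemannZeta s ≠ 0 := riemannZeta_ne_zero_of_one_le_re hs.le
  have hE : xi =ᶠ[𝓝 s] fun z => z * (z - 1) * (Complex.Gammaℝ z * riemannZeta z) := by
    filter_upwards [(isOpen_lt continuous_const Complex.continuous_re).mem_nhds hs] with z hz
    have hz' : 1 < z.re := hz
    exact xi_eq (by linarith) (by rintro rfl; simp at hz')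
  have hdz := differentiableAt_riemannZeta hs1
  have hdG := differentiableAt_Gammaℝ hpos
  have hid : DifferentiableAt ℂ (fun z : ℂ => z) s := differentiableAt_id
  have hid1 : DifferentiableAt ℂ (fun z : ℂ => z - 1) s := hid.sub_const 1
  have h0 : s - 1 ≠ 0 := sub_ne_zero.2 hs1
  rw [logDeriv_apply, hE.deriv_eq, hE.self_of_nhds, ← logDeriv_apply
    (fun z => z * (z - 1) * (Complex.Gammaℝ z * riemannZeta z)),
    logDeriv_mul (f := fun z : ℂ => z * (z - 1)) (g := fun z => Complex.Gammaℝ z * riemannZeta z) s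
      (mul_ne_zero hs0 h0) (mul_ne_zero hG hz) (hid.mul hid1) (hdG.mul hdz),
    logDeriv_mul (f := fun z : ℂ => z) (g := fun z => z - 1) s hs0 h0 hid hid1,
    logDeriv_mul (f := Complex.Gammaℝ) (g := riemannZeta) s hG hz hdG hdz]
  simp only [logDeriv_apply, deriv_sub_const, deriv_id'']
  ring

/-- Borel–Carathéodory for -ξ'/ξ on the disc of radius 5/2 about 3 + it: its real part is at most 0
under the hypothesis, and its value at the centre is bounded through the digamma function and the
Dirichlet series of ζ'/ζ. -/
lemma exists_norm_logDeriv_xi_le (hRH : RiemannHypothesis) {η : ℝ} (hη : 0 < η) :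
    ∃ K, 0 ≤ K ∧ ∀ s : ℂ, 1 / 2 + η ≤ s.re → s.re ≤ 3 → ‖logDeriv xi s‖ ≤ K * (1 + |s.im|) := by
  obtain ⟨K₁, hK₁, h1⟩ := exists_norm_logDeriv_Gammaℝ_le one_pos
  obtain ⟨B, hB, h2⟩ := exists_norm_logDeriv_riemannZeta_le
  have hL : ∀ t : ℝ, ‖logDeriv xi (3 + t * Complex.I)‖ ≤ (2 + 4 * K₁ + B) * (1 + |t|) := by
    intro t
    set w : ℂ := 3 + t * Complex.I
    have hre : w.re = 3 := by simp [w]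
    have a1 : ‖1 / w‖ ≤ 1 := by
      rw [norm_div, norm_one, div_le_one (by
        rw [norm_pos_iff]; intro h; rw [h] at hre; norm_num at hre)]
      have := Complex.abs_re_le_norm w
      rw [hre, abs_of_pos three_pos] at this
      linarith
    have a2 : ‖1 / (w - 1)‖ ≤ 1 := by
      have hre' : (w - 1).re = 2 := by rw [Complex.sub_re, hre, Complex.one_re]; norm_num
      rw [norm_div, norm_one, div_le_one (by
        rw [norm_pos_iff]; intro h; rw [h] at hre'; norm_num at hre')]
      have := Complex.abs_re_le_norm (w - 1)
      rw [hre', abs_of_pos two_pos] at this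
      linarith
    have a3 : ‖logDeriv Complex.Gammaℝ w‖ ≤ K₁ * (4 * (1 + |t|)) := by
      refine (h1 w (by rw [hre]; norm_num)).trans (mul_le_mul_of_nonneg_left ?_ hK₁)
      have : ‖w‖ ≤ 3 + |t| := (norm_add_le _ _).trans (by simp)
      linarith [abs_nonneg t]
    have a4 := h2 w (by rw [hre]; norm_num)
    rw [logDeriv_xi (by rw [hre]; norm_num)]
    refine (norm_add_le _ _).trans ?_
    have b1 := norm_add_le (1 / w + 1 / (w - 1)) (logDeriv Complex.Gammaℝ w)
    have b2 := norm_add_le (1 / w) (1 / (w - 1))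
    nlinarith [abs_nonneg t]
  set K₀ := 2 + 4 * K₁ + B
  have hK₀ : 0 < K₀ := by positivity
  refine ⟨K₀ + 5 * K₀ / η, by positivity, fun s hs1 hs2 => ?_⟩
  set t := s.im
  set w : ℂ := 3 + t * Complex.I
  have hM : 0 < K₀ * (1 + |t|) := by positivity
  have hball : ∀ z ∈ Metric.ball w (5 / 2), 1 / 2 < z.re := by
    intro z hz
    rw [Metric.mem_ball, dist_eq_norm] at hz
    have h1 := abs_lt.1 ((Complex.abs_re_le_norm _).trans_lt hz)
    have e1 : (z - w).re = z.re - 3 := by simp [w]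
    rw [e1] at h1
    linarith [h1.1]
  have hz : ‖s - w‖ ≤ 5 / 2 - η := by
    have e : s - w = ((s.re - 3 : ℝ) : ℂ) := by
      apply Complex.ext <;> simp [w, t]
    rw [e, Complex.norm_real, Real.norm_eq_abs, abs_le]
    constructor <;> linarith
  have h := borelCaratheodory_ball (g := fun z => -logDeriv xi z) (c := w) (R := 5 / 2) hM
    ((differentiableOn_logDeriv_xi hRH).neg.mono hball) (fun z hz => by
      have e1 := re_logDeriv_xi_nonneg hRH (hball z hz)
      have e2 := (Complex.re_le_norm (logDeriv xi w)).trans (hL t)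
      simp only [Complex.sub_re, Complex.neg_re]
      linarith) (by linarith : 5 / 2 - η < 5 / 2) hz
  rw [sub_sub_cancel] at h
  have h3 : 2 * (K₀ * (1 + |t|)) * (5 / 2 - η) / η ≤ 5 * K₀ / η * (1 + |t|) := by
    rw [div_mul_eq_mul_div]
    gcongr ?_ / η
    nlinarith
  have h4 : ‖logDeriv xi s‖ ≤ ‖-logDeriv xi s - -logDeriv xi w‖ + ‖logDeriv xi w‖ := by
    have := norm_sub_le (-logDeriv xi s - -logDeriv xi w) (logDeriv xi w)
    have e : -logDeriv xi s - -logDeriv xi w - logDeriv xi w = -logDeriv xi s := by ring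
    rwa [e, norm_neg] at this
  have := hL t
  linarith

/-! ### The Riemann hypothesis implies nonpositivity of the Weil sums -/

section

variable {f : ℝ → ℂ}

lemma IsTest.differentiable_mellin_autoConv (hf : IsTest f) :
    Differentiable ℂ (mellin (autoConv f)) := by
  obtain ⟨a, b, ha, hab, h⟩ := hf.exists_suppIn
  exact (h.autoConv ha hab).differentiable_mellin (div_pos ha (ha.trans_le hab))
    hf.continuous_autoConv

lemma IsTest.mellinConvergent_autoConv (hf : IsTest f) (s : ℂ) :
    MellinConvergent (autoConv f) s := by
  obtain ⟨a, b, ha, hab, h⟩ := hf.exists_suppIn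
  exact (h.autoConv ha hab).mellinConvergent (div_pos ha (ha.trans_le hab))
    hf.continuous_autoConv s

lemma IsTest.integrable_mellin_autoConv (hf : IsTest f) (σ : ℝ) :
    Integrable fun t : ℝ => mellin (autoConv f) (σ + t * Complex.I) := by
  obtain ⟨C, hC0, hC⟩ := hf.mellin_autoConv_decay σ σ
  refine integrable_vertical (C := C)
    (hf.differentiable_mellin_autoConv.continuous.comp (by fun_prop)) fun t => ?_
  have h := hC (σ + t * Complex.I) (by simp) (by simp)
  have him : (σ + t * Complex.I : ℂ).im = t := by simp
  rw [him] at h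
  nlinarith [mul_nonneg (norm_nonneg (mellin (autoConv f) (σ + t * Complex.I))) (abs_nonneg t)]

/-- Mellin inversion applied to the Dirichlet series of `-ζ'/ζ`. -/
lemma IsTest.hasSum_vonMangoldt_autoConv (hf : IsTest f) {η : ℝ} (hη : 0 ≤ η) :
    HasSum (fun n : ℕ => (2 * Real.pi : ℂ) *
        ((ArithmeticFunction.vonMangoldt n * (n : ℝ) ^ (-η) : ℝ) * autoConv f n))
      (∫ t : ℝ, mellin (autoConv f) (2 + t * Complex.I) *
        -(deriv riemannZeta (2 + η + t * Complex.I) / riemannZeta (2 + η + t * Complex.I))) := by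
  set Λ : ℕ → ℂ := fun n => (ArithmeticFunction.vonMangoldt n : ℂ)
  set G := mellin (autoConv f)
  have hGi : Integrable fun t : ℝ => G (2 + t * Complex.I) := by
    simpa using hf.integrable_mellin_autoConv 2
  set F : ℕ → ℝ → ℂ := fun n t => G (2 + t * Complex.I) * LSeries.term Λ (2 + η + t * Complex.I) n
  have hre : ∀ t : ℝ, (2 + η + t * Complex.I : ℂ).re = 2 + η := fun t => by simp
  have hL2 : LSeriesSummable Λ ((2 : ℝ) : ℂ) :=
    ArithmeticFunction.LSeriesSummable_vonMangoldt (by simp)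
  have hnorm : ∀ n t, ‖F n t‖ ≤ ‖G (2 + t * Complex.I)‖ * ‖LSeries.term Λ ((2 : ℝ) : ℂ) n‖ := by
    intro n t
    rw [norm_mul]
    refine mul_le_mul_of_nonneg_left (LSeries.norm_term_le_of_re_le_re Λ ?_ n) (norm_nonneg _)
    rw [hre, Complex.ofReal_re]
    linarith
  have hterm : ∀ (n : ℕ), n ≠ 0 → ∀ t : ℝ, LSeries.term Λ (2 + η + t * Complex.I) n =
      ((ArithmeticFunction.vonMangoldt n * (n : ℝ) ^ (-η) : ℝ) : ℂ) *
        ((n : ℝ) : ℂ) ^ (-(((2 : ℝ) : ℂ) + t * Complex.I)) := by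
    intro n hn t
    have hn0 : (n : ℂ) ≠ 0 := by exact_mod_cast hn
    rw [LSeries.term_of_ne_zero hn, div_eq_mul_inv, ← Complex.cpow_neg, Complex.ofReal_mul,
      Complex.ofReal_cpow n.cast_nonneg, mul_assoc]
    push_cast
    rw [← Complex.cpow_add _ _ hn0]
    simp only [Λ]
    ring_nf
  have hcont : ∀ n, AEStronglyMeasurable (F n) volume := by
    intro n
    refine hGi.aestronglyMeasurable.mul ?_
    rcases eq_or_ne n 0 with rfl | hn
    · simp only [LSeries.term_zero]; exact aestronglyMeasurable_const
    · simp only [hterm n hn]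
      have hn0 : ((n : ℝ) : ℂ) ≠ 0 := by exact_mod_cast hn
      refine Continuous.aestronglyMeasurable (continuous_const.mul ?_)
      exact (by fun_prop : Continuous fun t : ℝ => -(((2 : ℝ) : ℂ) + t * Complex.I)).const_cpow
        (Or.inl hn0)
  have hFi : ∀ n, Integrable (F n) := fun n =>
    (hGi.norm.mul_const ‖LSeries.term Λ ((2 : ℝ) : ℂ) n‖).mono' (hcont n)
      (ae_of_all _ (hnorm n))
  have hsum : Summable fun n => ∫ t, ‖F n t‖ := by
    refine Summable.of_nonneg_of_le (fun n => integral_nonneg fun t => norm_nonneg _) (fun n => ?_)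
      (hL2.norm.mul_left (∫ t : ℝ, ‖G (2 + t * Complex.I)‖))
    rw [← integral_mul_const]
    exact integral_mono (hFi n).norm (hGi.norm.mul_const _) (hnorm n)
  have h := hasSum_integral_of_summable_integral_norm hFi hsum
  have hval : ∀ t : ℝ, ∑' n, F n t = G (2 + t * Complex.I) *
      -(deriv riemannZeta (2 + η + t * Complex.I) / riemannZeta (2 + η + t * Complex.I)) := by
    intro t
    rw [tsum_mul_left, ← neg_div, ← ArithmeticFunction.LSeries_vonMangoldt_eq_deriv_riemannZeta_div
      (by rw [hre]; linarith), LSeries]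
  simp only [hval] at h
  refine h.congr_fun fun n => ?_
  rcases eq_or_ne n 0 with rfl | hn
  · simp [F]
  have hn0 : (0 : ℝ) < n := by positivity
  have hinv := mellinInv_mellin_eq 2 (autoConv f) hn0 (hf.mellinConvergent_autoConv _)
    (hf.integrable_mellin_autoConv 2) hf.continuous_autoConv.continuousAt
  rw [mellinInv] at hinv
  have hF : ∀ t, F n t = ((ArithmeticFunction.vonMangoldt n * (n : ℝ) ^ (-η) : ℝ) : ℂ) *
      (((n : ℝ) : ℂ) ^ (-(((2 : ℝ) : ℂ) + t * Complex.I)) • G (((2 : ℝ) : ℂ) + t * Complex.I)) := by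
    intro t
    simp only [F]
    rw [hterm n hn, smul_eq_mul, Complex.ofReal_ofNat]
    ring
  simp only [hF]
  rw [integral_const_mul]
  set J := ∫ t : ℝ, ((n : ℝ) : ℂ) ^ (-(((2 : ℝ) : ℂ) + t * Complex.I)) •
    G (((2 : ℝ) : ℂ) + t * Complex.I)
  have hJ : ((1 / (2 * Real.pi) : ℝ) : ℂ) * J = autoConv f n := by
    rw [← Complex.real_smul]; exact hinv
  clear_value J
  rw [← hJ]
  have hpi : (Real.pi : ℂ) ≠ 0 := by exact_mod_cast Real.pi_ne_zero
  push_cast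
  field_simp

lemma IsTest.integral_vonMangoldt_autoConv (hf : IsTest f) {a b : ℝ} (ha : 0 < a) (hab : a ≤ b)
    (h : SuppIn a b f) {N : ℕ} (hN : b / a < N) {η : ℝ} (hη : 0 ≤ η) :
    ∫ t : ℝ, mellin (autoConv f) (2 + t * Complex.I) *
        (deriv riemannZeta (2 + η + t * Complex.I) / riemannZeta (2 + η + t * Complex.I)) =
      -((2 * Real.pi : ℂ) * ∑ n ∈ Finset.range N,
        ((ArithmeticFunction.vonMangoldt n * (n : ℝ) ^ (-η) : ℝ) * autoConv f n)) := by
  have h1 := hf.hasSum_vonMangoldt_autoConv hη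
  simp only [mul_neg, integral_neg] at h1
  rw [Finset.mul_sum, ← neg_eq_iff_eq_neg, ← h1.tsum_eq]
  refine tsum_eq_sum fun n hn => ?_
  rw [h.autoConv ha hab, mul_zero, mul_zero]
  intro hmem
  have h2 : (N : ℝ) ≤ n := by exact_mod_cast not_lt.1 fun h' => hn (Finset.mem_range.2 h')
  linarith [hmem.2]

lemma norm_one_div_add_le {s : ℂ} (hs : 2 ≤ s.re) : ‖1 / s + 1 / (s - 1)‖ ≤ 2 := by
  have n1 : 1 ≤ ‖s‖ := by
    have := (le_abs_self _).trans (Complex.abs_re_le_norm s)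
    linarith
  have n2 : 1 ≤ ‖s - 1‖ := by
    have := (le_abs_self _).trans (Complex.abs_re_le_norm (s - 1))
    rw [Complex.sub_re, Complex.one_re] at this
    linarith
  refine (norm_add_le _ _).trans ?_
  rw [norm_div, norm_div, norm_one]
  have := (div_le_one (by linarith)).2 n1
  have := (div_le_one (by linarith)).2 n2
  linarith

lemma continuous_logDeriv_Gammaℝ_vertical {σ : ℝ} (hσ : 0 < σ) :
    Continuous fun t : ℝ => logDeriv Complex.Gammaℝ (σ + t * Complex.I) :=
  differentiableOn_logDeriv_Gammaℝ.continuousOn.comp_continuous (by fun_prop) fun t => by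
    simpa using hσ

lemma continuous_one_div_vertical {σ : ℝ} (hσ : 2 ≤ σ) : Continuous fun t : ℝ =>
    1 / ((σ : ℂ) + t * Complex.I) + 1 / ((σ : ℂ) + t * Complex.I - 1) := by
  have h0 : ∀ (c : ℝ) (t : ℝ), 0 < c → (c : ℂ) + t * Complex.I ≠ 0 := fun c t hc h => by
    have := congrArg Complex.re h
    simp at this
    linarith
  refine (continuous_const.div (by fun_prop) fun t => h0 σ t (by linarith)).add
    (continuous_const.div (by fun_prop) fun t => ?_)
  have := h0 (σ - 1) t (by linarith)
  push_cast at this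
  rwa [add_sub_right_comm]

lemma IsTest.integrable_mellin_autoConv_mul (hf : IsTest f) {S : ℝ → ℂ} (hS : Continuous S)
    {K : ℝ} (hK : ∀ t, ‖S t‖ ≤ K) :
    Integrable fun t : ℝ => mellin (autoConv f) (2 + t * Complex.I) * S t := by
  have := hf.integrable_mellin_autoConv 2
  rw [Complex.ofReal_ofNat] at this
  exact this.mul_bdd hS.aestronglyMeasurable (ae_of_all _ hK)

lemma exists_norm_logDeriv_Gammaℝ_vertical_le : ∃ K, 0 ≤ K ∧ ∀ s : ℂ, 1 / 2 ≤ s.re → s.re ≤ 3 →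
    ‖logDeriv Complex.Gammaℝ s‖ ≤ K * (1 + |s.im|) := by
  obtain ⟨K, hK0, hK⟩ := exists_norm_logDeriv_Gammaℝ_le (one_half_pos (α := ℝ))
  refine ⟨4 * K, by positivity, fun s h1 h2 => (hK s h1).trans ?_⟩
  have := Complex.norm_le_abs_re_add_abs_im s
  rw [abs_of_pos (by linarith)] at this
  nlinarith [abs_nonneg s.im]

/-- The shifted explicit formula. -/
lemma IsTest.integral_critSq_logDeriv (hRH : RiemannHypothesis) (hf : IsTest f) {a b : ℝ}
    (ha : 0 < a) (hab : a ≤ b) (h : SuppIn a b f) {N : ℕ} (hN : b / a < N) {η : ℝ} (hη : 0 < η)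
    (hη2 : η ≤ 1 / 2) :
    ∫ t : ℝ, (critSq f t : ℂ) * (logDeriv xi (((1 / 2 + η : ℝ) : ℂ) + t * Complex.I) -
        logDeriv Complex.Gammaℝ (((1 / 2 + η : ℝ) : ℂ) + t * Complex.I)) =
      (∫ t : ℝ, mellin (autoConv f) (2 + t * Complex.I) *
        (1 / (((2 + η : ℝ) : ℂ) + t * Complex.I) + 1 / (((2 + η : ℝ) : ℂ) + t * Complex.I - 1))) -
      (2 * Real.pi : ℂ) * ∑ n ∈ Finset.range N,
        ((ArithmeticFunction.vonMangoldt n * (n : ℝ) ^ (-η) : ℝ) * autoConv f n) := by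
  set G := mellin (autoConv f)
  obtain ⟨K₁, hK₁, h1⟩ := exists_norm_logDeriv_xi_le hRH hη
  obtain ⟨K₂, hK₂, h2⟩ := exists_norm_logDeriv_Gammaℝ_vertical_le
  obtain ⟨C, hC, h3⟩ := hf.mellin_autoConv_decay (1 / 2) 2
  -- The argument of G is shifted by η: on the left edge G is read on the critical line, where it is
  -- `critSq f`, and ξ'/ξ at distance η from its possible poles. On the right edge the bracket is
  -- 1/s + 1/(s - 1) + ζ'/ζ(s).
  set Q : ℂ → ℂ := fun s => G (s - η) * (logDeriv xi s - logDeriv Complex.Gammaℝ s)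
  have hQ : DifferentiableOn ℂ Q {s | 1 / 2 + η ≤ s.re ∧ s.re ≤ 2 + η} := by
    refine ((hf.differentiable_mellin_autoConv.comp
      (differentiable_id.sub_const _)).differentiableOn).mul (DifferentiableOn.sub ?_ ?_)
    · refine (differentiableOn_logDeriv_xi hRH).mono fun s hs => ?_
      have := hs.1
      show 1 / 2 < s.re
      linarith
    · refine differentiableOn_logDeriv_Gammaℝ.mono fun s hs => ?_
      have := hs.1
      show 0 < s.re
      linarith
  have hb : ∀ s : ℂ, 1 / 2 + η ≤ s.re → s.re ≤ 2 + η →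
      ‖Q s‖ ≤ C * (K₁ + K₂) * (1 + s.im ^ 2)⁻¹ := by
    intro s hs1 hs2
    have e1 : (s - η).re = s.re - η := by simp
    have e2 : (s - η).im = s.im := by simp
    have i1 := h1 s hs1 (by linarith)
    have i2 := h2 s (by linarith) (by linarith)
    have i3 := h3 (s - η) (by rw [e1]; linarith) (by rw [e1]; linarith)
    rw [e2] at i3
    calc ‖Q s‖ ≤ ‖G (s - η)‖ * ((K₁ + K₂) * (1 + |s.im|)) := by
          rw [norm_mul]
          refine mul_le_mul_of_nonneg_left ((norm_sub_le _ _).trans ?_) (norm_nonneg _)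
          linarith
      _ = (K₁ + K₂) * (‖G (s - η)‖ * (1 + |s.im|)) := by ring
      _ ≤ (K₁ + K₂) * (C * (1 + s.im ^ 2)⁻¹) := by gcongr
      _ = _ := by ring
  have hshift := integral_vertical_eq (by linarith : 1 / 2 + η ≤ 2 + η) hQ hb
  have hleft : ∀ t : ℝ, Q (((1 / 2 + η : ℝ) : ℂ) + t * Complex.I) = (critSq f t : ℂ) *
      (logDeriv xi (((1 / 2 + η : ℝ) : ℂ) + t * Complex.I) -
        logDeriv Complex.Gammaℝ (((1 / 2 + η : ℝ) : ℂ) + t * Complex.I)) := by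
    intro t
    have e : ((1 / 2 + η : ℝ) : ℂ) + t * Complex.I - η = 1 / 2 + t * Complex.I := by
      push_cast; ring
    simp only [Q, e, G]
    rw [hf.mellin_autoConv_crit]
  have hright : ∀ t : ℝ, Q (((2 + η : ℝ) : ℂ) + t * Complex.I) = G (2 + t * Complex.I) *
      (1 / (((2 + η : ℝ) : ℂ) + t * Complex.I) + 1 / (((2 + η : ℝ) : ℂ) + t * Complex.I - 1)) +
      G (2 + t * Complex.I) *
        (deriv riemannZeta (2 + η + t * Complex.I) / riemannZeta (2 + η + t * Complex.I)) := by
    intro t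
    have e : ((2 + η : ℝ) : ℂ) + t * Complex.I - η = 2 + t * Complex.I := by
      push_cast; ring
    have e2 : (2 + η + t * Complex.I : ℂ) = ((2 + η : ℝ) : ℂ) + t * Complex.I := by push_cast; rfl
    simp only [Q, e]
    rw [logDeriv_xi (by simp; linarith), e2]
    ring
  simp only [hleft, hright] at hshift
  have hPi : Integrable fun t : ℝ => G (2 + t * Complex.I) *
      (1 / (((2 + η : ℝ) : ℂ) + t * Complex.I) + 1 / (((2 + η : ℝ) : ℂ) + t * Complex.I - 1)) :=
    hf.integrable_mellin_autoConv_mul (continuous_one_div_vertical (by linarith))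
      fun t => norm_one_div_add_le (by simp [hη.le])
  have hZi : Integrable fun t : ℝ => G (2 + t * Complex.I) *
        (deriv riemannZeta (2 + η + t * Complex.I) / riemannZeta (2 + η + t * Complex.I)) := by
    have hQi : Integrable fun t : ℝ => Q (((2 + η : ℝ) : ℂ) + t * Complex.I) := by
      refine integrable_vertical (C := C * (K₁ + K₂)) ?_ fun t => ?_
      · exact hQ.continuousOn.comp_continuous (by fun_prop) fun t => by
          simp only [mem_ofPred_eq, Complex.add_re, Complex.ofReal_re, Complex.mul_re, Complex.I_re,
            mul_zero, Complex.ofReal_im, Complex.I_im, mul_one, sub_self, add_zero]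
          exact ⟨by linarith, le_rfl⟩
      · have := hb (((2 + η : ℝ) : ℂ) + t * Complex.I) (by simp; linarith) (by simp)
        simpa using this
    refine (hQi.sub hPi).congr (ae_of_all _ fun t => ?_)
    simp only [Pi.sub_apply, hright]
    ring
  rw [hshift, integral_add hPi hZi, hf.integral_vonMangoldt_autoConv ha hab h hN hη.le,
    sub_eq_add_neg]

/-- As G(1) = 0, the integrand has no pole for Re s ≥ 1/2 and the line can be moved to Re s = 1/2.
There G is real and 1/s + 1/(s - 1) = 1/s - 1/conj s is purely imaginary. -/
lemma IsTest.re_integral_mellin_autoConv_eq_zero (hf : IsTest f) (h1 : mellin f 1 = 0) :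
    (∫ t : ℝ, mellin (autoConv f) (2 + t * Complex.I) *
      (1 / (((2 : ℝ) : ℂ) + t * Complex.I) + 1 / (((2 : ℝ) : ℂ) + t * Complex.I - 1))).re = 0 := by
  set G := mellin (autoConv f)
  have hG1 : G 1 = 0 := by
    show mellin (autoConv f) 1 = 0
    rw [hf.mellin_autoConv, h1, zero_mul]
  have hGd := hf.differentiable_mellin_autoConv
  -- `dslope G 1` is G(s)/(s - 1) with the singularity at 1 removed.
  have hdd : Differentiable ℂ (dslope G 1) := by
    rw [← differentiableOn_univ, Complex.differentiableOn_dslope univ_mem]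
    exact hGd.differentiableOn
  have hds : ∀ s : ℂ, s ≠ 1 → dslope G 1 s = G s / (s - 1) := by
    intro s hs
    rw [dslope_of_ne _ hs, slope_def_field, hG1, sub_zero]
  obtain ⟨C, hC, hdec⟩ := hf.mellin_autoConv_decay (1 / 2) 2
  have hcomp : IsCompact ((Icc (1 / 2 : ℝ) 2) ×ℂ (Icc (-1 : ℝ) 1)) :=
    isCompact_Icc.reProdIm isCompact_Icc
  obtain ⟨B, hB⟩ := hcomp.exists_bound_of_continuousOn hdd.continuous.continuousOn
  set Q : ℂ → ℂ := fun s => G s / s + dslope G 1 s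
  have hb : ∀ s : ℂ, 1 / 2 ≤ s.re → s.re ≤ 2 → ‖Q s‖ ≤ (3 * C + 2 * |B|) * (1 + s.im ^ 2)⁻¹ := by
    intro s hs1 hs2
    have hG : ‖G s‖ ≤ C * (1 + s.im ^ 2)⁻¹ := by
      have := hdec s hs1 hs2
      nlinarith [mul_nonneg (norm_nonneg (G s)) (abs_nonneg s.im)]
    have hpos : 0 < 1 + s.im ^ 2 := by positivity
    have n1 : ‖G s / s‖ ≤ 2 * C * (1 + s.im ^ 2)⁻¹ := by
      have : 1 / 2 ≤ ‖s‖ := hs1.trans ((le_abs_self _).trans (Complex.abs_re_le_norm s))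
      rw [norm_div, div_le_iff₀ (by linarith)]
      have h0 : 0 ≤ C * (1 + s.im ^ 2)⁻¹ := by positivity
      nlinarith
    have n2 : ‖dslope G 1 s‖ ≤ (C + 2 * |B|) * (1 + s.im ^ 2)⁻¹ := by
      rcases le_total |s.im| 1 with hi | hi
      · have := hB s ⟨⟨hs1, hs2⟩, abs_le.1 hi⟩
        rw [← div_eq_mul_inv, le_div_iff₀ hpos]
        have hsq : s.im ^ 2 ≤ 1 := by rw [← sq_abs]; exact pow_le_one₀ (abs_nonneg _) hi
        have hB' := this.trans (le_abs_self B)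
        have := norm_nonneg (dslope G 1 s)
        nlinarith [abs_nonneg B]
      · have hs : s ≠ 1 := by rintro rfl; norm_num at hi
        have hn : 1 ≤ ‖s - 1‖ := by
          have := Complex.abs_im_le_norm (s - 1)
          rw [Complex.sub_im, Complex.one_im, sub_zero] at this
          linarith
        rw [hds s hs, norm_div]
        refine (div_le_self (norm_nonneg _) hn).trans (hG.trans ?_)
        gcongr
        linarith [abs_nonneg B]
    calc ‖Q s‖ ≤ _ := norm_add_le _ _
      _ ≤ _ := add_le_add n1 n2
      _ = _ := by ring
  have hQ : DifferentiableOn ℂ Q {s | 1 / 2 ≤ s.re ∧ s.re ≤ 2} := by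
    refine (hGd.differentiableOn.div differentiableOn_id fun s hs h0 => ?_).add hdd.differentiableOn
    have : s = 0 := h0
    rw [this] at hs
    norm_num at hs
  have hshift := integral_vertical_eq (by norm_num : (1 / 2 : ℝ) ≤ 2) hQ hb
  have hright : ∀ t : ℝ, G (2 + t * Complex.I) *
      (1 / (((2 : ℝ) : ℂ) + t * Complex.I) + 1 / (((2 : ℝ) : ℂ) + t * Complex.I - 1)) =
      Q (((2 : ℝ) : ℂ) + t * Complex.I) := by
    intro t
    have hne : ((2 : ℝ) : ℂ) + t * Complex.I ≠ 1 := by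
      intro h
      have := congrArg Complex.re h
      norm_num at this
    simp only [Q]
    rw [hds _ hne, Complex.ofReal_ofNat]
    ring
  have hleft : ∀ t : ℝ, (Q (((1 / 2 : ℝ) : ℂ) + t * Complex.I)).re = 0 := by
    intro t
    set s : ℂ := 1 / 2 + t * Complex.I
    have hes : ((1 / 2 : ℝ) : ℂ) + t * Complex.I = s := by simp only [s]; push_cast; rfl
    have hne : s ≠ 1 := by
      intro h
      have := congrArg Complex.re h
      norm_num [s] at this
    have hsc : s - 1 = -(starRingEnd ℂ) s := by
      simp only [s]; simp [Complex.conj_ofNat]; ring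
    rw [hes]
    simp only [Q]
    rw [hds _ hne, hsc]
    have hGs : G s = (critSq f t : ℂ) := hf.mellin_autoConv_crit t
    rw [hGs, div_neg, ← sub_eq_add_neg, div_eq_mul_inv, div_eq_mul_inv, ← mul_sub,
      Complex.re_ofReal_mul, ← map_inv₀, Complex.sub_re, Complex.conj_re, sub_self, mul_zero]
  have hQi : Integrable fun t : ℝ => Q (((1 / 2 : ℝ) : ℂ) + t * Complex.I) := by
    refine integrable_vertical (C := 3 * C + 2 * |B|) ?_ fun t => ?_
    · exact hQ.continuousOn.comp_continuous (by fun_prop) fun t => by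
        simp only [mem_ofPred_eq, Complex.add_re, Complex.ofReal_re, Complex.mul_re, Complex.I_re,
          mul_zero, Complex.ofReal_im, Complex.I_im, mul_one, sub_self, add_zero]
        norm_num
    · have := hb (((1 / 2 : ℝ) : ℂ) + t * Complex.I) (by simp) (by norm_num)
      simpa using this
  simp only [hright]
  rw [← hshift]
  have := integral_re hQi
  simp only [RCLike.re_to_complex, hleft, integral_zero] at this
  exact this.symm

lemma archWeight_eq (t : ℝ) :
    archWeight t = -2 * (logDeriv Complex.Gammaℝ (((1 / 2 : ℝ) : ℂ) + t * Complex.I)).re := by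
  have e : (((1 / 2 : ℝ) : ℂ) + t * Complex.I) / 2 = 1 / 4 + t / 2 * Complex.I := by
    push_cast; ring
  rw [logDeriv_Gammaℝ (by simp), e, archWeight, Complex.add_re, Complex.div_ofNat_re,
    Complex.div_ofNat_re, Complex.neg_re, Complex.ofReal_re]
  ring

lemma IsTest.re_weilCoeff (hf : IsTest f) (n : ℕ) :
    (weilCoeff f n).re = 2 * (ArithmeticFunction.vonMangoldt n * (autoConv f n).re) := by
  rcases Nat.eq_zero_or_pos n with rfl | hn
  · simp [weilCoeff]
  have hn0 : (0 : ℝ) < n := by exact_mod_cast hn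
  rw [weilCoeff, critFourier_neg, hf.autoConv_eq hn0, Complex.re_ofReal_mul, Complex.re_ofReal_mul,
    Complex.add_re, Complex.conj_re]
  ring

/-- Under the Riemann hypothesis, Weil sums are nonpositive. -/
theorem IsTest.weilSum_nonpos (hRH : RiemannHypothesis) (hf : IsTest f) (hf1 : mellin f 1 = 0) :
    (weilSum (autoConv f)).re ≤ 0 := by
  obtain ⟨a, b, ha, hab, h⟩ := hf.exists_suppIn
  obtain ⟨N, hN⟩ := exists_nat_gt (b / a)
  set G := mellin (autoConv f)
  obtain ⟨K₂, hK₂, h2⟩ := exists_norm_logDeriv_Gammaℝ_vertical_le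
  have hbΓ : ∀ η : ℝ, 0 ≤ η → η ≤ 1 / 2 → ∀ t : ℝ,
      ‖logDeriv Complex.Gammaℝ (((1 / 2 + η : ℝ) : ℂ) + t * Complex.I)‖ ≤ K₂ * (1 + |t|) ^ 1 := by
    intro η h0 h1 t
    have := h2 (((1 / 2 + η : ℝ) : ℂ) + t * Complex.I) (by simp [h0]) (by simp; linarith)
    simpa using this
  have hiΓ : ∀ η : ℝ, 0 ≤ η → η ≤ 1 / 2 → Integrable fun t : ℝ => (critSq f t : ℂ) *
      logDeriv Complex.Gammaℝ (((1 / 2 + η : ℝ) : ℂ) + t * Complex.I) := by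
    intro η h0 h1
    have := hf.integrable_critSq_mul (continuous_logDeriv_Gammaℝ_vertical
      (by linarith : 0 < 1 / 2 + η)).aestronglyMeasurable (hbΓ η h0 h1)
    simpa only [Complex.real_smul] using this
  -- By the shifted formula A(η) is the real part of ∫ Φ · (ξ'/ξ)(1/2 + η + it), hence nonnegative.
  -- Its expression here avoids ξ, which may vanish on the critical line, and so has a limit as η →
  -- 0, namely -π times the Weil sum.
  set A : ℝ → ℝ := fun η => (∫ t : ℝ, (critSq f t : ℂ) *
      logDeriv Complex.Gammaℝ (((1 / 2 + η : ℝ) : ℂ) + t * Complex.I)).re +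
    ((∫ t : ℝ, G (2 + t * Complex.I) *
        (1 / (((2 + η : ℝ) : ℂ) + t * Complex.I) + 1 / (((2 + η : ℝ) : ℂ) + t * Complex.I - 1))) -
      (2 * Real.pi : ℂ) * ∑ n ∈ Finset.range N,
        ((ArithmeticFunction.vonMangoldt n * (n : ℝ) ^ (-η) : ℝ) * autoConv f n)).re with hA
  have hpos : ∀ η, 0 < η → η ≤ 1 / 2 → 0 ≤ A η := by
    intro η h0 h1
    obtain ⟨K₁, hK₁, hx⟩ := exists_norm_logDeriv_xi_le hRH h0
    have hre : ∀ t : ℝ, (((1 / 2 + η : ℝ) : ℂ) + t * Complex.I).re = 1 / 2 + η := fun t => by simp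
    have him : ∀ t : ℝ, (((1 / 2 + η : ℝ) : ℂ) + t * Complex.I).im = t := fun t => by simp
    have hcx : Continuous fun t : ℝ => logDeriv xi (((1 / 2 + η : ℝ) : ℂ) + t * Complex.I) :=
      (differentiableOn_logDeriv_xi hRH).continuousOn.comp_continuous (by fun_prop) fun t => by
        show 1 / 2 < (((1 / 2 + η : ℝ) : ℂ) + t * Complex.I).re
        rw [hre]; linarith
    have hix : Integrable fun t : ℝ => (critSq f t : ℂ) *
        logDeriv xi (((1 / 2 + η : ℝ) : ℂ) + t * Complex.I) := by
      have := hf.integrable_critSq_mul (K := K₁) (n := 1) hcx.aestronglyMeasurable (fun t => by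
        have := hx (((1 / 2 + η : ℝ) : ℂ) + t * Complex.I) (by rw [hre]) (by rw [hre]; linarith)
        rwa [him, ← pow_one (1 + |t|)] at this)
      simpa only [Complex.real_smul] using this
    have hxpos : 0 ≤ (∫ t : ℝ, (critSq f t : ℂ) *
        logDeriv xi (((1 / 2 + η : ℝ) : ℂ) + t * Complex.I)).re := by
      have e := integral_re hix
      simp only [RCLike.re_to_complex] at e
      rw [← e]
      refine integral_nonneg fun t => ?_
      simp only [Pi.zero_apply]
      rw [Complex.re_ofReal_mul]
      refine mul_nonneg (critSq_nonneg _ _) (re_logDeriv_xi_nonneg hRH ?_)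
      rw [hre]; linarith
    have e := hf.integral_critSq_logDeriv hRH ha hab h hN h0 h1
    simp only [mul_sub] at e
    rw [integral_sub hix (hiΓ η h0.le h1)] at e
    simp only [hA]
    have e' := congrArg Complex.re e
    simp only [Complex.sub_re] at e' ⊢
    linarith
  have hIcc : ∀ᶠ η : ℝ in 𝓝[>] 0, 0 ≤ η ∧ η ≤ 1 / 2 := by
    filter_upwards [Ioo_mem_nhdsGT (by norm_num : (0 : ℝ) < 1 / 2)] with η hη
    exact ⟨hη.1.le, hη.2.le⟩
  have htη : Tendsto (fun η : ℝ => η) (𝓝[>] 0) (𝓝 0) := tendsto_id.mono_left inf_le_left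
  have l1 : Tendsto (fun η : ℝ => ∫ t : ℝ, (critSq f t : ℂ) *
      logDeriv Complex.Gammaℝ (((1 / 2 + η : ℝ) : ℂ) + t * Complex.I)) (𝓝[>] 0)
      (𝓝 (∫ t : ℝ, (critSq f t : ℂ) *
        logDeriv Complex.Gammaℝ (((1 / 2 : ℝ) : ℂ) + t * Complex.I))) := by
    refine tendsto_integral_filter_of_dominated_convergence
      (fun t => critSq f t • (K₂ * (1 + |t|) ^ 1)) ?_ ?_ ?_ ?_
    · filter_upwards [hIcc] with η hη using (hiΓ η hη.1 hη.2).aestronglyMeasurable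
    · filter_upwards [hIcc] with η hη
      refine ae_of_all _ fun t => ?_
      rw [norm_mul, Complex.norm_real, Real.norm_of_nonneg (critSq_nonneg _ _), smul_eq_mul]
      exact mul_le_mul_of_nonneg_left (hbΓ η hη.1 hη.2 t) (critSq_nonneg _ _)
    · exact hf.integrable_critSq_mul (K := K₂) (n := 1)
        (by fun_prop : Continuous fun t : ℝ => K₂ * (1 + |t|) ^ 1).aestronglyMeasurable
        (fun t => by rw [Real.norm_of_nonneg (by positivity)])
    · refine ae_of_all _ fun t => ?_
      refine Tendsto.const_mul _ ?_
      have hc : ContinuousAt (logDeriv Complex.Gammaℝ) (((1 / 2 : ℝ) : ℂ) + t * Complex.I) :=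
        (differentiableOn_logDeriv_Gammaℝ.differentiableAt
          ((isOpen_lt continuous_const Complex.continuous_re).mem_nhds (by simp))).continuousAt
      refine hc.tendsto.comp ?_
      have : Tendsto (fun η : ℝ => ((1 / 2 + η : ℝ) : ℂ) + t * Complex.I) (𝓝 0)
          (𝓝 (((1 / 2 + 0 : ℝ) : ℂ) + t * Complex.I)) :=
        (by fun_prop : Continuous fun η : ℝ => ((1 / 2 + η : ℝ) : ℂ) + t * Complex.I).tendsto 0
      rw [add_zero] at this
      exact this.comp htη
  have l2 : Tendsto (fun η : ℝ => ∫ t : ℝ, G (2 + t * Complex.I) *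
        (1 / (((2 + η : ℝ) : ℂ) + t * Complex.I) + 1 / (((2 + η : ℝ) : ℂ) + t * Complex.I - 1)))
      (𝓝[>] 0) (𝓝 (∫ t : ℝ, G (2 + t * Complex.I) *
        (1 / (((2 : ℝ) : ℂ) + t * Complex.I) + 1 / (((2 : ℝ) : ℂ) + t * Complex.I - 1)))) := by
    have hGi : Integrable fun t : ℝ => G (2 + t * Complex.I) := by
      simpa using hf.integrable_mellin_autoConv 2
    refine tendsto_integral_filter_of_dominated_convergence
      (fun t => ‖G (2 + t * Complex.I)‖ * 2) ?_ ?_ (hGi.norm.mul_const 2) ?_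
    · filter_upwards [hIcc] with η hη
      exact (hf.integrable_mellin_autoConv_mul (continuous_one_div_vertical (by linarith [hη.1]))
        fun t => norm_one_div_add_le (by simp [hη.1])).aestronglyMeasurable
    · filter_upwards [hIcc] with η hη
      refine ae_of_all _ fun t => ?_
      rw [norm_mul]
      exact mul_le_mul_of_nonneg_left (norm_one_div_add_le (by simp [hη.1])) (norm_nonneg _)
    · refine ae_of_all _ fun t => ?_
      refine Tendsto.const_mul _ ?_
      have : Tendsto (fun η : ℝ => ((2 + η : ℝ) : ℂ) + t * Complex.I) (𝓝[>] 0)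
          (𝓝 (((2 : ℝ) : ℂ) + t * Complex.I)) := by
        have h0 : Tendsto (fun η : ℝ => ((2 + η : ℝ) : ℂ) + t * Complex.I) (𝓝 0)
            (𝓝 (((2 + 0 : ℝ) : ℂ) + t * Complex.I)) :=
          (by fun_prop : Continuous fun η : ℝ => ((2 + η : ℝ) : ℂ) + t * Complex.I).tendsto 0
        rw [add_zero] at h0
        exact h0.comp htη
      have hne0 : ((2 : ℝ) : ℂ) + t * Complex.I ≠ 0 := fun h => by
        have := congrArg Complex.re h
        norm_num at this
      have hne1 : ((2 : ℝ) : ℂ) + t * Complex.I - 1 ≠ 0 := fun h => by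
        have := congrArg Complex.re h
        norm_num at this
      exact (tendsto_const_nhds.div this hne0).add (tendsto_const_nhds.div (this.sub_const 1) hne1)
  have l3 : Tendsto (fun η : ℝ => (2 * Real.pi : ℂ) * ∑ n ∈ Finset.range N,
        ((ArithmeticFunction.vonMangoldt n * (n : ℝ) ^ (-η) : ℝ) * autoConv f n)) (𝓝[>] 0)
      (𝓝 ((2 * Real.pi : ℂ) * ∑ n ∈ Finset.range N,
        ((ArithmeticFunction.vonMangoldt n : ℝ) * autoConv f n))) := by
    refine Tendsto.const_mul _ (tendsto_finsetSum _ fun n _ => Tendsto.mul_const _ ?_)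
    refine (Complex.continuous_ofReal.tendsto _).comp ?_
    rcases Nat.eq_zero_or_pos n with rfl | hn
    · simp
    have hn0 : (0 : ℝ) < n := by exact_mod_cast hn
    have : Tendsto (fun η : ℝ => (n : ℝ) ^ (-η)) (𝓝 0) (𝓝 ((n : ℝ) ^ (-(0 : ℝ)))) :=
      ((Real.continuous_const_rpow hn0.ne').comp continuous_neg).tendsto 0
    rw [neg_zero, Real.rpow_zero] at this
    simpa using (this.comp htη).const_mul (ArithmeticFunction.vonMangoldt n)
  have lA := ((Complex.continuous_re.tendsto _).comp l1).add
    ((Complex.continuous_re.tendsto _).comp (l2.sub l3))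
  have hfin := ge_of_tendsto lA (by
    filter_upwards [Ioo_mem_nhdsGT (by norm_num : (0 : ℝ) < 1 / 2)] with η hη
    exact hpos η hη.1 hη.2.le)
  rw [Complex.sub_re, hf.re_integral_mellin_autoConv_eq_zero hf1, zero_sub] at hfin
  have e1 : (∫ t : ℝ, (critSq f t : ℂ) *
      logDeriv Complex.Gammaℝ (((1 / 2 : ℝ) : ℂ) + t * Complex.I)).re =
      -(1 / 2) * ∫ t, critSq f t * archWeight t := by
    have hi := hiΓ 0 le_rfl (by norm_num)
    simp only [add_zero] at hi
    have e := integral_re hi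
    simp only [RCLike.re_to_complex] at e
    rw [← e, ← integral_const_mul]
    refine integral_congr_ae (ae_of_all _ fun t => ?_)
    simp only
    rw [archWeight_eq, Complex.re_ofReal_mul]
    ring
  have e2 : ((2 * Real.pi : ℂ) * ∑ n ∈ Finset.range N,
        ((ArithmeticFunction.vonMangoldt n : ℝ) * autoConv f n)).re =
      Real.pi * ∑ n ∈ Finset.range N, (weilCoeff f n).re := by
    have : (2 * Real.pi : ℂ) = ((2 * Real.pi : ℝ) : ℂ) := by push_cast; rfl
    rw [this, Complex.re_ofReal_mul, Complex.re_sum, Finset.mul_sum, Finset.mul_sum]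
    refine Finset.sum_congr rfl fun n _ => ?_
    rw [hf.re_weilCoeff, Complex.re_ofReal_mul]
    ring
  rw [e1, e2] at hfin
  rw [weilSum, weilTerm_Gammaℝ hf, tsum_weilTerm_zetaFactor hf ha hab h hN, Complex.add_re,
    Complex.ofReal_re, Complex.re_sum]
  have hpi := Real.pi_pos
  have h5 : 1 / (2 * Real.pi) * (∫ t, critSq f t * archWeight t) +
      ∑ n ∈ Finset.range N, (weilCoeff f n).re = -(1 / Real.pi) * (-(1 / 2) *
        (∫ t, critSq f t * archWeight t) +
        -(Real.pi * ∑ n ∈ Finset.range N, (weilCoeff f n).re)) := by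
    field_simp
    ring
  rw [h5]
  exact mul_nonpos_of_nonpos_of_nonneg (neg_nonpos.2 (by positivity)) hfin

end

/-! ### The archimedean term as an integral over `(0, ∞)` -/

/-- The function `g(e^u) + e^{-u} g(e^{-u})` for `g = f * conj f^*`. -/
def symFourier (f : ℝ → ℂ) (u : ℝ) : ℝ := Real.exp (-u / 2) * (2 * (critFourier f u).re)

/-- The integrand of the archimedean term. -/
def archKernel (f : ℝ → ℂ) (u : ℝ) : ℝ :=
  symFourier f u / (1 - Real.exp (-2 * u)) - (critFourier f 0).re * (Real.exp (-2 * u) / u)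

lemma one_sub_exp_bounds {u : ℝ} (hu : 0 < u) :
    2 * u / (1 + 2 * u) ≤ 1 - Real.exp (-2 * u) ∧ 1 - Real.exp (-2 * u) ≤ 2 * u := by
  have h1 : Real.exp (-2 * u) ≤ 1 / (1 + 2 * u) := by
    rw [neg_mul, Real.exp_neg, ← one_div]
    exact one_div_le_one_div_of_le (by positivity) (by linarith [Real.add_one_le_exp (2 * u)])
  have h2 := Real.add_one_le_exp (-2 * u)
  refine ⟨?_, by linarith⟩
  have : 2 * u / (1 + 2 * u) = 1 - 1 / (1 + 2 * u) := by field_simp; ring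
  linarith

lemma one_sub_exp_pos {u : ℝ} (hu : 0 < u) : 0 < 1 - Real.exp (-2 * u) :=
  (by positivity : 0 < 2 * u / (1 + 2 * u)).trans_le (one_sub_exp_bounds hu).1

section

variable {f : ℝ → ℂ}

lemma IsTest.continuous_symFourier (hf : IsTest f) : Continuous (symFourier f) :=
  (by fun_prop : Continuous fun u : ℝ => Real.exp (-u / 2)).mul
    (continuous_const.mul (Complex.continuous_re.comp hf.continuous_critFourier))

lemma IsTest.continuousOn_archKernel (hf : IsTest f) : ContinuousOn (archKernel f) (Ioi 0) := by
  refine (hf.continuous_symFourier.continuousOn.div (by fun_prop) fun u hu =>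
    (one_sub_exp_pos hu).ne').sub (continuousOn_const.mul (ContinuousOn.div (by fun_prop)
      continuousOn_id fun u hu => ne_of_gt hu))

lemma exists_abs_symFourier_le (f : ℝ → ℂ) :
    ∃ C, 0 ≤ C ∧ ∀ u, 0 ≤ u → |symFourier f u| ≤ C * Real.exp (-u / 2) := by
  set M := 1 / (2 * Real.pi) * ∫ t, critSq f t
  have hM : 0 ≤ M := (norm_nonneg _).trans (norm_critFourier_le f 0)
  refine ⟨2 * M, by positivity, fun u hu => ?_⟩
  rw [symFourier, abs_mul, Real.abs_exp, mul_comm, abs_mul, abs_two]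
  gcongr
  exact (Complex.abs_re_le_norm _).trans (norm_critFourier_le f u)

/-- As u → 0 the two summands behave like c/u with opposite signs, and the Lipschitz bound for φ
controls the difference. Beyond log(b/a) only c e^{-2u}/u remains. -/
lemma IsTest.exists_abs_archKernel_le (hf : IsTest f) :
    ∃ C, 0 ≤ C ∧ ∀ u, 0 < u → |archKernel f u| ≤ C * Real.exp (-u) := by
  obtain ⟨a, b, ha, hab, h⟩ := hf.exists_suppIn
  obtain ⟨L, hL0, hL⟩ := hf.critFourier_lipschitz
  set M := 1 / (2 * Real.pi) * ∫ t, critSq f t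
  have hM : 0 ≤ M := (norm_nonneg _).trans (norm_critFourier_le f 0)
  have hcM : ∀ u, |(critFourier f u).re| ≤ M := fun u =>
    (Complex.abs_re_le_norm _).trans (norm_critFourier_le f u)
  set c := (critFourier f 0).re
  set B := Real.log (b / a) + 1
  have hB : 1 ≤ B := by
    have : 0 ≤ Real.log (b / a) := Real.log_nonneg ((one_le_div ha).2 hab)
    linarith
  set C₁ := (2 * L + M) * (1 + 2 * B) + M * (1 + 2 * B) + 2 * M
  have hC₁ : 0 ≤ C₁ := by positivity
  refine ⟨C₁ * Real.exp B + M, by positivity, fun u hu => ?_⟩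
  have hE := one_sub_exp_pos hu
  obtain ⟨hE1, hE2⟩ := one_sub_exp_bounds hu
  rcases le_or_gt u B with huB | huB
  · have hle : |archKernel f u| ≤ C₁ := by
      set E := 1 - Real.exp (-2 * u)
      -- With E = 1 - e^{-2u} ~ 2u each summand is bounded: the first by the Lipschitz estimate, the
      -- others because 2/E - 1/u and E/u are.
      have e : archKernel f u = (symFourier f u - 2 * c) / E + c * (2 / E - 1 / u) + c * (E / u) := by
        have h1 : Real.exp (-2 * u) = 1 - E := by simp [E]
        have hE0 := hE.ne'
        rw [archKernel, h1]
        change symFourier f u / (1 - (1 - E)) - c * ((1 - E) / u) = _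
        rw [sub_sub_cancel]
        field_simp
        ring
      have b1 : |(symFourier f u - 2 * c) / E| ≤ (2 * L + M) * (1 + 2 * B) := by
        have hnum : |symFourier f u - 2 * c| ≤ (2 * L + M) * u := by
          have e1 : symFourier f u - 2 * c = Real.exp (-u / 2) * (2 * ((critFourier f u).re - c)) -
              (1 - Real.exp (-u / 2)) * (2 * c) := by
            rw [symFourier]; ring
          have k1 : |(critFourier f u).re - c| ≤ L * u := by
            have := (Complex.abs_re_le_norm (critFourier f u - critFourier f 0)).trans (hL u 0)
            rwa [Complex.sub_re, sub_zero, abs_of_pos hu] at this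
          have k2 : Real.exp (-u / 2) ≤ 1 := Real.exp_le_one_iff.2 (by linarith)
          have k3 : |1 - Real.exp (-u / 2)| ≤ u / 2 := by
            rw [abs_of_nonneg (by linarith)]
            linarith [Real.add_one_le_exp (-u / 2)]
          rw [e1]
          refine (abs_sub _ _).trans ?_
          rw [abs_mul, abs_mul, abs_mul, abs_mul, Real.abs_exp, abs_two]
          have k4 := mul_le_mul k2 (mul_le_mul_of_nonneg_left k1 two_pos.le) (by positivity) one_pos.le
          have k5 := mul_le_mul k3 (mul_le_mul_of_nonneg_left (hcM 0) two_pos.le) (by positivity)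
            (by positivity)
          calc _ ≤ 1 * (2 * (L * u)) + u / 2 * (2 * M) := add_le_add k4 k5
            _ = _ := by ring
        rw [abs_div, abs_of_pos hE, div_le_iff₀ hE]
        have h3 : u ≤ (1 + 2 * u) * E := by
          have := (div_le_iff₀ (by positivity : 0 < 1 + 2 * u)).1 hE1
          linarith
        calc _ ≤ (2 * L + M) * u := hnum
          _ ≤ (2 * L + M) * ((1 + 2 * u) * E) := by gcongr
          _ ≤ (2 * L + M) * ((1 + 2 * B) * E) := by gcongr
          _ = _ := by ring
      have b2 : |c * (2 / E - 1 / u)| ≤ M * (1 + 2 * B) := by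
        rw [abs_mul]
        refine mul_le_mul (hcM 0) ?_ (abs_nonneg _) hM
        have e2 : 2 / E - 1 / u = (2 * u - E) / (u * E) := by field_simp
        rw [e2, abs_of_nonneg (div_nonneg (by linarith) (by positivity)), div_le_iff₀ (by positivity)]
        have h3 : 2 * u ≤ (1 + 2 * u) * E := by
          have := (div_le_iff₀ (by positivity : 0 < 1 + 2 * u)).1 hE1
          linarith
        have h4 : 2 * u - E ≤ 2 * u * E := by linarith
        have h5 : 2 * u * E ≤ (1 + 2 * B) * (u * E) := by
          have : 0 < u * E := by positivity
          nlinarith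
        linarith
      have b3 : |c * (E / u)| ≤ 2 * M := by
        rw [abs_mul, mul_comm]
        refine mul_le_mul ?_ (hcM 0) (abs_nonneg _) two_pos.le
        rw [abs_of_pos (by positivity), div_le_iff₀ hu]
        exact hE2
      rw [e]
      refine (abs_add_le _ _).trans (add_le_add ((abs_add_le _ _).trans (add_le_add b1 b2)) b3)
    refine hle.trans ?_
    have : 1 ≤ Real.exp B * Real.exp (-u) := by
      rw [← Real.exp_add]; exact Real.one_le_exp (by linarith)
    nlinarith [Real.exp_pos (-u), mul_nonneg hM (Real.exp_pos (-u)).le]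
  · have h0 : critFourier f u = 0 := by
      refine hf.critFourier_eq_zero ha hab h ?_
      rw [abs_of_pos hu]
      linarith
    have : archKernel f u = -(c * (Real.exp (-2 * u) / u)) := by
      rw [archKernel, symFourier, h0]; simp [c]
    rw [this, abs_neg, abs_mul, abs_of_pos (by positivity : 0 < Real.exp (-2 * u) / u)]
    have h1 : Real.exp (-2 * u) / u ≤ Real.exp (-u) := by
      rw [div_le_iff₀ hu]
      have : Real.exp (-2 * u) ≤ Real.exp (-u) := Real.exp_le_exp.2 (by linarith)
      nlinarith [Real.exp_pos (-u)]
    calc _ ≤ M * Real.exp (-u) := mul_le_mul (hcM 0) h1 (by positivity) hM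
      _ ≤ _ := by
        have : 0 ≤ C₁ * Real.exp B * Real.exp (-u) := by positivity
        nlinarith

lemma integrableOn_exp_neg_mul {c : ℝ} (hc : 0 < c) :
    IntegrableOn (fun u : ℝ => Real.exp (-c * u)) (Ioi 0) :=
  integrableOn_exp_mul_Ioi (by linarith) 0

lemma IsTest.integrableOn_archKernel (hf : IsTest f) : IntegrableOn (archKernel f) (Ioi 0) := by
  obtain ⟨C, -, hC⟩ := hf.exists_abs_archKernel_le
  refine ((integrableOn_exp_neg_mul one_pos).const_mul C).mono'
    (hf.continuousOn_archKernel.aestronglyMeasurable measurableSet_Ioi) ?_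
  refine (ae_restrict_iff' measurableSet_Ioi).2 (ae_of_all _ fun u hu => ?_)
  simpa using hC u hu

/-- The Laplace transform of `symFourier`. -/
lemma IsTest.integral_symFourier_exp (hf : IsTest f) (j : ℕ) :
    ∫ u in Ioi (0 : ℝ), symFourier f u * Real.exp (-2 * u) ^ j =
      1 / (2 * Real.pi) * ∫ t, critSq f t * (1 / ((1 / 4 + t / 2 * Complex.I : ℂ) + j)).re := by
  -- The rate of e^{-u/2} e^{-2ju}; it gives c + it = 2(1/4 + it/2 + j), the denominators of the
  -- digamma series.
  set c : ℝ := 1 / 2 + 2 * j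
  have hc : 0 < c := by positivity
  have hprod : Integrable (Function.uncurry fun (u t : ℝ) => ((Real.exp (-c * u) : ℝ) : ℂ) *
      ((critSq f t : ℂ) * Complex.exp (-(t * u : ℝ) * Complex.I)))
      ((volume.restrict (Ioi 0)).prod volume) := by
    have h1 : Integrable (fun p : ℝ × ℝ => ((Real.exp (-c * p.1) : ℝ) : ℂ) * (critSq f p.2 : ℂ))
        ((volume.restrict (Ioi 0)).prod volume) :=
      (Integrable.ofReal (𝕜 := ℂ) (integrableOn_exp_neg_mul hc)).mul_prod
        (hf.integrable_critSq.ofReal (𝕜 := ℂ))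
    have h2 := h1.mul_bdd (c := 1)
      (g := fun p : ℝ × ℝ => Complex.exp (-(p.2 * p.1 : ℝ) * Complex.I))
      (by fun_prop : Continuous fun p : ℝ × ℝ =>
        Complex.exp (-(p.2 * p.1 : ℝ) * Complex.I)).aestronglyMeasurable
      (ae_of_all _ fun p => (norm_exp_neg_ofReal_mul_I _).le)
    refine h2.congr (ae_of_all _ fun p => ?_)
    simp only [Function.uncurry]
    ring
  have hswap := integral_integral_swap hprod
  have hL : ∀ u : ℝ, ∫ t : ℝ, ((Real.exp (-c * u) : ℝ) : ℂ) *
      ((critSq f t : ℂ) * Complex.exp (-(t * u : ℝ) * Complex.I)) =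
      (2 * Real.pi : ℂ) * (((Real.exp (-c * u) : ℝ) : ℂ) * critFourier f u) := by
    intro u
    have hpi : (Real.pi : ℂ) ≠ 0 := by exact_mod_cast Real.pi_ne_zero
    rw [integral_const_mul, critFourier]
    generalize (∫ t : ℝ, (critSq f t : ℂ) * Complex.exp (-(t * u : ℝ) * Complex.I)) = J
    push_cast
    field_simp
  have hR : ∀ t : ℝ, ∫ u in Ioi (0 : ℝ), ((Real.exp (-c * u) : ℝ) : ℂ) *
      ((critSq f t : ℂ) * Complex.exp (-(t * u : ℝ) * Complex.I)) =
      (critSq f t : ℂ) * (1 / ((1 / 4 + t / 2 * Complex.I : ℂ) + j)) / 2 := by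
    intro t
    have hz : ((1 / 4 + t / 2 * Complex.I : ℂ) + j) ≠ 0 :=
      add_natCast_ne_zero (by rw [quarter_re]; norm_num) j
    have hre : (-((c : ℂ) + t * Complex.I)).re < 0 := by simp [hc]
    have h1 := integral_exp_mul_complex_Ioi hre 0
    have h2 : ∀ u : ℝ, ((Real.exp (-c * u) : ℝ) : ℂ) *
        ((critSq f t : ℂ) * Complex.exp (-(t * u : ℝ) * Complex.I)) =
        (critSq f t : ℂ) * Complex.exp (-((c : ℂ) + t * Complex.I) * u) := by
      intro u
      rw [mul_left_comm, Complex.ofReal_exp, ← Complex.exp_add]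
      congr 2; push_cast; ring
    simp only [h2]
    rw [integral_const_mul, h1]
    have h3 : (c : ℂ) + t * Complex.I = 2 * ((1 / 4 + t / 2 * Complex.I : ℂ) + j) := by
      simp only [c]; push_cast; ring
    rw [h3]
    simp only [Complex.ofReal_zero, mul_zero, Complex.exp_zero]
    field_simp
  simp only [hL, hR] at hswap
  rw [integral_const_mul, integral_div] at hswap
  have hi1 : Integrable (fun u : ℝ => ((Real.exp (-c * u) : ℝ) : ℂ) * critFourier f u)
      (volume.restrict (Ioi 0)) := by
    refine (Integrable.ofReal (𝕜 := ℂ) (integrableOn_exp_neg_mul hc)).mul_bdd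
      (c := 1 / (2 * Real.pi) * ∫ t, critSq f t) hf.continuous_critFourier.aestronglyMeasurable
      (ae_of_all _ (norm_critFourier_le f))
  have hi2 : Integrable fun t : ℝ =>
      (critSq f t : ℂ) * (1 / ((1 / 4 + t / 2 * Complex.I : ℂ) + j)) := by
    have hcont : Continuous fun t : ℝ => 1 / ((1 / 4 + t / 2 * Complex.I : ℂ) + j) :=
      continuous_const.div (by fun_prop) fun t =>
        add_natCast_ne_zero (by rw [quarter_re]; norm_num) j
    have := hf.integrable_critSq_mul (K := 4) (n := 0) hcont.aestronglyMeasurable (fun t => by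
      rw [norm_div, norm_one, pow_zero, mul_one, div_le_iff₀ (norm_pos_iff.2
        (add_natCast_ne_zero (by rw [quarter_re]; norm_num) j))]
      have h1 := (le_abs_self _).trans
        (Complex.abs_re_le_norm ((1 / 4 + t / 2 * Complex.I : ℂ) + j))
      rw [Complex.add_re, quarter_re, Complex.natCast_re] at h1
      have : (0 : ℝ) ≤ j := j.cast_nonneg
      linarith)
    simpa only [Complex.real_smul] using this
  have hre := congrArg Complex.re hswap
  rw [show (2 * Real.pi : ℂ) = ((2 * Real.pi : ℝ) : ℂ) by push_cast; rfl, Complex.re_ofReal_mul,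
    Complex.div_ofNat_re] at hre
  have r1 := integral_re hi1
  have r2 := integral_re hi2
  simp only [RCLike.re_to_complex, Complex.re_ofReal_mul] at r1 r2
  rw [← r1, ← r2] at hre
  have hsym : ∀ u : ℝ, symFourier f u * Real.exp (-2 * u) ^ j =
      2 * (Real.exp (-c * u) * (critFourier f u).re) := by
    intro u
    rw [symFourier, ← Real.exp_nat_mul]
    have : Real.exp (-c * u) = Real.exp (-u / 2) * Real.exp (j * (-2 * u)) := by
      rw [← Real.exp_add]; congr 1; simp only [c]; ring
    rw [this]; ring
  simp only [hsym]
  rw [integral_const_mul]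
  have hpi := Real.pi_pos
  rw [one_div, inv_mul_eq_div, eq_div_iff (by positivity)]
  linarith

lemma integrableOn_exp_sub_exp_div {n : ℕ} (hn : 1 ≤ n) :
    IntegrableOn (fun u : ℝ => u⁻¹ * (Real.exp (-2 * u) - Real.exp (-2 * u) ^ n)) (Ioi 0) := by
  refine ((integrableOn_exp_neg_mul two_pos).const_mul (2 * (n : ℝ))).mono' ?_ ?_
  · exact ContinuousOn.aestronglyMeasurable
      ((continuousOn_inv₀.mono fun u hu => ne_of_gt hu).mul (by fun_prop)) measurableSet_Ioi
  · refine (ae_restrict_iff' measurableSet_Ioi).2 (ae_of_all _ fun u hu => ?_)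
    have hu0 : 0 < u := hu
    have hx0 := Real.exp_pos (-2 * u)
    have hx1 : Real.exp (-2 * u) ≤ 1 := Real.exp_le_one_iff.2 (by linarith)
    obtain ⟨m, rfl⟩ : ∃ m, n = m + 1 := ⟨n - 1, by omega⟩
    have h1 : 1 - Real.exp (-2 * u) ^ m ≤ 2 * m * u := by
      rw [← Real.exp_nat_mul]
      linarith [Real.add_one_le_exp (m * (-2 * u))]
    have h2 : Real.exp (-2 * u) ^ m ≤ 1 := pow_le_one₀ hx0.le hx1
    rw [pow_succ, norm_mul, norm_inv, Real.norm_of_nonneg hu0.le, Real.norm_of_nonneg (by nlinarith),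
      inv_mul_le_iff₀ hu0]
    push_cast
    nlinarith

/-- Frullani's integral for e^{-x} between 2 and 2n; it represents the log n in `digammaSeq`. -/
lemma integral_exp_sub_exp_div {n : ℕ} (hn : 1 ≤ n) :
    ∫ u in Ioi (0 : ℝ), u⁻¹ * (Real.exp (-2 * u) - Real.exp (-2 * u) ^ n) = Real.log n := by
  have hn0 : (0 : ℝ) < n := by exact_mod_cast hn
  have e : ∀ u : ℝ, Real.exp (-(2 * u)) ^ n = Real.exp (-(2 * n * u)) := fun u => by
    rw [← Real.exp_nat_mul]; congr 1; ring
  have h := Frullani.integral_Ioi_eq (f := fun x : ℝ => Real.exp (-x)) (a := 2) (b := 2 * n)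
    (L := 1) (R := 0)
    ((by fun_prop : Continuous fun x : ℝ => Real.exp (-x)).locallyIntegrable.locallyIntegrableOn _)
    two_pos (by positivity)
    (by
      have : Tendsto (fun x : ℝ => Real.exp (-x)) (𝓝 0) (𝓝 (Real.exp (-0))) :=
        (by fun_prop : Continuous fun x : ℝ => Real.exp (-x)).tendsto 0
      rw [neg_zero, Real.exp_zero] at this
      exact this.mono_left inf_le_left)
    (Real.tendsto_exp_neg_atTop_nhds_zero)
    (by
      have := integrableOn_exp_sub_exp_div hn
      simpa only [smul_eq_mul, e, neg_mul] using this)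
  rw [mul_div_cancel_left₀ _ two_ne_zero, sub_zero, smul_eq_mul, mul_one] at h
  rw [← h]
  simp only [smul_eq_mul, e, neg_mul]

/-- Frullani's integral replaces log n and Laplace integrals replace the fractions 1/(z + j).
Summing the geometric progression of e^{-2ju} isolates the kernel, with a remainder carrying the
factor e^{-2nu}. -/
lemma IsTest.integral_critSq_digammaSeq (hf : IsTest f) {n : ℕ} (hn : 1 ≤ n) :
    1 / (2 * Real.pi) * ∫ t, critSq f t * (digammaSeq (1 / 4 + t / 2 * Complex.I) n).re =
      -(∫ u in Ioi (0 : ℝ), archKernel f u) + ∫ u in Ioi (0 : ℝ), Real.exp (-2 * u) ^ n *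
        (archKernel f u - symFourier f u - (critFourier f 0).re * ((1 - Real.exp (-2 * u)) / u)) := by
  set c := (critFourier f 0).re
  have hc : c = 1 / (2 * Real.pi) * ∫ t, critSq f t := by
    simp only [c]; rw [critFourier_zero, Complex.ofReal_re]
  obtain ⟨C, hC0, hC⟩ := exists_abs_symFourier_le f
  have hsi : ∀ j : ℕ, IntegrableOn (fun u => symFourier f u * Real.exp (-2 * u) ^ j) (Ioi 0) := by
    intro j
    refine ((integrableOn_exp_neg_mul (by norm_num : (0 : ℝ) < 1 / 2)).const_mul C).mono'
      (hf.continuous_symFourier.mul (by fun_prop)).aestronglyMeasurable ?_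
    refine (ae_restrict_iff' measurableSet_Ioi).2 (ae_of_all _ fun u hu => ?_)
    have hu0 : 0 < u := hu
    have h1 : Real.exp (-2 * u) ^ j ≤ 1 :=
      pow_le_one₀ (Real.exp_pos _).le (Real.exp_le_one_iff.2 (by linarith))
    have h2 := hC u hu0.le
    rw [norm_mul, norm_pow, Real.norm_of_nonneg (Real.exp_pos (-2 * u)).le, Real.norm_eq_abs]
    calc _ ≤ (C * Real.exp (-u / 2)) * 1 := by gcongr
      _ = _ := by rw [mul_one]; congr 2; ring
  have hti : ∀ j : ℕ, Integrable fun t : ℝ =>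
      critSq f t * (1 / ((1 / 4 + t / 2 * Complex.I : ℂ) + j)).re := by
    intro j
    have hcont : Continuous fun t : ℝ => (1 / ((1 / 4 + t / 2 * Complex.I : ℂ) + j)).re :=
      Complex.continuous_re.comp (continuous_const.div (by fun_prop) fun t =>
        add_natCast_ne_zero (by rw [quarter_re]; norm_num) j)
    have := hf.integrable_critSq_mul (K := 4) (n := 0) hcont.aestronglyMeasurable (fun t => by
      rw [Real.norm_eq_abs]
      refine (Complex.abs_re_le_norm _).trans ?_
      rw [norm_div, norm_one, pow_zero, mul_one, div_le_iff₀ (norm_pos_iff.2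
        (add_natCast_ne_zero (by rw [quarter_re]; norm_num) j))]
      have h1 := (le_abs_self _).trans
        (Complex.abs_re_le_norm ((1 / 4 + t / 2 * Complex.I : ℂ) + j))
      rw [Complex.add_re, quarter_re, Complex.natCast_re] at h1
      have : (0 : ℝ) ≤ j := j.cast_nonneg
      linarith)
    simpa only [smul_eq_mul] using this
  have hleft : 1 / (2 * Real.pi) * ∫ t, critSq f t * (digammaSeq (1 / 4 + t / 2 * Complex.I) n).re =
      c * Real.log n - ∑ j ∈ Finset.range (n + 1),
        ∫ u in Ioi (0 : ℝ), symFourier f u * Real.exp (-2 * u) ^ j := by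
    have e : ∀ t : ℝ, critSq f t * (digammaSeq (1 / 4 + t / 2 * Complex.I) n).re =
        critSq f t * Real.log n - ∑ j ∈ Finset.range (n + 1),
          critSq f t * (1 / ((1 / 4 + t / 2 * Complex.I : ℂ) + j)).re := by
      intro t
      rw [digammaSeq, Complex.sub_re, Complex.ofReal_re, Complex.re_sum, mul_sub, Finset.mul_sum]
    simp only [e]
    rw [integral_sub (hf.integrable_critSq.mul_const _)
      (integrable_finsetSum _ fun j _ => hti j), integral_finsetSum _ fun j _ => hti j,
      integral_mul_const, mul_sub, ← mul_assoc, ← hc, Finset.mul_sum]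
    simp only [hf.integral_symFourier_exp]
  have hi := ((integrableOn_exp_sub_exp_div hn).const_mul c).sub
    (integrable_finsetSum (Finset.range (n + 1)) fun j _ => hsi j)
  have hi' : IntegrableOn (fun u => c * (u⁻¹ * (Real.exp (-2 * u) - Real.exp (-2 * u) ^ n)) -
      ∑ j ∈ Finset.range (n + 1), symFourier f u * Real.exp (-2 * u) ^ j) (Ioi 0) := hi
  rw [hleft, ← integral_exp_sub_exp_div hn, ← integral_const_mul,
    ← integral_finsetSum _ fun j _ => hsi j,
    ← integral_sub ((integrableOn_exp_sub_exp_div hn).const_mul c)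
      (integrable_finsetSum _ fun j _ => hsi j), eq_neg_add_iff_add_eq, add_comm,
    ← integral_add hi' hf.integrableOn_archKernel]
  refine setIntegral_congr_fun measurableSet_Ioi fun u hu => ?_
  have hu0 : 0 < u := hu
  have hE := one_sub_exp_pos hu0
  have hgeom := geom_sum_eq (x := Real.exp (-2 * u)) (by linarith) (n + 1)
  simp only [archKernel]
  rw [← Finset.mul_sum, hgeom]
  have hE' : Real.exp (-2 * u) - 1 ≠ 0 := by linarith
  set x := Real.exp (-2 * u)
  have hE0 := hE.ne'
  rw [pow_succ, show x - 1 = -(1 - x) by ring]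
  field_simp
  ring

/-- The archimedean Weil term as an integral. -/
lemma IsTest.weilTerm_Gammaℝ_eq (hf : IsTest f) : weilTerm Complex.Gammaℝ (autoConv f) =
    (((critFourier f 0).re * Real.log Real.pi + ∫ u in Ioi (0 : ℝ), archKernel f u : ℝ) : ℂ) := by
  rw [weilTerm_Gammaℝ hf]
  congr 1
  set c := (critFourier f 0).re
  have hc : c = 1 / (2 * Real.pi) * ∫ t, critSq f t := by
    simp only [c]; rw [critFourier_zero, Complex.ofReal_re]
  obtain ⟨K, hK0, hK⟩ := norm_digammaSeq_le (by norm_num : (0 : ℝ) < 1 / 4)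
  have hKt : ∀ (n : ℕ) (t : ℝ), ‖(digammaSeq (1 / 4 + t / 2 * Complex.I) n).re‖ ≤
      2 * K * (1 + |t|) ^ 1 := by
    intro n t
    rw [Real.norm_eq_abs, pow_one]
    refine (Complex.abs_re_le_norm _).trans ((hK _ (by rw [quarter_re]) n).trans ?_)
    nlinarith [norm_quarter_le t]
  have hmeas : ∀ n : ℕ, AEStronglyMeasurable
      (fun t : ℝ => (digammaSeq (1 / 4 + t / 2 * Complex.I) n).re) volume := by
    intro n
    refine (Complex.continuous_re.comp ?_).aestronglyMeasurable
    refine continuous_const.sub (continuous_finsetSum _ fun j _ => ?_)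
    exact continuous_const.div (by fun_prop) fun t =>
      add_natCast_ne_zero (by rw [quarter_re]; norm_num) j
  have hlim1 : Tendsto (fun n : ℕ => ∫ t, critSq f t *
      (digammaSeq (1 / 4 + t / 2 * Complex.I) n).re) atTop
      (𝓝 (∫ t, critSq f t * (Complex.digamma (1 / 4 + t / 2 * Complex.I)).re)) := by
    refine tendsto_integral_of_dominated_convergence
      (fun t => critSq f t • (2 * K * (1 + |t|) ^ 1)) (fun n => ?_) ?_ (fun n => ?_) ?_
    · have := (hf.integrable_critSq_mul (hmeas n) (hKt n)).aestronglyMeasurable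
      simpa only [smul_eq_mul] using this
    · exact hf.integrable_critSq_mul (K := 2 * K) (n := 1)
        (by fun_prop : Continuous fun t : ℝ => 2 * K * (1 + |t|) ^ 1).aestronglyMeasurable
        (fun t => by rw [Real.norm_of_nonneg (by positivity)])
    · refine ae_of_all _ fun t => ?_
      rw [norm_mul, Real.norm_of_nonneg (critSq_nonneg _ _), smul_eq_mul]
      exact mul_le_mul_of_nonneg_left (hKt n t) (critSq_nonneg _ _)
    · refine ae_of_all _ fun t => Tendsto.const_mul _ ?_
      exact (Complex.continuous_re.tendsto _).comp
        (tendsto_digammaSeq (by rw [quarter_re]; norm_num))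
  obtain ⟨C₁, hC₁, h1⟩ := hf.exists_abs_archKernel_le
  obtain ⟨C₂, hC₂, h2⟩ := exists_abs_symFourier_le f
  set D := C₁ + C₂ + |c| * 2
  have hD0 : 0 ≤ D := by positivity
  -- The bracket in the remainder is bounded by D on (0, ∞), so the remainder is at most D ∫
  -- e^{-2nu} du.
  have hrem : ∀ n : ℕ, 1 ≤ n → ‖∫ u in Ioi (0 : ℝ), Real.exp (-2 * u) ^ n *
      (archKernel f u - symFourier f u - c * ((1 - Real.exp (-2 * u)) / u))‖ ≤ D * (1 / (2 * n)) := by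
    intro n hn
    have hn0 : (0 : ℝ) < n := by exact_mod_cast hn
    have hi : ∫ u in Ioi (0 : ℝ), D * Real.exp (-(2 * n) * u) = D * (1 / (2 * n)) := by
      rw [integral_const_mul, integral_exp_mul_Ioi (by linarith)]
      simp
    rw [← hi]
    refine norm_integral_le_of_norm_le
      ((integrableOn_exp_neg_mul (by positivity : (0 : ℝ) < 2 * n)).const_mul D) ?_
    refine (ae_restrict_iff' measurableSet_Ioi).2 (ae_of_all _ fun u hu => ?_)
    have hu0 : 0 < u := hu
    have k0 : Real.exp (-2 * u) ^ n = Real.exp (-(2 * n) * u) := by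
      rw [← Real.exp_nat_mul]; congr 1; ring
    have k1 : |archKernel f u| ≤ C₁ := (h1 u hu0).trans
      (mul_le_of_le_one_right hC₁ (Real.exp_le_one_iff.2 (by linarith)))
    have k2 : |symFourier f u| ≤ C₂ := (h2 u hu0.le).trans
      (mul_le_of_le_one_right hC₂ (Real.exp_le_one_iff.2 (by linarith)))
    have k3 : |c * ((1 - Real.exp (-2 * u)) / u)| ≤ |c| * 2 := by
      rw [abs_mul]
      refine mul_le_mul_of_nonneg_left ?_ (abs_nonneg _)
      rw [abs_of_pos (div_pos (one_sub_exp_pos hu0) hu0), div_le_iff₀ hu0]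
      exact (one_sub_exp_bounds hu0).2
    rw [k0, norm_mul, Real.norm_of_nonneg (Real.exp_pos _).le, mul_comm]
    refine mul_le_mul_of_nonneg_right ?_ (Real.exp_pos _).le
    rw [Real.norm_eq_abs]
    exact (abs_sub _ _).trans (add_le_add ((abs_sub _ _).trans (add_le_add k1 k2)) k3)
  have hlim2 : Tendsto (fun n : ℕ => ∫ u in Ioi (0 : ℝ), Real.exp (-2 * u) ^ n *
      (archKernel f u - symFourier f u - c * ((1 - Real.exp (-2 * u)) / u))) atTop (𝓝 0) := by
    refine squeeze_zero_norm' (a := fun n : ℕ => D / 2 * (1 / (n : ℝ))) ?_ ?_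
    · filter_upwards [eventually_ge_atTop 1] with n hn
      refine (hrem n hn).trans (le_of_eq ?_)
      have hn0 : (0 : ℝ) < n := by exact_mod_cast hn
      field_simp
    · simpa using tendsto_one_div_atTop_nhds_zero_nat.const_mul (D / 2)
  have hlim3 : Tendsto (fun n : ℕ => 1 / (2 * Real.pi) * ∫ t, critSq f t *
      (digammaSeq (1 / 4 + t / 2 * Complex.I) n).re) atTop
      (𝓝 (-(∫ u in Ioi (0 : ℝ), archKernel f u) + 0)) := by
    refine (tendsto_const_nhds.add hlim2).congr' ?_
    filter_upwards [eventually_ge_atTop 1] with n hn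
    exact (hf.integral_critSq_digammaSeq hn).symm
  have huniq := tendsto_nhds_unique (hlim1.const_mul (1 / (2 * Real.pi))) hlim3
  have hdi : Integrable fun t => critSq f t * (Complex.digamma (1 / 4 + t / 2 * Complex.I)).re := by
    obtain ⟨K', hK'0, hK'⟩ := exists_abs_archWeight_le
    have h3 := hf.integrable_critSq_mul (K := K') (n := 1)
      continuous_archWeight.aestronglyMeasurable (fun t => by rw [pow_one]; exact hK' t)
    refine ((hf.integrable_critSq.mul_const (Real.log Real.pi)).sub h3).congr
      (ae_of_all _ fun t => ?_)
    simp only [Pi.sub_apply, smul_eq_mul, archWeight]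
    ring
  have e : ∀ t, critSq f t * archWeight t = critSq f t * Real.log Real.pi -
      critSq f t * (Complex.digamma (1 / 4 + t / 2 * Complex.I)).re := fun t => by
    rw [archWeight]; ring
  simp only [e]
  rw [integral_sub (hf.integrable_critSq.mul_const _) hdi, integral_mul_const, mul_sub, huniq,
    ← mul_assoc, ← hc]
  ring

end

/-! ### Riemann sums on a half-line -/

/-- The Riemann sum is the integral of a step function sampling F at the right end of each cell.
Right ends avoid the point 0 and lie beyond u, so the bound C e^{-u} survives with the same C; it is
the majorant for the limit h → 0. -/
lemma mul_tsum_eq_integral_ceil {F : ℝ → ℝ} {C : ℝ}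
    (hC : ∀ u, 0 < u → |F u| ≤ C * Real.exp (-u)) {h : ℝ} (hh : 0 < h) :
    IntegrableOn (fun u => F (h * ⌈u / h⌉₊)) (Ioi 0) ∧
    HasSum (fun k : ℕ => h * F (h * (k + 1))) (∫ u in Ioi 0, F (h * ⌈u / h⌉₊)) := by
  have hcell : ∀ (k : ℕ), ∀ u ∈ Ioc (h * k) (h * (k + 1)), F (h * ⌈u / h⌉₊) = F (h * (k + 1)) := by
    intro k u hu
    have h1 : ⌈u / h⌉₊ = k + 1 := by
      rw [Nat.ceil_eq_iff (Nat.succ_ne_zero k)]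
      constructor
      · rw [lt_div_iff₀ hh, mul_comm]; simpa using hu.1
      · rw [div_le_iff₀ hh, mul_comm]; simpa using hu.2
    rw [h1]; push_cast; rfl
  have hunion : ⋃ k : ℕ, Ioc (h * k) (h * ((k : ℝ) + 1)) = Ioi (0 : ℝ) := by
    ext u
    simp only [mem_iUnion, mem_Ioc, mem_Ioi]
    constructor
    · rintro ⟨k, h1, -⟩
      exact lt_of_le_of_lt (by positivity) h1
    · intro hu
      have hc : 0 < ⌈u / h⌉₊ := Nat.ceil_pos.2 (div_pos hu hh)
      refine ⟨⌈u / h⌉₊ - 1, ?_⟩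
      have h2 := (Nat.ceil_eq_iff hc.ne').1 rfl
      rw [lt_div_iff₀ hh, div_le_iff₀ hh] at h2
      have h3 : ((⌈u / h⌉₊ - 1 : ℕ) : ℝ) + 1 = (⌈u / h⌉₊ : ℝ) := by
        rw [← Nat.cast_add_one, Nat.sub_add_cancel hc]
      rw [h3]
      exact ⟨by linarith [h2.1], by linarith [h2.2]⟩
  have hdisj : Pairwise (Function.onFun Disjoint fun k : ℕ => Ioc (h * k) (h * ((k : ℝ) + 1))) := by
    intro i j hij
    refine disjoint_left.2 fun u hi hj => hij ?_
    have a1 := hi.1.trans_le hj.2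
    have a2 := hj.1.trans_le hi.2
    have b1 : (i : ℝ) < j + 1 := lt_of_mul_lt_mul_left a1 hh.le
    have b2 : (j : ℝ) < i + 1 := lt_of_mul_lt_mul_left a2 hh.le
    have c1 : i < j + 1 := by exact_mod_cast b1
    have c2 : j < i + 1 := by exact_mod_cast b2
    omega
  have hmeas : Measurable fun u : ℝ => F (h * ⌈u / h⌉₊) := by
    have h1 : Measurable fun n : ℕ => F (h * n) := measurable_from_top
    exact h1.comp (Nat.measurable_ceil.comp (measurable_id.div_const h))
  have hint : IntegrableOn (fun u => F (h * ⌈u / h⌉₊)) (Ioi 0) := by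
    refine ((integrableOn_exp_neg_mul one_pos).const_mul C).mono' hmeas.aestronglyMeasurable ?_
    refine (ae_restrict_iff' measurableSet_Ioi).2 (ae_of_all _ fun u hu => ?_)
    have hu0 : 0 < u := hu
    have hC0 : 0 ≤ C := by
      have := (abs_nonneg _).trans (hC 1 one_pos)
      exact nonneg_of_mul_nonneg_left this (Real.exp_pos _)
    have hle : u ≤ h * ⌈u / h⌉₊ := by
      have := Nat.le_ceil (u / h)
      rwa [div_le_iff₀ hh, mul_comm] at this
    refine (hC _ (hu0.trans_le hle)).trans ?_
    gcongr
    linarith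
  refine ⟨hint, ?_⟩
  have hs := hasSum_integral_iUnion (f := fun u => F (h * ⌈u / h⌉₊)) (μ := volume)
    (fun k : ℕ => (measurableSet_Ioc : MeasurableSet (Ioc (h * k) (h * ((k : ℝ) + 1))))) hdisj
    (by rw [hunion]; exact hint)
  rw [hunion] at hs
  refine hs.congr_fun fun k => ?_
  rw [setIntegral_congr_fun measurableSet_Ioc (hcell k), setIntegral_const, Real.volume_real_Ioc_of_le
    (by nlinarith), smul_eq_mul]
  ring

lemma tendsto_riemannSum {F : ℝ → ℝ} {C : ℝ} (hF : ContinuousOn F (Ioi 0))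
    (hC : ∀ u, 0 < u → |F u| ≤ C * Real.exp (-u)) :
    Tendsto (fun h : ℝ => h * ∑' k : ℕ, F (h * (k + 1))) (𝓝[>] 0) (𝓝 (∫ u in Ioi 0, F u)) := by
  have hC0 : 0 ≤ C := by
    have := (abs_nonneg _).trans (hC 1 one_pos)
    exact nonneg_of_mul_nonneg_left this (Real.exp_pos _)
  have hpos : ∀ᶠ h : ℝ in 𝓝[>] 0, 0 < h := self_mem_nhdsWithin
  have hle : ∀ h : ℝ, 0 < h → ∀ u : ℝ, u ≤ h * ⌈u / h⌉₊ := fun h hh u => by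
    have := Nat.le_ceil (u / h)
    rwa [div_le_iff₀ hh, mul_comm] at this
  have hlim : Tendsto (fun h : ℝ => ∫ u in Ioi (0 : ℝ), F (h * ⌈u / h⌉₊)) (𝓝[>] 0)
      (𝓝 (∫ u in Ioi 0, F u)) := by
    refine tendsto_integral_filter_of_dominated_convergence (fun u => C * Real.exp (-1 * u)) ?_ ?_
      ((integrableOn_exp_neg_mul one_pos).const_mul C) ?_
    · filter_upwards [hpos] with h hh
      exact (mul_tsum_eq_integral_ceil hC hh).1.aestronglyMeasurable
    · filter_upwards [hpos] with h hh
      refine (ae_restrict_iff' measurableSet_Ioi).2 (ae_of_all _ fun u hu => ?_)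
      have hu0 : 0 < u := hu
      refine (hC _ (hu0.trans_le (hle h hh u))).trans ?_
      gcongr
      linarith [hle h hh u]
    · refine (ae_restrict_iff' measurableSet_Ioi).2 (ae_of_all _ fun u hu => ?_)
      have hu0 : 0 < u := hu
      have hc : ContinuousAt F u := hF.continuousAt (Ioi_mem_nhds hu0)
      refine hc.tendsto.comp ?_
      have hup : Tendsto (fun h : ℝ => u + h) (𝓝[>] 0) (𝓝 u) := by
        have : Tendsto (fun h : ℝ => u + h) (𝓝 0) (𝓝 (u + 0)) :=
          (continuous_const_add u).tendsto 0
        rw [add_zero] at this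
        exact this.mono_left inf_le_left
      refine tendsto_of_tendsto_of_tendsto_of_le_of_le' tendsto_const_nhds hup ?_ ?_
      · filter_upwards [hpos] with h hh using hle h hh u
      · filter_upwards [hpos] with h hh
        have := Nat.ceil_lt_add_one (div_pos hu0 hh).le
        have h2 := mul_lt_mul_of_pos_left this hh
        have h3 : h * (u / h + 1) = u + h := by field_simp
        linarith
  refine hlim.congr' ?_
  filter_upwards [hpos] with h hh
  have := (mul_tsum_eq_integral_ceil hC hh).2
  rw [← this.tsum_eq, tsum_mul_left]

/-! ### Integration on the Bohr compactification -/

namespace Bohr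

instance : Measure.IsMulLeftInvariant haar :=
  inferInstanceAs (Measure.IsMulLeftInvariant (Measure.haarMeasure ⊤))

lemma T_apply (k : ℝ) (χ : Bohr) : T k χ = ((χ.1 k : Circle) : ℂ) := rfl

lemma T_add (k l : ℝ) : T (k + l) = T k * T l := by
  ext χ
  rw [ContinuousMap.mul_apply, T_apply, T_apply, T_apply, χ.2 k l, Circle.coe_mul]

lemma T_zero : T 0 = 1 := by
  ext χ
  have h := χ.2 0 0
  rw [add_zero] at h
  rw [T_apply, left_eq_mul.1 h]
  rfl

lemma star_T (k : ℝ) : star (T k) = T (-k) := by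
  ext χ
  have h := χ.2 k (-k)
  have h0 := χ.2 0 0
  rw [add_zero] at h0
  rw [add_neg_cancel, left_eq_mul.1 h0] at h
  rw [ContinuousMap.star_apply, T_apply, T_apply, eq_inv_of_mul_eq_one_right h.symm,
    Circle.coe_inv_eq_conj]
  rfl

lemma norm_T_le (k : ℝ) : ‖T k‖ ≤ 1 :=
  (ContinuousMap.norm_le _ zero_le_one).2 fun χ => by rw [T_apply, Circle.norm_coe]

/-- The character `x ↦ exp(i a x)` as a point of the Bohr compactification. -/
def ofReal (a : ℝ) : Bohr :=
  ⟨fun x => Circle.exp (a * x), fun k l => by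
    change Circle.exp (a * (k + l)) = Circle.exp (a * k) * Circle.exp (a * l)
    rw [mul_add, Circle.exp_add]⟩

lemma continuousMap_integrable (h : C(Bohr, ℂ)) : Integrable h haar :=
  h.continuous.integrable_of_hasCompactSupport (HasCompactSupport.of_compactSpace _)

/-- The expectation as a continuous linear functional on continuous functions. -/
def expectL : C(Bohr, ℂ) →L[ℂ] ℂ :=
  LinearMap.mkContinuous
    { toFun := fun h => ∫ χ, h χ ∂haar
      map_add' := fun h₁ h₂ =>
        integral_add (continuousMap_integrable h₁) (continuousMap_integrable h₂)
      map_smul' := fun c h => integral_const_mul c _ } 1 fun h => by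
    have := norm_integral_le_of_norm_le_const (μ := haar) (C := ‖h‖)
      (ae_of_all _ fun χ => h.norm_coe_le_norm χ)
    simpa using this

lemma expectL_apply (h : C(Bohr, ℂ)) : expectL h = ∫ χ, h χ ∂haar := rfl

open Classical in
-- Translation by the character x ↦ e^{iπx/k} changes the sign of T_k, so its translation-invariant
-- mean is zero.
lemma expectL_T (k : ℝ) : expectL (T k) = if k = 0 then 1 else 0 := by
  split_ifs with hk
  · rw [hk, T_zero, expectL_apply]
    simp
  · have h := integral_mul_left_eq_self (μ := haar) (fun χ => T k χ) (ofReal (Real.pi / k))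
    have h1 : ∀ χ, T k (ofReal (Real.pi / k) * χ) = -T k χ := by
      intro χ
      have e : T k (ofReal (Real.pi / k) * χ) =
          ((Circle.exp (Real.pi / k * k) : Circle) : ℂ) * T k χ := rfl
      rw [e, div_mul_cancel₀ _ hk, Circle.coe_exp, Complex.exp_pi_mul_I, neg_one_mul]
    simp only [h1, integral_neg] at h
    rw [expectL_apply]
    exact self_eq_neg.1 h.symm

/-- The Fourier coefficients of a continuous function. -/
def coeffL (m : ℝ) : C(Bohr, ℂ) →L[ℂ] ℂ := expectL.comp (ContinuousLinearMap.mul ℂ C(Bohr, ℂ) (T m))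

lemma coeffL_apply (m : ℝ) (S : C(Bohr, ℂ)) : coeffL m S = expectL (T m * S) := rfl

open Classical in
-- The pairing involves no conjugation, so `coeffL m` selects the frequency -m.
lemma coeffL_T (m l : ℝ) : coeffL m (T l) = if m + l = 0 then 1 else 0 := by
  rw [coeffL_apply, ← T_add, expectL_T]

lemma hasSum_expectL_mul {ι : Type*} {c : ι → ℂ} {w : ι → ℝ} {X : C(Bohr, ℂ)}
    (h : HasSum (fun k => c k • T (w k)) X) (S : C(Bohr, ℂ)) :
    HasSum (fun k => c k * coeffL (w k) S) (expectL (X * S)) := by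
  have h1 := (h.mul_right S).mapL expectL
  refine h1.congr_fun fun k => ?_
  rw [smul_mul_assoc, map_smul, smul_eq_mul, coeffL_apply]

end Bohr

open Bohr

/-! ### The random variables -/

/-- The Fourier coefficients of `archSymbol`. -/
def archCoeff (q : ℝ) (k : ℤ) : ℂ := if k = 0 then (0 : ℂ) else
  ((Real.log q⁻¹ * (q ^ (|(k : ℝ)| / 2) / (1 - q ^ (2 * |(k : ℝ)|))) : ℝ) : ℂ)

/-- The constant term of `archSymbol`. -/
def archConst (q : ℝ) : ℝ := Real.log Real.pi + Real.log (1 - q ^ 2)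

/-- The coefficients of `primeLogDeriv`. -/
def primeCoeff (p k : ℕ) : ℂ := ((ArithmeticFunction.vonMangoldt (p ^ (k + 1)) *
      (p : ℝ) ^ (-((k : ℝ) + 1) / 2) : ℝ) : ℂ)

lemma summable_smul_T {ι : Type*} {c : ι → ℂ} (w : ι → ℝ) (hc : Summable fun k => ‖c k‖) :
    Summable fun k => c k • T (w k) := by
  refine Summable.of_norm_bounded hc fun k => ?_
  rw [norm_smul]
  exact mul_le_of_le_one_right (norm_nonneg _) (norm_T_le _)

lemma archCoeff_neg (q : ℝ) (k : ℤ) : archCoeff q (-k) = archCoeff q k := by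
  simp [archCoeff]

lemma archCoeff_natCast_succ {q : ℝ} (hq : 0 < q) (n : ℕ) :
    archCoeff q ((n : ℤ) + 1) = ((-Real.log q * (Real.exp (-(-Real.log q * (n + 1)) / 2) /
      (1 - Real.exp (-2 * (-Real.log q * (n + 1))))) : ℝ) : ℂ) := by
  have h0 : ((n : ℤ) + 1) ≠ 0 := by omega
  have h1 : |(((n : ℤ) + 1 : ℤ) : ℝ)| = (n : ℝ) + 1 := by
    push_cast
    exact abs_of_pos (by positivity)
  rw [archCoeff, if_neg h0, h1, Real.log_inv, Real.rpow_def_of_pos hq, Real.rpow_def_of_pos hq]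
  ring_nf

lemma summable_norm_archCoeff {q : ℝ} (hq : 0 < q) (hq1 : q < 1) :
    Summable fun k => ‖archCoeff q k‖ := by
  have hlog : 0 < -Real.log q := neg_pos.2 (Real.log_neg hq hq1)
  set h := -Real.log q
  have key : Summable fun n : ℕ => ‖archCoeff q ((n : ℤ) + 1)‖ := by
    have hgeo : Summable fun n : ℕ => h / (1 - Real.exp (-2 * h)) * Real.exp (-h / 2) ^ n :=
      (summable_geometric_of_lt_one (Real.exp_pos _).le
        (Real.exp_lt_one_iff.2 (by linarith))).mul_left _
    refine Summable.of_nonneg_of_le (fun n => norm_nonneg _) (fun n => ?_) hgeo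
    rw [archCoeff_natCast_succ hq, Complex.norm_real]
    have hn : (0 : ℝ) ≤ n := n.cast_nonneg
    have hpos := one_sub_exp_pos (mul_pos hlog (by positivity : (0 : ℝ) < n + 1))
    have hpos1 := one_sub_exp_pos hlog
    rw [Real.norm_of_nonneg (mul_nonneg hlog.le (div_nonneg (Real.exp_pos _).le hpos.le)),
      div_mul_eq_mul_div, mul_div_assoc', ← Real.exp_nat_mul]
    have e1 : Real.exp (-2 * (h * (n + 1))) ≤ Real.exp (-2 * h) := by
      rw [Real.exp_le_exp]; nlinarith
    have e2 : Real.exp (-(h * (n + 1)) / 2) ≤ Real.exp (n * (-h / 2)) := by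
      rw [Real.exp_le_exp]; nlinarith
    gcongr
  have key' : Summable fun n : ℕ => ‖archCoeff q (n : ℤ)‖ := by
    rw [← summable_nat_add_iff 1]
    simpa using key
  refine Summable.of_nat_of_neg key' ?_
  simpa only [archCoeff_neg] using key'

lemma hasSum_archSymbol {q : ℝ} (hq : 0 < q) (hq1 : q < 1) :
    HasSum (fun k : ℤ => archCoeff q k • T (k * Real.log q))
      (archSymbol q - (archConst q : ℂ) • 1) := by
  have h : archSymbol q - (archConst q : ℂ) • 1 =
      ∑' k : ℤ, archCoeff q k • T (k * Real.log q) := add_sub_cancel_left _ _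
  rw [h]
  exact (summable_smul_T _ (summable_norm_archCoeff hq hq1)).hasSum

open Classical in
lemma hasSum_coeffL_archSymbol {q : ℝ} (hq : 0 < q) (hq1 : q < 1) (m : ℝ) :
    HasSum (fun k : ℤ => archCoeff q k * if m + k * Real.log q = 0 then 1 else 0)
      (coeffL m (archSymbol q) - if m = 0 then (archConst q : ℂ) else 0) := by
  have h := (hasSum_archSymbol hq hq1).mapL (coeffL m)
  rw [map_sub, map_smul, ← T_zero, coeffL_T, add_zero, smul_eq_mul, mul_ite, mul_one, mul_zero] at h
  refine h.congr_fun fun k => ?_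
  rw [map_smul, coeffL_T, smul_eq_mul]

lemma coeffL_archSymbol_int {q : ℝ} (hq : 0 < q) (hq1 : q < 1) (j : ℤ) :
    coeffL (j * Real.log q) (archSymbol q) =
      archCoeff q j + if j = 0 then (archConst q : ℂ) else 0 := by
  classical
  have hlog : Real.log q ≠ 0 := (Real.log_neg hq hq1).ne
  have h := hasSum_coeffL_archSymbol hq hq1 (j * Real.log q)
  have h1 := hasSum_single (f := fun k : ℤ => archCoeff q k *
    if (j : ℝ) * Real.log q + k * Real.log q = 0 then 1 else 0) (-j) fun k hk => by
      rw [if_neg, mul_zero]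
      intro h0
      rw [← add_mul, mul_eq_zero, or_iff_left hlog] at h0
      have h2 : j + k = 0 := by exact_mod_cast h0
      omega
  have h2 := h.unique h1
  have e : (j : ℝ) * Real.log q + ((-j : ℤ) : ℝ) * Real.log q = 0 := by push_cast; ring
  rw [if_pos e, mul_one, archCoeff_neg] at h2
  have h3 : ((j : ℝ) * Real.log q = 0) ↔ j = 0 := by simp [hlog]
  simp only [h3] at h2
  rw [← h2]; ring

lemma coeffL_archSymbol_eq_zero {q : ℝ} (hq : 0 < q) (hq1 : q < 1) {m : ℝ}
    (hm : ∀ k : ℤ, m + k * Real.log q ≠ 0) : coeffL m (archSymbol q) = 0 := by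
  classical
  have h := hasSum_coeffL_archSymbol hq hq1 m
  simp only [hm, if_false, mul_zero] at h
  have h0 : m ≠ 0 := by simpa using hm 0
  rw [if_neg h0, sub_zero] at h
  exact h.unique hasSum_zero

lemma primeCoeff_eq {p : ℕ} (hp : p.Prime) (k : ℕ) :
    primeCoeff p k = ((Real.log p * (p : ℝ) ^ (-((k : ℝ) + 1) / 2) : ℝ) : ℂ) := by
  rw [primeCoeff, ArithmeticFunction.vonMangoldt_apply_pow (Nat.succ_ne_zero k),
    ArithmeticFunction.vonMangoldt_apply_prime hp]

lemma summable_norm_primeCoeff {p : ℕ} (hp : p.Prime) : Summable fun k => ‖primeCoeff p k‖ := by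
  have hp1 : (1 : ℝ) < p := by exact_mod_cast hp.one_lt
  have hp0 : (0 : ℝ) < p := by linarith
  have hr1 : (p : ℝ) ^ (-(1 / 2) : ℝ) < 1 := Real.rpow_lt_one_of_one_lt_of_neg hp1 (by norm_num)
  have hgeo := (summable_geometric_of_lt_one (Real.rpow_nonneg hp0.le _) hr1).mul_left
    (Real.log p * (p : ℝ) ^ (-(1 / 2) : ℝ))
  refine hgeo.congr fun k => ?_
  rw [primeCoeff_eq hp, Complex.norm_real, Real.norm_of_nonneg
    (mul_nonneg (Real.log_nonneg hp1.le) (Real.rpow_nonneg hp0.le _)), mul_assoc, ← pow_succ',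
    ← Real.rpow_natCast, ← Real.rpow_mul hp0.le]
  push_cast
  ring_nf

lemma hasSum_primeLogDeriv {p : ℕ} (hp : p.Prime) :
    HasSum (fun k : ℕ => primeCoeff p k • T (-((k : ℝ) + 1) * Real.log p)) (primeLogDeriv p) :=
  (summable_smul_T _ (summable_norm_primeCoeff hp)).hasSum

open Classical in
lemma hasSum_coeffL_primeLogDeriv {p : ℕ} (hp : p.Prime) (m : ℝ) :
    HasSum (fun k : ℕ => primeCoeff p k * ((if m - (k + 1) * Real.log p = 0 then 1 else 0) +
        if m + (k + 1) * Real.log p = 0 then 1 else 0))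
      (coeffL m (primeLogDeriv p + star (primeLogDeriv p))) := by
  have h1 := hasSum_primeLogDeriv hp
  have h := (h1.add h1.star).mapL (coeffL m)
  refine h.congr_fun fun k => ?_
  have hreal : (starRingEnd ℂ) (primeCoeff p k) = primeCoeff p k := by
    rw [primeCoeff]; exact Complex.conj_ofReal _
  rw [star_smul, star_T, map_add, map_smul, map_smul, coeffL_T, coeffL_T, smul_eq_mul, smul_eq_mul,
    neg_mul, neg_neg, ← sub_eq_add_neg, mul_add]
  congr 2
  exact hreal.symm

lemma coeffL_primeLogDeriv_eq_zero {p : ℕ} (hp : p.Prime) {m : ℝ}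
    (hm : ∀ k : ℤ, k ≠ 0 → m + k * Real.log p ≠ 0) :
    coeffL m (primeLogDeriv p + star (primeLogDeriv p)) = 0 := by
  classical
  have h := hasSum_coeffL_primeLogDeriv hp m
  have h1 : ∀ k : ℕ, m - (k + 1) * Real.log p ≠ 0 := fun k => by
    have := hm (-((k : ℤ) + 1)) (by omega)
    push_cast at this
    intro h0
    apply this
    linarith
  have h2 : ∀ k : ℕ, m + (k + 1) * Real.log p ≠ 0 := fun k => by
    have := hm ((k : ℤ) + 1) (by omega)
    push_cast at this
    exact this
  simp only [h1, h2, if_false, add_zero, mul_zero] at h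
  exact h.unique hasSum_zero

lemma coeffL_primeLogDeriv_of_abs {p : ℕ} (hp : p.Prime) {m : ℝ} (n : ℕ)
    (hm : m = (n + 1) * Real.log p ∨ m = -((n + 1) * Real.log p)) :
    coeffL m (primeLogDeriv p + star (primeLogDeriv p)) = primeCoeff p n := by
  classical
  have hlog : 0 < Real.log p := Real.log_pos (by exact_mod_cast hp.one_lt)
  have h := hasSum_coeffL_primeLogDeriv hp m
  have hs := hasSum_single (f := fun k : ℕ => primeCoeff p k *
    ((if m - (k + 1) * Real.log p = 0 then 1 else 0) +
        if m + (k + 1) * Real.log p = 0 then 1 else 0)) n fun k hk => by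
      have hk' : ((k : ℝ) + 1) * Real.log p ≠ (n + 1) * Real.log p := by
        intro h0
        have := mul_right_cancel₀ hlog.ne' h0
        exact hk (by exact_mod_cast add_right_cancel this)
      have hkp : 0 < ((k : ℝ) + 1) * Real.log p := by positivity
      have hnp : 0 < ((n : ℝ) + 1) * Real.log p := by positivity
      rcases hm with rfl | rfl
      · rw [if_neg (fun h0 => hk' (by linarith)), if_neg (fun h0 => by linarith)]; simp
      · rw [if_neg (fun h0 => by linarith), if_neg (fun h0 => hk' (by linarith))]; simp
  have hnp : 0 < ((n : ℝ) + 1) * Real.log p := by positivity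
  rw [h.unique hs]
  rcases hm with rfl | rfl
  · rw [if_pos (sub_self _), if_neg (by linarith)]; simp
  · rw [if_neg (by linarith), if_pos (by ring)]; simp

/-- Independence of the logarithms of an admissible `q` and a prime. -/
lemma int_mul_log_ne_zero {I : Finset Nat.Primes} {q : ℝ} (hq : q ∈ admissible I)
    {p : Nat.Primes} (hp : p ∈ I) {j k : ℤ} (hjk : j ≠ 0 ∨ k ≠ 0) :
    j * Real.log q + k * Real.log ((p : ℕ) : ℝ) ≠ 0 := by
  intro h
  have hlogp : Real.log ((p : ℕ) : ℝ) ≠ 0 :=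
    (Real.log_pos (by exact_mod_cast p.2.one_lt)).ne'
  rcases eq_or_ne j 0 with rfl | hj
  · rcases hjk with h0 | h0
    · exact h0 rfl
    · simp [h0] at h
      exact hlogp (by simpa using h)
  · have hj' : (j : ℝ) ≠ 0 := by exact_mod_cast hj
    refine (irrational_iff_ne_rational _).1 (hq.2.2 p hp) (-k) j hj ?_
    rw [div_eq_div_iff hlogp hj']
    push_cast
    linarith

/-- Unique factorisation: a relation would equate a positive power of p with a power of p'. -/
lemma int_mul_log_prime_ne_zero {p p' : ℕ} (hp : p.Prime) (hp' : p'.Prime) (hne : p ≠ p') {j k : ℤ}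
    (hj : j ≠ 0) : j * Real.log p + k * Real.log p' ≠ 0 := by
  intro h
  have hp0 : (p : ℝ) ≠ 0 := by exact_mod_cast hp.ne_zero
  have hp0' : (p' : ℝ) ≠ 0 := by exact_mod_cast hp'.ne_zero
  have h1 : Real.log ((p : ℝ) ^ j.natAbs) = Real.log ((p' : ℝ) ^ k.natAbs) := by
    rw [Real.log_pow, Real.log_pow, Nat.cast_natAbs, Nat.cast_natAbs, Int.cast_abs, Int.cast_abs]
    have l1 : 0 ≤ Real.log p := Real.log_natCast_nonneg p
    have l2 : 0 ≤ Real.log p' := Real.log_natCast_nonneg p'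
    have h0 := congrArg abs (eq_neg_of_add_eq_zero_left h)
    rwa [abs_neg, abs_mul, abs_mul, abs_of_nonneg l1, abs_of_nonneg l2] at h0
  have h2 : (p : ℝ) ^ j.natAbs = (p' : ℝ) ^ k.natAbs :=
    Real.log_injOn_pos (mem_Ioi.2 (pow_pos (by exact_mod_cast hp.pos) _))
      (mem_Ioi.2 (pow_pos (by exact_mod_cast hp'.pos) _)) h1
  have h3 : p ^ j.natAbs = p' ^ k.natAbs := by exact_mod_cast h2
  have h4 : p ∣ p' ^ k.natAbs := h3 ▸ dvd_pow_self p (Int.natAbs_ne_zero.2 hj)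
  exact hne ((Nat.prime_dvd_prime_iff_eq hp hp').1 (hp.dvd_of_dvd_pow h4))

/-! ### Pairing of frequencies: expectations and covariances -/

section

variable {f : ℝ → ℂ}

lemma SuppIn.exists_zpow_eq_zero {α β : ℝ} (hα : 0 < α) {g : ℝ → ℂ} (h : SuppIn α β g) {r : ℝ}
    (hr : 0 < r) (hr1 : r ≠ 1) : ∃ K : ℤ, ∀ k : ℤ, k ∉ Finset.Icc (-K) K → g (r ^ k) = 0 := by
  have hlog : 0 < |Real.log r| := abs_pos.2 (Real.log_ne_zero_of_pos_of_ne_one hr hr1)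
  obtain ⟨K, hK⟩ := exists_nat_gt ((|Real.log α| + |Real.log β|) / |Real.log r|)
  rw [div_lt_iff₀ hlog] at hK
  refine ⟨K, fun k hk => h _ fun hmem => hk ?_⟩
  have hpos : 0 < r ^ k := zpow_pos hr k
  have h1 := Real.log_le_log hα hmem.1
  have h2 := Real.log_le_log hpos hmem.2
  rw [Real.log_zpow] at h1 h2
  have h3 : |(k : ℝ)| * |Real.log r| ≤ |Real.log α| + |Real.log β| := by
    rw [← abs_mul, abs_le]
    constructor
    · linarith [neg_abs_le (Real.log α), abs_nonneg (Real.log β)]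
    · linarith [le_abs_self (Real.log β), abs_nonneg (Real.log α)]
  have h4 : |(k : ℝ)| < K := lt_of_mul_lt_mul_right (h3.trans_lt hK) hlog.le
  have h5 : |k| < (K : ℤ) := by exact_mod_cast h4
  rw [Finset.mem_Icc]
  exact abs_le.1 h5.le

/-- The weight r^{k/2} cancels the x^{-1/2} in g(x) = x^{-1/2} φ(log x), so the coefficients of the
random variables are samples of φ. -/
lemma IsTest.autoConv_zpow (hf : IsTest f) {r : ℝ} (hr : 0 < r) (k : ℤ) :
    autoConv f (r ^ k) * ((r ^ ((k : ℝ) / 2) : ℝ) : ℂ) = critFourier f (k * Real.log r) := by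
  have h0 : (r ^ k : ℝ) ^ (-(1 / 2) : ℝ) * r ^ ((k : ℝ) / 2) = 1 := by
    rw [← Real.rpow_intCast, ← Real.rpow_mul hr.le, ← Real.rpow_add hr]
    ring_nf
    exact Real.rpow_zero r
  rw [hf.autoConv_eq (zpow_pos hr k), Real.log_zpow, mul_right_comm, ← Complex.ofReal_mul, h0,
    Complex.ofReal_one, one_mul]

lemma IsTest.hasSum_latticeMellin (hf : IsTest f) {r : ℝ} (hr : 0 < r) (hr1 : r ≠ 1) :
    HasSum (fun k : ℤ => critFourier f (k * Real.log r) • T (k * Real.log r))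
      (latticeMellin r (autoConv f)) := by
  obtain ⟨a, b, ha, hab, h⟩ := hf.exists_suppIn
  obtain ⟨K, hK⟩ := (h.autoConv ha hab).exists_zpow_eq_zero (div_pos ha (ha.trans_le hab)) hr hr1
  have hs : Summable fun k : ℤ =>
      (autoConv f (r ^ k) * ((r ^ ((k : ℝ) / 2) : ℝ) : ℂ)) • T (k * Real.log r) :=
    summable_of_ne_finset_zero (s := Finset.Icc (-K) K) fun k hk => by
      rw [hK k hk, zero_mul, zero_smul]
  have := hs.hasSum
  simp only [hf.autoConv_zpow hr] at this
  rw [latticeMellin]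
  simp only [hf.autoConv_zpow hr]
  exact this

lemma hasSum_nat_of_hasSum_int {F : ℤ → ℂ} {a : ℂ} (h : HasSum F a) :
    HasSum (fun n : ℕ => F ((n : ℤ) + 1) + F (-((n : ℤ) + 1))) (a - F 0) := by
  have h1 := (hasSum_nat_add_iff' 1).2 h.nat_add_neg
  simp only [Finset.range_one, Finset.sum_singleton, Nat.cast_zero, neg_zero, Nat.cast_add,
    Nat.cast_one] at h1
  have e : a + F 0 - (F 0 + F 0) = a - F 0 := by ring
  rwa [e] at h1

variable {I : Finset Nat.Primes} {q : ℝ}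

/-- Admissibility is used here: no nonzero multiple of log p meets a multiple of log q, so the
primes contribute nothing at these frequencies. -/
lemma coeffL_weilSymbol_int (hq : q ∈ admissible I) (j : ℤ) :
    coeffL (j * Real.log q) (weilSymbol I q) =
      archCoeff q j + if j = 0 then (archConst q : ℂ) else 0 := by
  rw [weilSymbol, map_add, coeffL_archSymbol_int hq.1 hq.2.1, map_sum, Finset.sum_eq_zero, add_zero]
  intro p hp
  exact coeffL_primeLogDeriv_eq_zero p.2 fun k hk => int_mul_log_ne_zero hq hp (Or.inr hk)

/-- At a nonzero multiple of log p neither the q-part nor another prime has a frequency. -/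
lemma coeffL_weilSymbol_prime (hq : q ∈ admissible I) {p : Nat.Primes} (hp : p ∈ I) {m : ℝ} (n : ℕ)
    (hm : m = (n + 1) * Real.log ((p : ℕ) : ℝ) ∨ m = -((n + 1) * Real.log ((p : ℕ) : ℝ))) :
    coeffL m (weilSymbol I q) = primeCoeff p n := by
  obtain ⟨j, hj0, hj⟩ : ∃ j : ℤ, j ≠ 0 ∧ m = j * Real.log ((p : ℕ) : ℝ) := by
    rcases hm with h | h
    · exact ⟨(n : ℤ) + 1, by omega, by rw [h]; push_cast; ring⟩
    · exact ⟨-((n : ℤ) + 1), by omega, by rw [h]; push_cast; ring⟩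
  rw [weilSymbol, map_add, coeffL_archSymbol_eq_zero hq.1 hq.2.1 (fun k => by
    rw [hj, add_comm]; exact int_mul_log_ne_zero hq hp (Or.inr hj0)), zero_add, map_sum,
    Finset.sum_eq_single_of_mem p hp, coeffL_primeLogDeriv_of_abs p.2 n hm]
  intro p' _ hne
  refine coeffL_primeLogDeriv_eq_zero p'.2 fun k _ => ?_
  rw [hj]
  exact int_mul_log_prime_ne_zero p.2 p'.2 (fun h => hne (Subtype.ext h.symm)) hj0

lemma critFourier_zero_eq_ofReal (f : ℝ → ℂ) : critFourier f 0 = ((critFourier f 0).re : ℂ) := by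
  rw [critFourier_zero, Complex.ofReal_re]

lemma critFourier_add_neg (f : ℝ → ℂ) (u : ℝ) :
    critFourier f u + critFourier f (-u) = ((2 * (critFourier f u).re : ℝ) : ℂ) := by
  rw [critFourier_neg, Complex.add_conj]

/-- The symbol has the same coefficient at both frequencies ±(n+1) log p, so pairing them reproduces
the series of W_p term by term, without any limit. Subtracting the constant g(1) removes the
frequency 0, which the q-part carries. -/
lemma IsTest.expectL_prime (hf : IsTest f) (hq : q ∈ admissible I) {p : Nat.Primes} (hp : p ∈ I) :
    expectL ((latticeMellin (((p : ℕ) : ℝ)⁻¹) (autoConv f) -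
      autoConv f 1 • (1 : C(Bohr, ℂ))) * weilSymbol I q) =
      weilTerm (zetaFactor p) (autoConv f) := by
  have hp0 : (0 : ℝ) < ((p : ℕ) : ℝ) := by exact_mod_cast p.2.pos
  have hp1 : ((p : ℕ) : ℝ)⁻¹ ≠ 1 := by
    rw [Ne, inv_eq_one]
    exact_mod_cast p.2.one_lt.ne'
  have h1 := hasSum_expectL_mul (hf.hasSum_latticeMellin (inv_pos.2 hp0) hp1) (weilSymbol I q)
  have h2 := hasSum_nat_of_hasSum_int h1
  have e0 : critFourier f (((0 : ℤ) : ℝ) * Real.log ((p : ℕ) : ℝ)⁻¹) *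
      coeffL (((0 : ℤ) : ℝ) * Real.log ((p : ℕ) : ℝ)⁻¹) (weilSymbol I q) =
      expectL ((autoConv f 1 • (1 : C(Bohr, ℂ))) * weilSymbol I q) := by
    rw [smul_mul_assoc, map_smul, smul_eq_mul, hf.autoConv_one, Int.cast_zero, zero_mul,
      coeffL_apply, T_zero]
  rw [e0, ← map_sub, ← sub_mul] at h2
  refine h2.unique ?_
  refine (weilTerm_zetaFactor hf p.2).congr_fun fun n => ?_
  have hl : Real.log ((p : ℕ) : ℝ)⁻¹ = -Real.log ((p : ℕ) : ℝ) := Real.log_inv _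
  rw [coeffL_weilSymbol_prime hq hp n (Or.inr (by rw [hl]; push_cast; ring)),
    coeffL_weilSymbol_prime hq hp n (Or.inl (by rw [hl]; push_cast; ring)), weilCoeff, primeCoeff]
  have hpow : (((p : ℕ) ^ (n + 1) : ℕ) : ℝ) ^ (-(1 / 2) : ℝ) =
      ((p : ℕ) : ℝ) ^ (-((n : ℝ) + 1) / 2) := by
    rw [Nat.cast_pow, ← Real.rpow_natCast, ← Real.rpow_mul hp0.le]
    push_cast
    ring_nf
  have a1 : (((n : ℤ) + 1 : ℤ) : ℝ) * Real.log ((p : ℕ) : ℝ)⁻¹ =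
      -Real.log (((p : ℕ) ^ (n + 1) : ℕ) : ℝ) := by
    rw [hl, Nat.cast_pow, Real.log_pow]; push_cast; ring
  have a2 : ((-((n : ℤ) + 1) : ℤ) : ℝ) * Real.log ((p : ℕ) : ℝ)⁻¹ =
      Real.log (((p : ℕ) ^ (n + 1) : ℕ) : ℝ) := by
    rw [hl, Nat.cast_pow, Real.log_pow]; push_cast; ring
  rw [a1, a2, hpow]
  ring

/-- The frequency 0 contributes c (log π + log(1 - q²)). Writing log(1 - q²) = -∑ q^{2k}/k and
attaching the k-th term to the frequencies ±k log q supplies the subtracted part of `archKernel` at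
u = hk; the total is a Riemann sum of step h = -log q. -/
lemma IsTest.expectL_arch (hf : IsTest f) (hq : q ∈ admissible I) :
    expectL (latticeMellin q (autoConv f) * weilSymbol I q) =
      (((critFourier f 0).re * Real.log Real.pi +
        -Real.log q * ∑' k : ℕ, archKernel f (-Real.log q * (k + 1)) : ℝ) : ℂ) := by
  have hq0 := hq.1
  have hq1 := hq.2.1
  have hh : 0 < -Real.log q := neg_pos.2 (Real.log_neg hq0 hq1)
  set h := -Real.log q with hdef
  set c := (critFourier f 0).re
  obtain ⟨C, -, hC⟩ := hf.exists_abs_archKernel_le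
  have hK := (mul_tsum_eq_integral_ceil hC hh).2
  have hlog : HasSum (fun n : ℕ => h * (c * (Real.exp (-2 * (h * (n + 1))) / (h * (n + 1)))))
      (-(c * Real.log (1 - q ^ 2))) := by
    have h1 := (Real.hasSum_pow_div_log_of_abs_lt_one (x := q ^ 2) (by
      rw [abs_of_nonneg (sq_nonneg q)]
      exact pow_lt_one₀ hq0.le hq1 two_ne_zero)).mul_left c
    rw [mul_neg] at h1
    refine h1.congr_fun fun n => ?_
    have e : Real.exp (-2 * (h * (n + 1))) = (q ^ 2) ^ (n + 1) := by
      have : Real.exp (-2 * (h * (n + 1))) = Real.exp (Real.log q) ^ (2 * (n + 1)) := by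
        rw [← Real.exp_nat_mul]
        congr 1
        rw [hdef]; push_cast; ring
      rw [this, Real.exp_log hq0, pow_mul]
    rw [e]
    field_simp
  have hsum := hK.add hlog
  have h1 := hasSum_expectL_mul (hf.hasSum_latticeMellin hq0 hq1.ne) (weilSymbol I q)
  have h2 := hasSum_nat_of_hasSum_int h1
  simp only [coeffL_weilSymbol_int hq] at h2
  rw [if_pos trivial, Int.cast_zero, zero_mul, critFourier_zero_eq_ofReal] at h2
  have h3 := (Complex.hasSum_ofReal.2 hsum).congr_fun (g := fun n : ℕ =>
      critFourier f ((((n : ℤ) + 1 : ℤ) : ℝ) * Real.log q) *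
        (archCoeff q ((n : ℤ) + 1) + if (n : ℤ) + 1 = 0 then (archConst q : ℂ) else 0) +
      critFourier f (((-((n : ℤ) + 1) : ℤ) : ℝ) * Real.log q) *
        (archCoeff q (-((n : ℤ) + 1)) + if -((n : ℤ) + 1) = 0 then (archConst q : ℂ) else 0))
    fun n => by
      have n1 : ¬ ((n : ℤ) + 1 = 0) := by omega
      have n2 : ¬ (-((n : ℤ) + 1) = 0) := by omega
      have a1 : (((n : ℤ) + 1 : ℤ) : ℝ) * Real.log q = -(h * (n + 1)) := by
        rw [hdef]; push_cast; ring
      have a2 : ((-((n : ℤ) + 1) : ℤ) : ℝ) * Real.log q = h * (n + 1) := by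
        rw [hdef]; push_cast; ring
      rw [if_neg n1, if_neg n2, a1, a2, archCoeff_neg, add_zero, ← add_mul, add_comm (critFourier f _),
        critFourier_add_neg, archCoeff_natCast_succ hq0, ← hdef, ← Complex.ofReal_mul]
      congr 1
      rw [archKernel, symFourier]
      ring
  have h4 := h2.unique h3
  have h5 : archCoeff q 0 = 0 := if_pos rfl
  rw [h5, zero_add, sub_eq_iff_eq_add] at h4
  rw [h4, ← Complex.ofReal_mul, ← Complex.ofReal_add]
  congr 1
  have h6 : h * ∑' k : ℕ, archKernel f (h * (k + 1)) =
      ∫ u in Ioi (0 : ℝ), archKernel f (h * ⌈u / h⌉₊) := by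
    rw [← tsum_mul_left, hK.tsum_eq]
  rw [h6, archConst]
  ring

lemma weilOpOne_ae (I : Finset Nat.Primes) (q : ℝ) :
    (fun χ => weilOpOne I q χ) =ᵐ[haar] fun χ => weilSymbol I q χ := by
  have h1 : weilOpOne I q = (ContinuousLinearMap.mul ℂ ℂ).holder 2
      (ContinuousMap.toLp ∞ haar ℂ (weilSymbol I q))
      (ContinuousMap.toLp 2 haar ℂ (1 : C(Bohr, ℂ))) := rfl
  rw [h1]
  filter_upwards [(ContinuousLinearMap.mul ℂ ℂ).coeFn_holder (r := 2)
    (ContinuousMap.toLp ∞ haar ℂ (weilSymbol I q))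
    (ContinuousMap.toLp 2 haar ℂ (1 : C(Bohr, ℂ))),
    ContinuousMap.coeFn_toLp (p := ∞) (𝕜 := ℂ) haar (weilSymbol I q),
    ContinuousMap.coeFn_toLp (p := 2) (𝕜 := ℂ) haar (1 : C(Bohr, ℂ))] with χ h2 h3 h4
  rw [h2, h3, h4]
  simp

lemma weilExpect_eq_expectL (I : Finset Nat.Primes) (q : ℝ) (g : ℝ → ℂ) :
    weilExpect I q g = expectL (totalMellin I q g * weilSymbol I q) := by
  rw [weilExpect, expect, expectL_apply]
  refine integral_congr_ae ?_
  filter_upwards [weilOpOne_ae I q] with χ hχ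
  rw [hχ]; rfl

/-- The expectation as a sum of Weil terms and a Riemann sum for the archimedean term. -/
lemma IsTest.weilExpect_eq (hf : IsTest f) (hq : q ∈ admissible I) :
    weilExpect I q (autoConv f) = ∑ p ∈ I, weilTerm (zetaFactor p) (autoConv f) +
      (((critFourier f 0).re * Real.log Real.pi +
        -Real.log q * ∑' k : ℕ, archKernel f (-Real.log q * (k + 1)) : ℝ) : ℂ) := by
  rw [weilExpect_eq_expectL, totalMellin, add_mul, map_add, hf.expectL_arch hq, finMellin,
    Finset.sum_mul, map_sum]
  congr 1
  exact Finset.sum_congr rfl fun p hp => hf.expectL_prime hq hp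

/-- The Fourier coefficients are real and even, so the symbol is a real function and the conjugation
in the covariance has no effect. -/
lemma star_weilSymbol (hq : q ∈ admissible I) : star (weilSymbol I q) = weilSymbol I q := by
  have h1 := hasSum_archSymbol hq.1 hq.2.1
  have hA : star (archSymbol q) = archSymbol q := by
    have h2 := h1.star
    have h3 : HasSum (fun k : ℤ => star (archCoeff q k • T (k * Real.log q)))
        (archSymbol q - (archConst q : ℂ) • 1) := by
      refine (((Equiv.neg ℤ).hasSum_iff).2 h1).congr_fun fun k => ?_
      have hreal : star (archCoeff q k) = archCoeff q k := by
        rw [archCoeff]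
        split_ifs
        · exact star_zero _
        · exact Complex.conj_ofReal _
      rw [star_smul, star_T, hreal, Function.comp_apply, Equiv.neg_apply, archCoeff_neg, Int.cast_neg,
        neg_mul]
    have h4 := h2.unique h3
    rw [star_sub, star_smul, star_one] at h4
    have h5 : star (archConst q : ℂ) = (archConst q : ℂ) := Complex.conj_ofReal _
    rw [h5] at h4
    exact sub_left_injective h4
  rw [weilSymbol, star_add, hA, star_sum]
  congr 1
  refine Finset.sum_congr rfl fun p _ => ?_
  rw [star_add, star_star, add_comm]

lemma expectL_weilSymbol (hq : q ∈ admissible I) : expectL (weilSymbol I q) = (archConst q : ℂ) := by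
  have h := coeffL_weilSymbol_int hq 0
  rw [Int.cast_zero, zero_mul, coeffL_apply, T_zero, one_mul, if_pos rfl, archCoeff, if_pos rfl,
    zero_add] at h
  exact h

lemma IsTest.expectL_latticeMellin (hf : IsTest f) {r : ℝ} (hr : 0 < r) (hr1 : r ≠ 1) :
    expectL (latticeMellin r (autoConv f)) = autoConv f 1 := by
  classical
  have hlog : Real.log r ≠ 0 := Real.log_ne_zero_of_pos_of_ne_one hr hr1
  have h1 := (hf.hasSum_latticeMellin hr hr1).mapL expectL
  have h2 := hasSum_single (f := fun k : ℤ =>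
    expectL (critFourier f (k * Real.log r) • T (k * Real.log r))) 0 fun k hk => by
      rw [map_smul, expectL_T, if_neg (by simp [hk, hlog]), smul_zero]
  rw [h1.unique h2, Int.cast_zero, zero_mul, map_smul, expectL_T, if_pos rfl, smul_eq_mul, mul_one,
    hf.autoConv_one]

/-- Only the frequency 0 has a mean, and its coefficient g(1) is counted once, by the q-part. -/
lemma IsTest.expectL_totalMellin (hf : IsTest f) (hq : q ∈ admissible I) :
    expectL (totalMellin I q (autoConv f)) = autoConv f 1 := by
  rw [totalMellin, map_add, hf.expectL_latticeMellin hq.1 hq.2.1.ne, finMellin, map_sum,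
    Finset.sum_eq_zero, zero_add]
  intro p _
  have hp0 : (0 : ℝ) < ((p : ℕ) : ℝ) := by exact_mod_cast p.2.pos
  have hp1 : ((p : ℕ) : ℝ)⁻¹ ≠ 1 := by
    rw [Ne, inv_eq_one]
    exact_mod_cast p.2.one_lt.ne'
  rw [map_sub, hf.expectL_latticeMellin (inv_pos.2 hp0) hp1, map_smul, ← T_zero, expectL_T,
    if_pos rfl, smul_eq_mul, mul_one, sub_self]

lemma IsTest.weilCovar_eq (hf : IsTest f) (hq : q ∈ admissible I) :
    weilCovar I q (autoConv f) =
      weilExpect I q (autoConv f) - (((critFourier f 0).re * archConst q : ℝ) : ℂ) := by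
  have h1 : expect (fun χ => totalMellin I q (autoConv f) χ *
      (starRingEnd ℂ) (weilOpOne I q χ)) = weilExpect I q (autoConv f) := by
    rw [weilExpect_eq_expectL, expect, expectL_apply]
    refine integral_congr_ae ?_
    filter_upwards [weilOpOne_ae I q] with χ hχ
    rw [hχ]
    have : (starRingEnd ℂ) (weilSymbol I q χ) = weilSymbol I q χ :=
      congrArg (fun S : C(Bohr, ℂ) => S χ) (star_weilSymbol hq)
    rw [this]; rfl
  have h2 : expect (fun χ => weilOpOne I q χ) = (archConst q : ℂ) := by
    rw [← expectL_weilSymbol hq, expect, expectL_apply]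
    exact integral_congr_ae (weilOpOne_ae I q)
  have h3 : expect (fun χ => totalMellin I q (autoConv f) χ) = critFourier f 0 := by
    rw [← hf.autoConv_one, ← hf.expectL_totalMellin hq]; rfl
  rw [weilCovar, covar, h1, h2, h3, Complex.conj_ofReal, Complex.ofReal_mul,
    ← critFourier_zero_eq_ofReal]

end

/-! ### Admissible parameters -/

/-- The excluded q in (0, 1) are among the numbers exp(r log p) with r rational and p in I, a
countable set, whose complement is dense. -/
lemma neBot_nhdsWithin_admissible (I : Finset Nat.Primes) : (𝓝[admissible I] (1 : ℝ)).NeBot := by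
  rw [← mem_closure_iff_nhdsWithin_neBot]
  set B : Set ℝ := ⋃ p ∈ I, range fun r : ℚ => Real.exp (r * Real.log ((p : ℕ) : ℝ))
  have hB : B.Countable := I.countable_toSet.biUnion fun p _ => countable_range _
  have hsub : Ioo 0 1 ∩ Bᶜ ⊆ admissible I := by
    rintro q ⟨hq, hqB⟩
    refine ⟨hq.1, hq.2, fun p hp => ?_⟩
    rintro ⟨r, hr⟩
    refine hqB (mem_iUnion₂.2 ⟨p, hp, r, ?_⟩)
    have hlog : Real.log ((p : ℕ) : ℝ) ≠ 0 :=
      (Real.log_pos (by exact_mod_cast p.2.one_lt)).ne'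
    change Real.exp (r * Real.log ((p : ℕ) : ℝ)) = q
    rw [hr, div_mul_cancel₀ _ hlog, Real.exp_log hq.1]
  have h1 : closure (Ioo (0 : ℝ) 1) ⊆ closure (admissible I) :=
    closure_minimal (((hB.dense_compl ℝ).open_subset_closure_inter isOpen_Ioo).trans
      (closure_mono hsub)) isClosed_closure
  rw [closure_Ioo zero_ne_one] at h1
  exact h1 ⟨zero_le_one, le_rfl⟩

lemma exists_seq_admissible {I : Finset Nat.Primes} {P : ℝ → Prop}
    (h : ∀ᶠ q in 𝓝[admissible I] 1, P q) :
    ∃ q : ℕ → ℝ, (∀ n, q n ∈ admissible I) ∧ Tendsto q atTop (𝓝 1) ∧ ∀ n, P (q n) := by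
  have := neBot_nhdsWithin_admissible I
  obtain ⟨q, hq, hP⟩ := exists_seq_forall_of_frequently (h.and self_mem_nhdsWithin).frequently
  exact ⟨q, fun n => (hP n).2, hq.mono_right nhdsWithin_le_nhds, fun n => (hP n).1⟩

/-- For a prime p > b/a every p^k with k ≠ 0 lies outside the support [a/b, b/a]. -/
lemma IsTest.exists_inClass {f : ℝ → ℂ} (hf : IsTest f) :
    ∃ I : Finset Nat.Primes, InClass I (autoConv f) := by
  obtain ⟨a, b, ha, hab, hs⟩ := hf.exists_suppIn
  obtain ⟨N, hN⟩ := exists_nat_gt (b / a)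
  have hfin : {p : Nat.Primes | (p : ℕ) < N}.Finite :=
    (finite_Iio N).preimage Subtype.val_injective.injOn
  refine ⟨hfin.toFinset, fun p hp k hk => ?_⟩
  have hpN : N ≤ (p : ℕ) := by simpa using hp
  have hp0 : (0 : ℝ) < ((p : ℕ) : ℝ) := by exact_mod_cast p.2.pos
  have hlogp : 0 < Real.log ((p : ℕ) : ℝ) := Real.log_pos (by exact_mod_cast p.2.one_lt)
  have hba : 0 < b / a := div_pos (ha.trans_le hab) ha
  rw [hf.autoConv_eq (zpow_pos hp0 k), hf.critFourier_eq_zero ha hab hs, mul_zero]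
  rw [Real.log_zpow, abs_mul, abs_of_pos hlogp]
  have h1 : (1 : ℝ) ≤ |(k : ℝ)| := by exact_mod_cast Int.one_le_abs hk
  calc Real.log (b / a) < Real.log ((p : ℕ) : ℝ) :=
        Real.log_lt_log hba (hN.trans_le (by exact_mod_cast hpN))
    _ ≤ |(k : ℝ)| * Real.log ((p : ℕ) : ℝ) := le_mul_of_one_le_left hlogp.le h1

/-! ### Convergence of the expectations to the Weil sum -/

section

variable {f : ℝ → ℂ} {I : Finset Nat.Primes}

lemma IsTest.critFourier_log_eq_zero (hf : IsTest f) {x : ℝ} (hx : 0 < x)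
    (h : autoConv f x = 0) : critFourier f (Real.log x) = 0 := by
  rw [hf.autoConv_eq hx, mul_eq_zero] at h
  exact h.resolve_left (by exact_mod_cast (Real.rpow_pos_of_pos hx _).ne')

lemma IsTest.weilTerm_zetaFactor_eq_zero (hf : IsTest f) (hI : InClass I (autoConv f))
    {p : Nat.Primes} (hp : p ∉ I) : weilTerm (zetaFactor p) (autoConv f) = 0 := by
  refine (weilTerm_zetaFactor hf p.2).unique (hasSum_zero.congr_fun fun k => ?_)
  have hp0 : (0 : ℝ) < ((p : ℕ) : ℝ) := by exact_mod_cast p.2.pos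
  have h1 := hf.critFourier_log_eq_zero (zpow_pos hp0 _) (hI p hp (k + 1) (by omega))
  have h2 := hf.critFourier_log_eq_zero (zpow_pos hp0 _) (hI p hp (-(k + 1)) (by omega))
  rw [Real.log_zpow] at h1 h2
  have e1 : Real.log (((p : ℕ) ^ (k + 1) : ℕ) : ℝ) =
      (((k : ℤ) + 1 : ℤ) : ℝ) * Real.log ((p : ℕ) : ℝ) := by
    rw [Nat.cast_pow, Real.log_pow]; push_cast; ring
  have e2 : -Real.log (((p : ℕ) ^ (k + 1) : ℕ) : ℝ) =
      ((-((k : ℤ) + 1) : ℤ) : ℝ) * Real.log ((p : ℕ) : ℝ) := by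
    rw [Nat.cast_pow, Real.log_pow]; push_cast; ring
  rw [weilCoeff, e2, h2, e1, h1, add_zero, mul_zero]

lemma IsTest.weilSum_eq_finsetSum (hf : IsTest f) (hI : InClass I (autoConv f)) :
    weilSum (autoConv f) = ∑ p ∈ I, weilTerm (zetaFactor p) (autoConv f) +
      (((critFourier f 0).re * Real.log Real.pi + ∫ u in Ioi (0 : ℝ), archKernel f u : ℝ) : ℂ) := by
  rw [weilSum, tsum_eq_sum fun p hp => hf.weilTerm_zetaFactor_eq_zero hI hp,
    hf.weilTerm_Gammaℝ_eq, add_comm]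

/-- The expected values converge to the Weil sum. -/
theorem IsTest.tendsto_weilExpect (hf : IsTest f) (hI : InClass I (autoConv f)) :
    Tendsto (fun q => weilExpect I q (autoConv f)) (𝓝[admissible I] 1)
      (𝓝 (weilSum (autoConv f))) := by
  obtain ⟨C, -, hC⟩ := hf.exists_abs_archKernel_le
  have hlog : Tendsto (fun q => -Real.log q) (𝓝[admissible I] 1) (𝓝[>] 0) := by
    refine tendsto_nhdsWithin_iff.2 ⟨?_, ?_⟩
    · have : Tendsto (fun q => -Real.log q) (𝓝 1) (𝓝 (-Real.log 1)) :=
        (Real.continuousAt_log one_ne_zero).neg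
      rw [Real.log_one, neg_zero] at this
      exact this.mono_left nhdsWithin_le_nhds
    · filter_upwards [self_mem_nhdsWithin] with q hq
      exact neg_pos.2 (Real.log_neg hq.1 hq.2.1)
  have h1 := (tendsto_riemannSum hf.continuousOn_archKernel hC).comp hlog
  have h2 := (Complex.continuous_ofReal.tendsto _).comp
    (h1.const_add ((critFourier f 0).re * Real.log Real.pi))
  have h3 := h2.const_add (∑ p ∈ I, weilTerm (zetaFactor p) (autoConv f))
  rw [hf.weilSum_eq_finsetSum hI]
  refine h3.congr' ?_
  filter_upwards [self_mem_nhdsWithin] with q hq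
  rw [hf.weilExpect_eq hq]
  rfl

end

/-! ### The norms on the lattices `q ^ ℤ` -/

section

variable {f : ℝ → ℂ}

/-- φ(0) = g(1), and the convolution at 1 is ∫ f(y) conj f(y) dy. -/
lemma IsTest.critFourier_zero_re (hf : IsTest f) :
    (critFourier f 0).re = ∫ x in Ioi (0 : ℝ), ‖f x‖ ^ 2 := by
  have h : critFourier f 0 = ((∫ x in Ioi (0 : ℝ), ‖f x‖ ^ 2 : ℝ) : ℂ) := by
    rw [← hf.autoConv_one, autoConv, mulConv, ← integral_complex_ofReal]
    refine setIntegral_congr_fun measurableSet_Ioi fun y hy => ?_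
    have hy0 : (y : ℂ) ≠ 0 := by exact_mod_cast (mem_Ioi.1 hy).ne'
    simp only [starConj, one_div, inv_inv, Complex.ofReal_inv]
    rw [Complex.ofReal_pow, ← Complex.mul_conj']
    field_simp
  rw [h, Complex.ofReal_re]

lemma iUnion_Ioc_zpow {q : ℝ} (hq : 0 < q) (hq1 : q < 1) :
    ⋃ k : ℤ, Ioc (q ^ (k + 1)) (q ^ k) = Ioi 0 := by
  ext x
  rw [mem_iUnion, mem_Ioi]
  refine ⟨fun ⟨k, hk⟩ => (zpow_pos hq _).trans hk.1, fun hx => ?_⟩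
  obtain ⟨n, hn⟩ := exists_mem_Ioc_zpow hx ((one_lt_inv₀ hq).2 hq1)
  rw [inv_zpow', inv_zpow'] at hn
  refine ⟨-(n + 1), ?_⟩
  rwa [neg_add, neg_add_cancel_right, ← neg_add]

/-- A Riemann sum of |f|², which is Lipschitz with compact support, over the cells (q^{k+1}, q^k] of
length (1 - q) q^k. The rate O(1 - q) matters because the error is later multiplied by log(1 - q).
-/
lemma IsTest.exists_abs_qNormSq_sub_le (hf : IsTest f) :
    ∃ C, ∀ q : ℝ, 1 / 2 < q → q < 1 → |qNormSq q f - (critFourier f 0).re| ≤ C * (1 - q) := by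
  obtain ⟨a, b, ha, hab, hs⟩ := hf.exists_suppIn
  have hb : 0 < b := ha.trans_le hab
  set φ : ℝ → ℝ := fun x => ‖f x‖ ^ 2
  have hcomp : HasCompactSupport φ :=
    hf.compact.comp_left (g := fun z : ℂ => ‖z‖ ^ 2) (by simp)
  have hsmooth : ContDiff ℝ ∞ φ := hf.smooth.norm_sq ℝ
  obtain ⟨L, hL⟩ := hsmooth.lipschitzWith_of_hasCompactSupport hcomp (by simp)
  have hφ0 : ∀ x, b < x → φ x = 0 := fun x hx => by
    have : f x = 0 := hs x fun h => absurd h.2 (not_le.2 hx)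
    simp [φ, this]
  -- As q > 1/2, a cell containing some x ≤ 2b has q^k ≤ 4b, which bounds its length by 4b(1 - q).
  -- For x > 2b both values of |f|² vanish.
  set Ψ : ℝ → ℝ := (Icc 0 (2 * b)).indicator fun _ => L * (4 * b)
  have hΨ : Integrable Ψ := (integrable_indicator_iff measurableSet_Icc).2
    (integrableOn_const (measure_Icc_lt_top.ne))
  have hφi : Integrable φ := hsmooth.continuous.integrable_of_hasCompactSupport hcomp
  refine ⟨∫ x in Ioi (0 : ℝ), Ψ x, fun q hq hq1 => ?_⟩
  have hq0 : 0 < q := by linarith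
  have hmeas : ∀ k : ℤ, MeasurableSet (Ioc (q ^ (k + 1)) (q ^ k)) := fun k => measurableSet_Ioc
  have hdisj : Pairwise (Function.onFun Disjoint fun k : ℤ => Ioc (q ^ (k + 1)) (q ^ k)) :=
    (zpow_right_anti₀ hq0 hq1.le).pairwise_disjoint_on_Ioc_succ
  have h1 := hasSum_integral_iUnion hmeas hdisj hφi.integrableOn
  have h2 := hasSum_integral_iUnion hmeas hdisj hΨ.integrableOn
  rw [iUnion_Ioc_zpow hq0 hq1] at h1 h2
  obtain ⟨K, hK⟩ := hs.exists_zpow_eq_zero ha hq0 hq1.ne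
  have h3 : HasSum (fun k : ℤ => φ (q ^ k) * ((1 - q) * q ^ k)) (qNormSq q f) :=
    (summable_of_ne_finset_zero (s := Finset.Icc (-K) K) fun k hk => by
      simp [φ, hK k hk]).hasSum
  rw [hf.critFourier_zero_re, ← (h3.sub h1).tsum_eq, ← Real.norm_eq_abs]
  refine tsum_of_norm_bounded (h2.mul_right (1 - q)) fun k => ?_
  have hqk : 0 < q ^ k := zpow_pos hq0 k
  have hle : q ^ (k + 1) ≤ q ^ k := zpow_le_zpow_right_of_le_one₀ hq0 hq1.le (by omega)
  have hstep : q ^ k - q ^ (k + 1) = (1 - q) * q ^ k := by rw [zpow_add_one₀ hq0.ne']; ring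
  have h4 : φ (q ^ k) * ((1 - q) * q ^ k) - ∫ x in Ioc (q ^ (k + 1)) (q ^ k), φ x =
      ∫ x in Ioc (q ^ (k + 1)) (q ^ k), (φ (q ^ k) - φ x) := by
    rw [integral_sub (integrable_const _) hφi.integrableOn,
      setIntegral_const, Real.volume_real_Ioc_of_le hle, hstep, smul_eq_mul, mul_comm (φ _)]
  rw [h4, ← integral_mul_const]
  refine norm_integral_le_of_norm_le (hΨ.integrableOn.mul_const _)
    ((ae_restrict_iff' measurableSet_Ioc).2 (ae_of_all _ fun x hx => ?_))
  have hx0 : 0 < x := (zpow_pos hq0 _).trans hx.1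
  by_cases hxb : x ≤ 2 * b
  · rw [show Ψ x = L * (4 * b) from indicator_of_mem (mem_Icc.2 ⟨hx0.le, hxb⟩) _]
    have h5 := hL.dist_le_mul (q ^ k) x
    rw [Real.dist_eq, Real.dist_eq, abs_of_nonneg (sub_nonneg.2 hx.2)] at h5
    rw [Real.norm_eq_abs, mul_assoc]
    refine h5.trans (mul_le_mul_of_nonneg_left ?_ L.2)
    have h6 : q ^ k * q < x := by rw [← zpow_add_one₀ hq0.ne']; exact hx.1
    have h7 : q ^ k ≤ 4 * b := by nlinarith
    calc q ^ k - x ≤ (1 - q) * q ^ k := by linarith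
      _ ≤ (1 - q) * (4 * b) := mul_le_mul_of_nonneg_left h7 (by linarith)
      _ = 4 * b * (1 - q) := mul_comm _ _
  · push Not at hxb
    rw [show Ψ x = 0 from indicator_of_notMem (fun h => absurd h.2 (not_le.2 hxb)) _,
      hφ0 x (by linarith), hφ0 (q ^ k) (by linarith [hx.2])]
    simp

variable {I : Finset Nat.Primes}

lemma half_lt_eventually (I : Finset Nat.Primes) : ∀ᶠ q in 𝓝[admissible I] 1, (1 / 2 : ℝ) < q :=
  nhdsWithin_le_nhds (lt_mem_nhds (by norm_num))

lemma IsTest.tendsto_qNormSq (hf : IsTest f) :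
    Tendsto (fun q => qNormSq q f) (𝓝[admissible I] 1) (𝓝 (critFourier f 0).re) := by
  obtain ⟨C, hC⟩ := hf.exists_abs_qNormSq_sub_le
  have h0 : Tendsto (fun q : ℝ => C * (1 - q)) (𝓝[admissible I] 1) (𝓝 0) := by
    have : Continuous fun q : ℝ => C * (1 - q) := by fun_prop
    simpa using (this.tendsto 1).mono_left nhdsWithin_le_nhds
  rw [tendsto_iff_norm_sub_tendsto_zero]
  refine squeeze_zero' (Eventually.of_forall fun _ => norm_nonneg _) ?_ h0
  filter_upwards [half_lt_eventually I, self_mem_nhdsWithin] with q h1 h2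
  exact hC q h1 h2.2.1

lemma IsTest.tendsto_qNormSq_sub_mul_log (hf : IsTest f) :
    Tendsto (fun q => (qNormSq q f - (critFourier f 0).re) * Real.log (1 - q))
      (𝓝[admissible I] 1) (𝓝 0) := by
  obtain ⟨C, hC⟩ := hf.exists_abs_qNormSq_sub_le
  have h0 : Tendsto (fun q : ℝ => C * |(1 - q) * Real.log (1 - q)|) (𝓝[admissible I] 1) (𝓝 0) := by
    have : Continuous fun q : ℝ => C * |(1 - q) * Real.log (1 - q)| :=
      ((Real.continuous_mul_log.comp (continuous_const.sub continuous_id)).abs).const_mul C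
    simpa using (this.tendsto 1).mono_left nhdsWithin_le_nhds
  rw [tendsto_zero_iff_norm_tendsto_zero]
  refine squeeze_zero' (Eventually.of_forall fun _ => norm_nonneg _) ?_ h0
  filter_upwards [half_lt_eventually I, self_mem_nhdsWithin] with q h1 h2
  rw [Real.norm_eq_abs, abs_mul, abs_mul, abs_of_pos (sub_pos.2 h2.2.1), ← mul_assoc]
  exact mul_le_mul_of_nonneg_right (hC q h1 h2.2.1) (abs_nonneg _)

/-- The covariances, compensated by the norms on the lattices, converge to the Weil sum. -/
theorem IsTest.tendsto_weilCovar_sub (hf : IsTest f) (hI : InClass I (autoConv f)) :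
    Tendsto (fun q => (weilCovar I q (autoConv f)).re -
        qNormSq q f * Real.log ((1 - q)⁻¹ / (2 * Real.pi)))
      (𝓝[admissible I] 1) (𝓝 (weilSum (autoConv f)).re) := by
  set c := (critFourier f 0).re with hc
  have h1 := (Complex.continuous_re.tendsto _).comp (hf.tendsto_weilExpect hI)
  have h2 := hf.tendsto_qNormSq_sub_mul_log (I := I)
  have h3 := (hf.tendsto_qNormSq (I := I)).mul_const (Real.log (2 * Real.pi))
  -- Since log(1 - q²) = log(1 - q) + log(1 + q), the divergent logarithm is absorbed by the squared
  -- norm up to the error in `h2`. What is left are the constants c(log π + log 2) here and c log 2π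
  -- in `h3`, which cancel.
  have h4 : Tendsto (fun q : ℝ => c * (Real.log Real.pi + Real.log (1 + q))) (𝓝[admissible I] 1)
      (𝓝 (c * Real.log (2 * Real.pi))) := by
    have : ContinuousAt (fun q : ℝ => c * (Real.log Real.pi + Real.log (1 + q))) 1 := by
      refine ContinuousAt.mul continuousAt_const (continuousAt_const.add ?_)
      exact ContinuousAt.log (by fun_prop) (by norm_num)
    have h := this.tendsto.mono_left (nhdsWithin_le_nhds (s := admissible I))
    rwa [show (1 : ℝ) + 1 = 2 by norm_num, add_comm, ← Real.log_mul two_ne_zero Real.pi_ne_zero] at h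
  have h5 := (h1.add h2).add (h3.sub h4)
  rw [sub_self, add_zero, add_zero] at h5
  refine h5.congr' ?_
  filter_upwards [self_mem_nhdsWithin] with q hq
  have hq0 := hq.1
  have hq1 := sub_pos.2 hq.2.1
  have e : (1 : ℝ) - q ^ 2 = (1 - q) * (1 + q) := by ring
  rw [hf.weilCovar_eq hq, Complex.sub_re, Complex.ofReal_re, archConst, e,
    Real.log_mul hq1.ne' (by linarith), Real.log_div (inv_ne_zero hq1.ne') (by positivity),
    Real.log_inv, Function.comp_apply, ← hc]
  ring

end

/-! ### The Riemann hypothesis -/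

lemma autoConv_zero : autoConv 0 = 0 := by
  ext x
  simp [autoConv, mulConv]

lemma totalMellin_zero (I : Finset Nat.Primes) (q : ℝ) : totalMellin I q 0 = 0 := by
  simp [totalMellin, finMellin, latticeMellin]

/-- A criterion for the Riemann hypothesis in terms of functionals that converge to the Weil sum. -/
theorem riemannHypothesis_iff_of_tendsto {D : (ℝ → ℂ) → Finset Nat.Primes → ℝ → ℝ}
    (hD : ∀ f I, IsTest f → InClass I (autoConv f) →
      Tendsto (D f I) (𝓝[admissible I] 1) (𝓝 (weilSum (autoConv f)).re))
    (hD0 : ∀ I q, D 0 I q ≤ 0) :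
    RiemannHypothesis ↔ ∀ (f : ℝ → ℂ) (I : Finset Nat.Primes), IsTest f →
      mellin f 0 = 0 → mellin f 1 = 0 → InClass I (autoConv f) →
      ∃ q : ℕ → ℝ, (∀ n, q n ∈ admissible I) ∧ Tendsto q atTop (𝓝 1) ∧ ∀ n, D f I (q n) ≤ 0 := by
  refine ⟨fun hRH f I hf hf0 hf1 hI => ?_, fun H => ?_⟩
  · refine exists_seq_admissible (P := fun q => D f I q ≤ 0) ?_
    -- For f = 0 the limit is 0 and says nothing about the sign of the approximations; for f ≠ 0
    -- strict negativity of the limit makes them eventually negative.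
    rcases eq_or_ne f 0 with rfl | hne
    · exact Eventually.of_forall fun q => hD0 I q
    · have hneg := weilSum_neg_of_nonpos (fun f hf _ hf1 => hf.weilSum_nonpos hRH hf1) hf hf0 hf1 hne
      exact ((hD f I hf hI).eventually (gt_mem_nhds hneg)).mono fun q hq => hq.le
  · refine riemannHypothesis_of_weilSum_nonpos fun f hf hf0 hf1 => ?_
    obtain ⟨I, hI⟩ := hf.exists_inClass
    obtain ⟨q, hq, hq1, hneg⟩ := H f I hf hf0 hf1 hI
    have h : Tendsto q atTop (𝓝[admissible I] 1) :=
      tendsto_nhdsWithin_iff.2 ⟨hq1, Eventually.of_forall hq⟩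
    exact le_of_tendsto ((hD f I hf hI).comp h) (Eventually.of_forall hneg)

end BohrWeil

end

theorem corollary1 :
    (∀ (f : ℝ → ℂ) (I : Finset Nat.Primes), BohrWeil.IsTest f →
      BohrWeil.InClass I (BohrWeil.autoConv f) →
      (𝓝[BohrWeil.admissible I] (1 : ℝ)).NeBot ∧
      Tendsto (fun q : ℝ => BohrWeil.weilExpect I q (BohrWeil.autoConv f))
        (𝓝[BohrWeil.admissible I] 1) (𝓝 (BohrWeil.weilSum (BohrWeil.autoConv f)))) ∧
    (RiemannHypothesis ↔
      ∀ (f : ℝ → ℂ) (I : Finset Nat.Primes), BohrWeil.IsTest f →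
        mellin f 0 = 0 → mellin f 1 = 0 → BohrWeil.InClass I (BohrWeil.autoConv f) →
        ∃ q : ℕ → ℝ, (∀ n, q n ∈ BohrWeil.admissible I) ∧ Tendsto q atTop (𝓝 1) ∧
          ∀ n, (BohrWeil.weilExpect I (q n) (BohrWeil.autoConv f)).re ≤ 0) ∧
    (RiemannHypothesis ↔
      ∀ (f : ℝ → ℂ) (I : Finset Nat.Primes), BohrWeil.IsTest f →
        mellin f 0 = 0 → mellin f 1 = 0 → BohrWeil.InClass I (BohrWeil.autoConv f) →
        ∃ q : ℕ → ℝ, (∀ n, q n ∈ BohrWeil.admissible I) ∧ Tendsto q atTop (𝓝 1) ∧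
          ∀ n, (BohrWeil.weilCovar I (q n) (BohrWeil.autoConv f)).re ≤
            BohrWeil.qNormSq (q n) f * Real.log ((1 - q n)⁻¹ / (2 * Real.pi))) := by
  refine ⟨fun f I hf hI => ⟨BohrWeil.neBot_nhdsWithin_admissible I, hf.tendsto_weilExpect hI⟩, ?_, ?_⟩
  · refine BohrWeil.riemannHypothesis_iff_of_tendsto
      (D := fun f I q => (BohrWeil.weilExpect I q (BohrWeil.autoConv f)).re)
      (fun f I hf hI => (Complex.continuous_re.tendsto _).comp (hf.tendsto_weilExpect hI))
      fun I q => ?_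
    simp [BohrWeil.autoConv_zero, BohrWeil.weilExpect, BohrWeil.totalMellin_zero, BohrWeil.expect]
  · have h := BohrWeil.riemannHypothesis_iff_of_tendsto
      (D := fun f I q => (BohrWeil.weilCovar I q (BohrWeil.autoConv f)).re -
        BohrWeil.qNormSq q f * Real.log ((1 - q)⁻¹ / (2 * Real.pi)))
      (fun f I hf hI => hf.tendsto_weilCovar_sub hI) fun I q => by
        simp [BohrWeil.autoConv_zero, BohrWeil.weilCovar, BohrWeil.covar, BohrWeil.totalMellin_zero,
          BohrWeil.expect, BohrWeil.qNormSq]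
    simpa only [sub_nonpos] using h
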